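/- Let $\mathfrak g$ be a symmetrizable Kac--Moody algebra with finite totally ordered index set $I$, simple roots $\alpha_i$, simple coroots $\alpha_i^\vee$, weight lattice $P$, fundamental weights $\Lambda_i$, $\rho=\sum_i\Lambda_i$, Weyl group $W$, and let $\Phi^+$ be the set of positive real roots, with coroots $\beta^\vee$ and reflections $s_\beta$. For dominant $\lambda$, the lex $\lambda$-chain $\Gamma_\lambda$ is the set of pairs $(\beta,h)$ with $\beta\in\Phi^+$, $0\le h<\langle\lambda,\beta^\vee\rangle$, ordered by comparing the vectors $\frac1{\langle\lambda,\beta^\vee\rangle}(h,c_1,\dots,c_n)$ lexicographically, where $\beta^\vee=\sum_i c_i\alpha_i^\vee$. The $\infty$-chain is $\cdots*\Gamma_\rho*\Gamma_\rho$, the elements of the $q$-th block from the right ($q\ge1$) being labelled $(\beta,h-q\langle\rho,\beta^\vee\rangle)$. A finite increasing sequence $J=((\zeta_1,\ell_1)<\dots<(\zeta_p,\ell_p))$ in a chain is admissible if $1\lessdot s_{\zeta_1}\lessdot s_{\zeta_1}s_{\zeta_2}\lessdot\cdots\lessdot s_{\zeta_1}\cdots s_{\zeta_p}=:\tau(J)$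 are covers in the Bruhat order of $W$. Let $\mathcal A(\lambda)$ and $\mathcal A(\infty)$ be the sets of admissible sequences of $\Gamma_\lambda$ and of the $\infty$-chain. For a position $x=(\beta,\ell)$ put $\gamma_x=s_{\zeta_1}\cdots s_{\zeta_t}(\beta)$, where $(\zeta_1,\ell_1),\dots,(\zeta_t,\ell_t)$ are the elements of $J$ that precede $x$, and let $I_{\alpha_i}=\{x\mid\gamma_x=\pm\alpha_i\}$. Write the signs of $\gamma_x$ for $x\in I_{\alpha_i}\setminus J$ from left to right and cancel pairs $-+$ until none remain. If a $+$ remains and $a$ is the rightmost one, $f_iJ$ is obtained from $J$ by adding $a$ and removing the first element of $J\cap I_{\alpha_i}$ to the right of $a$, if any; if no $+$ remains, $f_iJ=0$. If a $-$ remains and $a$ is the leftmost one, $e_iJ$ is obtained by adding $a$ and removing the last element of $J\cap I_{\alpha_i}$ to the left of $a$, if any; if no $-$ remains, $e_iJ$ is obtained by removing the last element of $J\cap I_{\alpha_i}$ if $\langle\tau(J)\rho,\alpha_i^\vee\rangle<0$, and $e_iJ=0$ otherwise. With $s_{\beta,m}$ the reflection in $\{x\mid\langle x,\beta^\vee\rangle=m\}$,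 let $\mathrm{wt}(J)=-s_{\zeta_1,-\ell_1}\cdots s_{\zeta_p,-\ell_p}(-\lambda)$ on $\mathcal A(\lambda)$, and the same with $\lambda=0$ on $\mathcal A(\infty)$. On $\mathcal A(\lambda)$ put $\varepsilon_i(J)=\max\{m\mid e_i^mJ\ne0\}$, $\varphi_i(J)=\max\{m\mid f_i^mJ\neq0\}$; on $\mathcal A(\infty)$ put $\varepsilon_i(J)=\max\{m\mid e_i^mJ\neq0\}$, $\varphi_i(J)=\varepsilon_i(J)+\langle\mathrm{wt}(J),\alpha_i^\vee\rangle$. A morphism of abstract crystals $B_1\to B_2$ is a map $\psi\colon B_1\sqcup\{0\}\to B_2\sqcup\{0\}$ with $\psi(0)=0$ that preserves $\mathrm{wt},\varepsilon_i,\varphi_i$ at every $b\in B_1$ with $\psi(b)\ne0$, and satisfies $\psi(e_ib)=e_i\psi(b)$ whenever both sides are nonzero, and likewise for $f_i$. It is an embedding (a surjection) if it is injective (surjective) on $B_1\sqcup\{0\}\to B_2\sqcup\{0\}$. Let $T_\mu=\{t_\mu\}$ be the crystal with $e_it_\mu=f_it_\mu=0$, $\varepsilon_i(t_\mu)=\varphi_i(t_\mu)=-\infty$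 and $\mathrm{wt}(t_\mu)=\mu$, so that $T_\mu\otimes B$ has the operators of $B$, the same $\varepsilon_i$, and $\varphi_i$, $\mathrm{wt}$ shifted by $\langle\mu,\alpha_i^\vee\rangle$, $\mu$. **Lemma.** For every integer $k\ge0$, $\mathcal A(\infty)$ and $T_{-k\rho}\otimes\mathcal A(k\rho)$ are abstract crystals. The map $S^{\mathrm{pr}}_{k\rho}\colon\mathcal A(\infty)\to T_{-k\rho}\otimes\mathcal A(k\rho)$ that sends $((\zeta_1,\ell_1),\dots,(\zeta_p,\ell_p))$ to $t_{-k\rho}\otimes((\zeta_1,\ell_1+k\langle\rho,\zeta_1^\vee\rangle),\dots,(\zeta_p,\ell_p+k\langle\rho,\zeta_p^\vee\rangle))$ if the result is admissible, and to $0$ otherwise, is a crystal surjection. The map $S^{\mathrm{in}}_{-k\rho}\colon T_{-k\rho}\otimes\mathcal A(k\rho)\to\mathcal A(\infty)$ that sends $t_{-k\rho}\otimes((\zeta_1,\ell_1),\dots,(\zeta_p,\ell_p))$ to $((\zeta_1,\ell_1-k\langle\rho,\zeta_1^\vee\rangle),\dots,(\zeta_p,\ell_p-k\langle\rho,\zeta_p^\vee\rangle))$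 is a crystal embedding. -/

import Mathlib

/-! ## Kac--Moody root data -/

/-- A symmetrizable generalized Cartan matrix together with a realization over `ℤ`: a weight
lattice `P` and a coweight lattice `Pv` in perfect duality, linearly independent simple roots and
simple coroots with `⟨α_i, α_j^∨⟩ = A i j`, and fundamental weights. -/
structure KacMoodyDatum (I P Pv : Type*) [Fintype I] [DecidableEq I]
    [AddCommGroup P] [AddCommGroup Pv] where
  cartan : Matrix I I ℤ
  cartan_diag : ∀ i, cartan i i = 2
  cartan_nonpos : ∀ i j, i ≠ j → cartan i j ≤ 0
  cartan_zero : ∀ i j, cartan i j = 0 → cartan j i = 0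
  symmetrizable : ∃ d : I → ℚ, (∀ i, 0 < d i) ∧
    ∀ i j, d i * (cartan i j : ℚ) = d j * (cartan j i : ℚ)
  pairing : P →ₗ[ℤ] Pv →ₗ[ℤ] ℤ
  perfect : pairing.IsPerfPair
  simpleRoot : I → P
  simpleCoroot : I → Pv
  fundamentalWeight : I → P
  linearIndependent_simpleRoot : LinearIndependent ℤ simpleRoot
  linearIndependent_simpleCoroot : LinearIndependent ℤ simpleCoroot
  pairing_simple : ∀ i j, pairing (simpleRoot i) (simpleCoroot j) = cartan i j
  pairing_fundamentalWeight : ∀ i j,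
    pairing (fundamentalWeight i) (simpleCoroot j) = if i = j then 1 else 0

namespace KacMoodyDatum

section RootDatum

variable {I P Pv : Type*} [Fintype I] [DecidableEq I] [AddCommGroup P] [AddCommGroup Pv]
variable (D : KacMoodyDatum I P Pv)

/-- The weight `ρ`, the sum of the fundamental weights. -/
def rho : P := ∑ i, D.fundamentalWeight i

/-- `D.IsRealRoot β βv`: there are a Weyl group element `w` and an index `i` such that
`β = w α_i` and `βv = w α_i^∨`, that is, `β` is a real root and `βv` is its coroot. -/
inductive IsRealRoot : P → Pv → Prop
  | simple (i : I) : IsRealRoot (D.simpleRoot i) (D.simpleCoroot i)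
  | reflect (j : I) {β : P} {βv : Pv} (h : IsRealRoot β βv) :
      IsRealRoot (β - D.pairing β (D.simpleCoroot j) • D.simpleRoot j)
        (βv - D.pairing (D.simpleRoot j) βv • D.simpleCoroot j)

theorem IsRealRoot.pairing_eq_two {D : KacMoodyDatum I P Pv} {β : P} {βv : Pv}
    (h : D.IsRealRoot β βv) : D.pairing β βv = 2 := by
  induction h with
  | simple i => rw [D.pairing_simple, D.cartan_diag]
  | reflect j h ih =>
    simp only [map_sub, map_smul, LinearMap.sub_apply, LinearMap.smul_apply, ih,
      D.pairing_simple, D.cartan_diag, smul_eq_mul]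
    ring

/-- The positive real roots, each together with its coroot. -/
structure PosRoot where
  root : P
  coroot : Pv
  isRealRoot : D.IsRealRoot root coroot
  positive : root ∈ AddSubmonoid.closure (Set.range D.simpleRoot)

/-- The reflection `s_β : x ↦ x - ⟨x, β^∨⟩ β` of the weight lattice. -/
noncomputable def reflection (β : D.PosRoot) : P ≃ₗ[ℤ] P :=
  Module.reflection (x := β.root) (f := D.pairing.flip β.coroot) β.isRealRoot.pairing_eq_two

theorem simpleRoot_mem (i : I) :
    D.simpleRoot i ∈ AddSubmonoid.closure (Set.range D.simpleRoot) :=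
  AddSubmonoid.subset_closure (Set.mem_range_self i)

/-- The simple root `α_i` as a positive root. -/
def simplePosRoot (i : I) : D.PosRoot :=
  ⟨D.simpleRoot i, D.simpleCoroot i, .simple i, D.simpleRoot_mem i⟩

/-- The simple reflection `s_i`. The Weyl group is the group generated by these. -/
noncomputable def simpleReflection (i : I) : P ≃ₗ[ℤ] P := D.reflection (D.simplePosRoot i)

/-- The length of an element of the Weyl group: the least length of a word in the simple
reflections that represents it. -/
noncomputable def length (w : P ≃ₗ[ℤ] P) : ℕ :=
  sInf {n | ∃ s : List I, s.length = n ∧ (s.map D.simpleReflection).prod = w}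

/-- The covering relation `u ⋖ v` of the (strong) Bruhat order on the Weyl group. -/
def BruhatCover (u v : P ≃ₗ[ℤ] P) : Prop :=
  (∃ β : D.PosRoot, v = u * D.reflection β) ∧ D.length v = D.length u + 1

/-- A pair `(β, ℓ)` of a positive root and a level. -/
abbrev Position := D.PosRoot × ℤ

/-- The affine reflection `s_{β, -ℓ}` in the hyperplane `⟨x, β^∨⟩ = -ℓ`. -/
def affineReflection (j : D.Position) (x : P) : P :=
  x - (D.pairing x j.1.coroot + j.2) • j.1.root

/-- `⟨ρ, β^∨⟩`. -/
def height (β : D.PosRoot) : ℤ := D.pairing D.rho β.coroot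

/-- The successive products `w`, `w r_{j_1}`, `w r_{j_1} r_{j_2}`, ... form a saturated chain in
the Bruhat order. -/
def IsBruhatChain (w : P ≃ₗ[ℤ] P) : List D.Position → Prop
  | [] => True
  | j :: J => D.BruhatCover w (w * D.reflection j.1) ∧
      IsBruhatChain (w * D.reflection j.1) J

/-- The product `r_{j_1} r_{j_2} ⋯ r_{j_p}`. -/
noncomputable def reflectionProd (J : List D.Position) : P ≃ₗ[ℤ] P :=
  (J.map fun j => D.reflection j.1).prod

/-! ## Chains of roots and admissible sequences -/

/-- A chain of roots: a set of pairs `(β, ℓ)` with an ordering. -/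
structure RootChain where
  carrier : Set D.Position
  lt : D.Position → D.Position → Prop

namespace RootChain

variable {D}
variable (C : D.RootChain)

/-- `J = (j_1 < ⋯ < j_p)` is a finite increasing sequence of positions of the chain such that
`1 ⋖ r_{j_1} ⋖ r_{j_1} r_{j_2} ⋖ ⋯`. -/
def Admissible (J : List D.Position) : Prop :=
  (∀ j ∈ J, j ∈ C.carrier) ∧ J.Pairwise C.lt ∧ D.IsBruhatChain 1 J

/-- The set of admissible sequences of the chain. -/
def Al : Type _ := {J : List D.Position // C.Admissible J}

open Classical in
/-- `γ_x = r_{j_1} ⋯ r_{j_t} (β_x)`, where `j_1 < ⋯ < j_t` are the elements of `J` below `x`. -/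
noncomputable def gamma (J : List D.Position) (x : D.Position) : P :=
  D.reflectionProd (J.filter fun j => C.lt j x) x.1.root

/-- The set `I_{α_i}` of positions `x` with `γ_x = ± α_i`. -/
def rootSet (i : I) (J : List D.Position) : Set D.Position :=
  {x | x ∈ C.carrier ∧ (C.gamma J x = D.simpleRoot i ∨ C.gamma J x = -D.simpleRoot i)}

/-- The position `x` carries the letter `+` of the `i`-signature. -/
def IsPlus (i : I) (J : List D.Position) (x : D.Position) : Prop :=
  x ∈ C.carrier ∧ x ∉ J ∧ C.gamma J x = D.simpleRoot i

/-- The position `x` carries the letter `-` of the `i`-signature. -/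
def IsMinus (i : I) (J : List D.Position) (x : D.Position) : Prop :=
  x ∈ C.carrier ∧ x ∉ J ∧ C.gamma J x = -D.simpleRoot i

/-- The letter `-` at `x` is cancelled against the letter `+` at `y`: `x` is to the left of `y`,
and all letters strictly between them are cancelled among themselves
(`m z` is the partner of `z`). -/
inductive Cancels (i : I) (J : List D.Position) : D.Position → D.Position → Prop
  | intro {x y : D.Position} (m : D.Position → D.Position)
      (hx : C.IsMinus i J x) (hy : C.IsPlus i J y) (hxy : C.lt x y)
      (partner_right : ∀ z, C.IsMinus i J z → C.lt x z → C.lt z y → C.lt (m z) y)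
      (minus : ∀ z, C.IsMinus i J z → C.lt x z → C.lt z y → Cancels i J z (m z))
      (partner_left : ∀ z, C.IsPlus i J z → C.lt x z → C.lt z y → C.lt x (m z))
      (plus : ∀ z, C.IsPlus i J z → C.lt x z → C.lt z y → Cancels i J (m z) z) :
      Cancels i J x y

/-- `x` carries a `+` of the reduced `i`-signature. -/
def IsReducedPlus (i : I) (J : List D.Position) (x : D.Position) : Prop :=
  C.IsPlus i J x ∧ ∀ y, ¬ C.Cancels i J y x

/-- `x` carries a `-` of the reduced `i`-signature. -/
def IsReducedMinus (i : I) (J : List D.Position) (x : D.Position) : Prop :=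
  C.IsMinus i J x ∧ ∀ y, ¬ C.Cancels i J x y

/-- `a` is the rightmost `+` of the reduced `i`-signature. -/
def IsRightmostPlus (i : I) (J : List D.Position) (a : D.Position) : Prop :=
  C.IsReducedPlus i J a ∧ ∀ x, C.IsReducedPlus i J x → x = a ∨ C.lt x a

/-- `a` is the leftmost `-` of the reduced `i`-signature. -/
def IsLeftmostMinus (i : I) (J : List D.Position) (a : D.Position) : Prop :=
  C.IsReducedMinus i J a ∧ ∀ x, C.IsReducedMinus i J x → x = a ∨ C.lt a x

open Classical in
/-- The result of `f_i` as a sequence of positions; `none` stands for `0`. Let `a` be the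
rightmost `+` of the reduced signature. Add `a`, and remove the first element of
`J ∩ I_{α_i}` to the right of `a` if there is one. If there is no `+`, the result is `0`. -/
noncomputable def fList (i : I) (J : List D.Position) : Option (List D.Position) :=
  if h : ∃ a, C.IsRightmostPlus i J a then
    match (J.filter fun j => j ∈ C.rootSet i J ∧ C.lt h.choose j).head? with
    | none => some (J.orderedInsert C.lt h.choose)
    | some m => some ((J.erase m).orderedInsert C.lt h.choose)
  else none

open Classical in
/-- The result of `e_i` as a sequence of positions; `none` stands for `0`. Let `a` be the leftmost
`-` of the reduced signature. Add `a`, and remove the last element of `J ∩ I_{α_i}` to the left of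
`a` if there is one. If there is no `-`, then remove the last element of `J ∩ I_{α_i}` in the case
`⟨τ(J) ρ, α_i^∨⟩ < 0`, where `τ(J) = r_{j_1} ⋯ r_{j_p}`; otherwise the result is `0`. -/
noncomputable def eList (i : I) (J : List D.Position) : Option (List D.Position) :=
  if h : ∃ a, C.IsLeftmostMinus i J a then
    match (J.filter fun j => j ∈ C.rootSet i J ∧ C.lt j h.choose).getLast? with
    | none => some (J.orderedInsert C.lt h.choose)
    | some m => some ((J.erase m).orderedInsert C.lt h.choose)
  else if D.pairing (D.reflectionProd J D.rho) (D.simpleCoroot i) < 0 then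
    match (J.filter fun j => j ∈ C.rootSet i J).getLast? with
    | none => none
    | some m => some (J.erase m)
  else none

open Classical in
/-- A sequence of positions as an element of `Al ⊔ {0}`: it is `0` if not admissible. -/
noncomputable def toAl (J : List D.Position) : Option C.Al :=
  if h : C.Admissible J then some ⟨J, h⟩ else none

/-- The crystal operator `f_i : Al → Al ⊔ {0}`. -/
noncomputable def f (i : I) (J : C.Al) : Option C.Al := (C.fList i J.1).bind C.toAl

/-- The crystal operator `e_i : Al → Al ⊔ {0}`. -/
noncomputable def e (i : I) (J : C.Al) : Option C.Al := (C.eList i J.1).bind C.toAl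

/-- `wt(J) = -(s_{β_{j_1}, -ℓ_{j_1}} ⋯ s_{β_{j_p}, -ℓ_{j_p}})(-lam)`. -/
def wt (lam : P) (J : C.Al) : P := -(J.1.foldr D.affineReflection (-lam))

end RootChain

/-- The lex `lam`-chain: the pairs `(β, h)` with `0 ≤ h < ⟨lam, β^∨⟩`, ordered by comparing the
vectors `(h, c_1, …, c_n) / ⟨lam, β^∨⟩` lexicographically, where `β^∨ = ∑ c_i α_i^∨`, so that
`c_i = ⟨Λ_i, β^∨⟩`. -/
def lexChain [LT I] (lam : P) : D.RootChain where
  carrier := {x | 0 ≤ x.2 ∧ x.2 < D.pairing lam x.1.coroot}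
  lt x y :=
    let v : D.Position → ℚ ×ₗ Lex (I → ℚ) := fun z =>
      toLex ((z.2 : ℚ) / (D.pairing lam z.1.coroot : ℚ), toLex fun i =>
        (D.pairing (D.fundamentalWeight i) z.1.coroot : ℚ) / (D.pairing lam z.1.coroot : ℚ))
    v x < v y

/-- The `∞`-chain `⋯ ∗ Γ ∗ Γ` of a `ρ`-chain `Γ`. The block number `q < 0` (counted from the
right end, which is block `-1`) contains the element `(β, h)` of `Γ` as the pair `(β, ℓ)` with
`ℓ = h + q ⟨ρ, β^∨⟩`; thus `q` and `h` are the quotient and the remainder of `ℓ` by `⟨ρ, β^∨⟩`. -/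
def infinityChain (Γ : D.RootChain) : D.RootChain where
  carrier := {x | x.2 < 0}
  lt x y :=
    x.2 / D.height x.1 < y.2 / D.height y.1 ∨
      (x.2 / D.height x.1 = y.2 / D.height y.1 ∧
        Γ.lt (x.1, x.2 % D.height x.1) (y.1, y.2 % D.height y.1))

end RootDatum

end KacMoodyDatum

/-! ## Crystals -/

/-- The maps that make up an abstract crystal on the set `B`; `none : Option B` is the element `0`
of `B ⊔ {0}`, and `WithBot ℤ` is `ℤ ⊔ {-∞}`. The axioms are in `CrystalData.IsCrystal`. -/
structure CrystalData (I P B : Type*) where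
  e : I → B → Option B
  f : I → B → Option B
  eps : I → B → WithBot ℤ
  phi : I → B → WithBot ℤ
  wt : B → P

namespace CrystalData

section Crystals

variable {I P Pv : Type*} [Fintype I] [DecidableEq I] [AddCommGroup P] [AddCommGroup Pv]
variable {B B₁ B₂ : Type*}

/-- The axioms of an abstract `U_q(𝔤)`-crystal. -/
structure IsCrystal (D : KacMoodyDatum I P Pv) (X : CrystalData I P B) : Prop where
  nonempty : Nonempty B
  phi_eq : ∀ i b, X.phi i b = X.eps i b + (D.pairing (X.wt b) (D.simpleCoroot i) : WithBot ℤ)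
  eps_e : ∀ i b b', X.e i b = some b' → X.eps i b' = X.eps i b + ((-1 : ℤ) : WithBot ℤ)
  phi_e : ∀ i b b', X.e i b = some b' → X.phi i b' = X.phi i b + ((1 : ℤ) : WithBot ℤ)
  wt_e : ∀ i b b', X.e i b = some b' → X.wt b' = X.wt b + D.simpleRoot i
  eps_f : ∀ i b b', X.f i b = some b' → X.eps i b' = X.eps i b + ((1 : ℤ) : WithBot ℤ)
  phi_f : ∀ i b b', X.f i b = some b' → X.phi i b' = X.phi i b + ((-1 : ℤ) : WithBot ℤ)
  wt_f : ∀ i b b', X.f i b = some b' → X.wt b' = X.wt b - D.simpleRoot i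
  f_iff_e : ∀ i b b', X.f i b = some b' ↔ X.e i b' = some b
  eq_zero_of_phi_eq_bot : ∀ i b, X.phi i b = ⊥ → X.e i b = none ∧ X.f i b = none

/-- `ψ : B₁ ⊔ {0} → B₂ ⊔ {0}` is a morphism of abstract crystals, where `e_i 0 = f_i 0 = 0`. -/
structure IsMorphism (D : KacMoodyDatum I P Pv) (X₁ : CrystalData I P B₁)
    (X₂ : CrystalData I P B₂) (ψ : Option B₁ → Option B₂) : Prop where
  source : X₁.IsCrystal D
  target : X₂.IsCrystal D
  map_zero : ψ none = none
  map_wt : ∀ b b', ψ (some b) = some b' → X₂.wt b' = X₁.wt b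
  map_eps : ∀ i b b', ψ (some b) = some b' → X₂.eps i b' = X₁.eps i b
  map_phi : ∀ i b b', ψ (some b) = some b' → X₂.phi i b' = X₁.phi i b
  map_e : ∀ i b, ψ (X₁.e i b) ≠ none → (ψ (some b)).bind (X₂.e i) ≠ none →
    ψ (X₁.e i b) = (ψ (some b)).bind (X₂.e i)
  map_f : ∀ i b, ψ (X₁.f i b) ≠ none → (ψ (some b)).bind (X₂.f i) ≠ none →
    ψ (X₁.f i b) = (ψ (some b)).bind (X₂.f i)

/-- A crystal embedding: a morphism that is injective on `B₁ ⊔ {0}`. -/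
def IsEmbedding (D : KacMoodyDatum I P Pv) (X₁ : CrystalData I P B₁)
    (X₂ : CrystalData I P B₂) (ψ : Option B₁ → Option B₂) : Prop :=
  IsMorphism D X₁ X₂ ψ ∧ Function.Injective ψ

/-- A crystal surjection: a morphism that maps onto `B₂ ⊔ {0}`. -/
def IsSurjection (D : KacMoodyDatum I P Pv) (X₁ : CrystalData I P B₁)
    (X₂ : CrystalData I P B₂) (ψ : Option B₁ → Option B₂) : Prop :=
  IsMorphism D X₁ X₂ ψ ∧ Function.Surjective ψ

/-- The one-element crystal `T_lam = {t_lam}`. -/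
def T (I : Type*) {P : Type*} (lam : P) : CrystalData I P Unit where
  e _ _ := none
  f _ _ := none
  eps _ _ := ⊥
  phi _ _ := ⊥
  wt _ := lam

open Classical in
/-- The tensor product `B₂ ⊗ B₁` (in the convention opposite to Kashiwara's). -/
noncomputable def tensor (D : KacMoodyDatum I P Pv) (X₂ : CrystalData I P B₂)
    (X₁ : CrystalData I P B₁) : CrystalData I P (B₂ × B₁) where
  e i b := if X₁.phi i b.2 < X₂.eps i b.1 then (X₂.e i b.1).map fun c => (c, b.2)
    else (X₁.e i b.2).map fun c => (b.1, c)
  f i b := if X₁.phi i b.2 ≤ X₂.eps i b.1 then (X₂.f i b.1).map fun c => (c, b.2)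
    else (X₁.f i b.2).map fun c => (b.1, c)
  eps i b := max (X₁.eps i b.2)
    (X₂.eps i b.1 + ((-D.pairing (X₁.wt b.2) (D.simpleCoroot i) : ℤ) : WithBot ℤ))
  phi i b := max (X₂.phi i b.1)
    (X₁.phi i b.2 + (D.pairing (X₂.wt b.1) (D.simpleCoroot i) : WithBot ℤ))
  wt b := X₂.wt b.1 + X₁.wt b.2

/-- `max {n | g^n b ≠ 0}`. -/
noncomputable def stringLength (g : B → Option B) (b : B) : ℕ :=
  sSup {n | (fun c : Option B => c.bind g)^[n] (some b) ≠ none}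

end Crystals

end CrystalData

namespace KacMoodyDatum

section AlcoveCrystals

variable {I P Pv : Type*} [Fintype I] [LinearOrder I] [AddCommGroup P] [AddCommGroup Pv]
variable (D : KacMoodyDatum I P Pv)

/-- The set `Al(lam)` of admissible sequences of the lex `lam`-chain. -/
abbrev AlSet (lam : P) : Type _ := (D.lexChain lam).Al

/-- The set `Al(∞)` of admissible sequences of the `∞`-chain of the lex `ρ`-chain. -/
abbrev AlInfSet : Type _ := (D.infinityChain (D.lexChain D.rho)).Al

/-- The crystal structure on `Al(lam)`; `ε_i` and `φ_i` are such that it is regular. -/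
noncomputable def al (lam : P) : CrystalData I P (D.AlSet lam) where
  e := (D.lexChain lam).e
  f := (D.lexChain lam).f
  eps i J := ((CrystalData.stringLength ((D.lexChain lam).e i) J : ℤ) : WithBot ℤ)
  phi i J := ((CrystalData.stringLength ((D.lexChain lam).f i) J : ℤ) : WithBot ℤ)
  wt := (D.lexChain lam).wt lam

/-- The crystal structure on `Al(∞)`; `ε_i` is such that it is upper regular, the weight is the
one for `lam = 0`, and `φ_i = ε_i + ⟨wt, α_i^∨⟩`. -/
noncomputable def alInf : CrystalData I P D.AlInfSet where
  e := (D.infinityChain (D.lexChain D.rho)).e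
  f := (D.infinityChain (D.lexChain D.rho)).f
  eps i J := ((CrystalData.stringLength
    ((D.infinityChain (D.lexChain D.rho)).e i) J : ℤ) : WithBot ℤ)
  phi i J := ((CrystalData.stringLength ((D.infinityChain (D.lexChain D.rho)).e i) J +
    D.pairing ((D.infinityChain (D.lexChain D.rho)).wt 0 J) (D.simpleCoroot i) : ℤ) : WithBot ℤ)
  wt := (D.infinityChain (D.lexChain D.rho)).wt 0

/-- The crystal `T_{-kρ} ⊗ Al(kρ)`. -/
noncomputable def shiftedAl (k : ℕ) : CrystalData I P (Unit × D.AlSet (k • D.rho)) :=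
  CrystalData.tensor D (CrystalData.T I (-(k • D.rho))) (D.al (k • D.rho))

/-- Replace every `(ζ, ℓ)` by `(ζ, ℓ + n ⟨ρ, ζ^∨⟩)`. -/
def shiftLevels (n : ℤ) (J : List D.Position) : List D.Position :=
  J.map fun j => (j.1, j.2 + n * D.height j.1)

/-- The projection `S^pr_{kρ} : Al(∞) → T_{-kρ} ⊗ Al(kρ)`, which shifts the levels up by
`k ⟨ρ, ζ^∨⟩` and is `0` if the result is not admissible. -/
noncomputable def shiftProjection (k : ℕ) :
    Option D.AlInfSet → Option (Unit × D.AlSet (k • D.rho)) :=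
  fun b => b.bind fun J =>
    ((D.lexChain (k • D.rho)).toAl (D.shiftLevels k J.1)).map fun c => ((), c)

/-- The inclusion `S^in_{-kρ} : T_{-kρ} ⊗ Al(kρ) → Al(∞)`, which shifts the levels down by
`k ⟨ρ, ζ^∨⟩`. -/
noncomputable def shiftInclusion (k : ℕ) :
    Option (Unit × D.AlSet (k • D.rho)) → Option D.AlInfSet :=
  fun b => b.bind fun J =>
    (D.infinityChain (D.lexChain D.rho)).toAl (D.shiftLevels (-k) J.2.1)

end AlcoveCrystals

end KacMoodyDatum

/-!
The crystal operators are read off from a lattice path. For a sequence `J` and an index `i` whose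
set `I_{α_i}` is finite, the `i`-signature is a path with steps `-1` (a `+`), `1` (a `-`) and `0`
(an element of `J`). The cancellation of pairs `-+` removes the excursions of this path, so that
the rightmost remaining `+` is the step that first reaches the minimum, and the leftmost remaining
`-` the step that leaves it for the last time (`isRightmostPlus_iff`, `isLeftmostMinus_iff`). The
definition of `f_i` and `e_i` gains its meaning from the Bruhat order: by the lifting property
(`BruhatCover.map_root_eq`, which rests on the exchange property), a saturated chain turns an
ascent of `i` into a descent only by a fold at a hyperplane orthogonal to `α_i`. Hence a `-` is
preceded in `I_{α_i}` by an element of `J` or another `-`, and the element that `f_i` or `e_i`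
removes is adjacent in `I_{α_i}` to the one that it adds (`IsLowering`). Between these two
positions all roots `γ_z` are reflected by `s_i`. This keeps the chain saturated
(`Admissible.lower`, `Admissible.raise`) and changes two consecutive steps of the path, so that
`f_i` and `e_i` are mutually inverse and the lengths of their strings are the heights of the two
ends of the path above its minimum, with a correction by one at a descent of `τ(J)`.

All crystal axioms for `Al(lam)` then follow from `RootChain.isCrystal`, once the weight is known
to pair with `α_i^∨` to the total drop of the path minus that correction (`pairing_wt_eq`). This
is where the lexicographic order enters: it lists the positions in the order in which the line
from `0` to `-lam`, displaced by an infinitesimal vector, crosses the affine hyperplanes. Adding a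
last fold to `J` reflects the rest of the line; the signature after the fold is the number of
hyperplanes orthogonal to `α_i` that the reflected line still has to cross, which depends only on
its end and on the integral part of `⟨x, α_i^∨⟩` at the point `x` of the fold. This gives the
formula by induction on `J`.

The infinity chain is ordered by the crossing times of the same line, extended to negative times.
Therefore the lex `kρ`-chain, shifted by `kρ`, is an upper set of it
(`isUpperEmbedding_levelShift`). To the left of an upper set that contains `J`, all `γ_z` are
positive roots, so that the larger chain has additional letters `+` only, to the left of all other
letters. They take part in no cancellation, and `e_i` and `ε_i` agree on both chains; `f_i` agrees
where it does not vanish on the smaller chain. Since `Al(∞)` is the union of the shifted sets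
`Al(kρ)`, and `f_i` does not vanish at a given element if `k` is large (`exists_inclusion_f_eq`),
the axioms for `Al(∞)` follow from those for `Al(kρ)`. The inclusion of `T_{-kρ} ⊗ Al(kρ)` is the
map just described, and the projection is its partial inverse.
-/

namespace KacMoodyDatum

section WeylGroup

variable {I P Pv : Type*} [Fintype I] [DecidableEq I] [AddCommGroup P] [AddCommGroup Pv]
variable (D : KacMoodyDatum I P Pv)

/-! ### Real roots in coordinates -/

/-- The cone of nonnegative integral combinations of the simple roots. -/
abbrev posCone : AddSubmonoid P := AddSubmonoid.closure (Set.range D.simpleRoot)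

theorem mem_posCone_iff {x : P} :
    x ∈ D.posCone ↔ ∃ n : I → ℤ, (∀ i, 0 ≤ n i) ∧ x = ∑ i, n i • D.simpleRoot i := by
  constructor
  · intro h
    induction h using AddSubmonoid.closure_induction with
    | mem x hx =>
      obtain ⟨i, rfl⟩ := hx
      refine ⟨Pi.single i 1, fun j => ?_, ?_⟩
      · by_cases h : j = i
        · subst h; simp
        · simp [h]
      · simp [Pi.single_apply, ite_smul]
    | zero => exact ⟨0, fun _ => le_rfl, by simp⟩
    | add x y _ _ hx hy =>
      obtain ⟨n, hn, rfl⟩ := hx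
      obtain ⟨m, hm, rfl⟩ := hy
      exact ⟨n + m, fun i => add_nonneg (hn i) (hm i), by
        simp [add_smul, Finset.sum_add_distrib]⟩
  · rintro ⟨n, hn, rfl⟩
    refine AddSubmonoid.sum_mem _ fun i _ => ?_
    lift n i to ℕ using hn i with k
    rw [natCast_zsmul]
    exact AddSubmonoid.nsmul_mem _ (D.simpleRoot_mem i) k

theorem coeff_unique {n m : I → ℤ}
    (h : ∑ i, n i • D.simpleRoot i = ∑ i, m i • D.simpleRoot i) : n = m := by
  have := Fintype.linearIndependent_iff.1 D.linearIndependent_simpleRoot (fun i => n i - m i)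
    (by simp [sub_smul, Finset.sum_sub_distrib, h])
  funext i
  exact sub_eq_zero.1 (this i)

theorem eq_zero_of_mem_of_neg_mem {x : P} (h : x ∈ D.posCone) (h' : -x ∈ D.posCone) : x = 0 := by
  obtain ⟨n, hn, hx⟩ := D.mem_posCone_iff.1 h
  obtain ⟨m, hm, hx'⟩ := D.mem_posCone_iff.1 h'
  have : n + m = 0 := D.coeff_unique (by
    simp only [Pi.add_apply, add_smul, Finset.sum_add_distrib, ← hx, ← hx']; simp)
  have hn0 : n = 0 := by
    funext i
    have := congrFun this i
    simp only [Pi.add_apply, Pi.zero_apply] at this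
    have := hn i; have := hm i
    simp only [Pi.zero_apply]; omega
  simp [hx, hn0]

/-- A positive diagonal matrix that symmetrizes the Cartan matrix. -/
noncomputable def symmetrizer : I → ℚ := D.symmetrizable.choose

theorem symmetrizer_pos (i : I) : 0 < D.symmetrizer i := D.symmetrizable.choose_spec.1 i

theorem symmetrizer_mul (i j : I) :
    D.symmetrizer i * (D.cartan i j : ℚ) = D.symmetrizer j * (D.cartan j i : ℚ) :=
  D.symmetrizable.choose_spec.2 i j

variable {D}

/-- The symmetrizer turns the coordinates of a coroot into a positive multiple of the coordinates
of the root. This is the coordinate form of the Weyl group equivariant isomorphism between the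
rational root and coroot spaces. -/
theorem IsRealRoot.exists_coeff {β : P} {βv : Pv} (h : D.IsRealRoot β βv) :
    ∃ κ : ℚ, 0 < κ ∧ ∃ n m : I → ℤ, β = ∑ i, n i • D.simpleRoot i ∧
      βv = ∑ i, m i • D.simpleCoroot i ∧ ∀ i, D.symmetrizer i * (m i : ℚ) = κ * (n i : ℚ) := by
  induction h with
  | simple i =>
    refine ⟨D.symmetrizer i, D.symmetrizer_pos i, Pi.single i 1, Pi.single i 1, ?_, ?_, ?_⟩
    · simp [Pi.single_apply, ite_smul]
    · simp [Pi.single_apply, ite_smul]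
    · intro j
      by_cases h : j = i
      · subst h; simp
      · simp [h]
  | reflect j h ih =>
    obtain ⟨κ, hκ, n, m, rfl, rfl, hnm⟩ := ih
    refine ⟨κ, hκ, n - Pi.single j (∑ i, n i * D.cartan i j),
      m - Pi.single j (∑ i, m i * D.cartan j i), ?_, ?_, ?_⟩
    · simp [map_sum, D.pairing_simple, sub_smul, Finset.sum_sub_distrib, Pi.single_apply, ite_smul]
    · simp [map_sum, D.pairing_simple, sub_smul, Finset.sum_sub_distrib, Pi.single_apply, ite_smul]
    · intro i
      by_cases hi : i = j
      · subst hi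
        simp only [Pi.sub_apply, Pi.single_eq_same, Int.cast_sub, Int.cast_sum, Int.cast_mul,
          mul_sub, hnm, Finset.mul_sum]
        congr 1
        refine Finset.sum_congr rfl fun j _ => ?_
        have h1 := hnm j
        have h2 := D.symmetrizer_mul i j
        linear_combination (m j : ℚ) * h2 + (D.cartan j i : ℚ) * h1
      · simp [hi, hnm]

theorem IsRealRoot.ne_zero {β : P} {βv : Pv} (h : D.IsRealRoot β βv) : β ≠ 0 := by
  rintro rfl
  simpa using h.pairing_eq_two

/-- The coroot is determined by the root: its coordinates are known up to a common factor, which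
`⟨β, β^∨⟩ = 2` fixes. -/
theorem IsRealRoot.coroot_unique {β : P} {βv βv' : Pv} (h : D.IsRealRoot β βv)
    (h' : D.IsRealRoot β βv') : βv = βv' := by
  obtain ⟨κ, hκ, n, m, hβ, hv, hnm⟩ := h.exists_coeff
  obtain ⟨κ', hκ', n', m', hβ', hv', hnm'⟩ := h'.exists_coeff
  obtain rfl : n = n' := D.coeff_unique (hβ.symm.trans hβ')
  have key : ∀ i, κ' * (m i : ℚ) = κ * (m' i : ℚ) := fun i => by
    have := (D.symmetrizer_pos i).ne'
    apply mul_left_cancel₀ this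
    linear_combination κ' * hnm i - κ * hnm' i
  have h2 := h.pairing_eq_two
  have h2' := h'.pairing_eq_two
  have e1 : ∀ m : I → ℤ, D.pairing β (∑ i, m i • D.simpleCoroot i)
      = ∑ i, m i * D.pairing β (D.simpleCoroot i) := fun m => by simp [map_sum]
  rw [hv, e1] at h2
  rw [hv', e1] at h2'
  have hκκ : κ' = κ := by
    have a1 : (∑ i, (m i : ℚ) * (D.pairing β (D.simpleCoroot i) : ℚ)) = 2 := by exact_mod_cast h2
    have a2 : (∑ i, (m' i : ℚ) * (D.pairing β (D.simpleCoroot i) : ℚ)) = 2 := by exact_mod_cast h2'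
    have : κ' * (∑ i, (m i : ℚ) * (D.pairing β (D.simpleCoroot i) : ℚ))
        = κ * (∑ i, (m' i : ℚ) * (D.pairing β (D.simpleCoroot i) : ℚ)) := by
      simp only [Finset.mul_sum]
      refine Finset.sum_congr rfl fun i _ => ?_
      linear_combination (D.pairing β (D.simpleCoroot i) : ℚ) * key i
    rw [a1, a2] at this
    linarith
  subst hκκ
  rw [hv, hv']
  refine Finset.sum_congr rfl fun i _ => ?_
  have := mul_left_cancel₀ hκ.ne' (key i)
  rw [show m i = m' i by exact_mod_cast this]

theorem IsRealRoot.neg {β : P} {βv : Pv} (h : D.IsRealRoot β βv) : D.IsRealRoot (-β) (-βv) := by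
  induction h with
  | simple i =>
    have := IsRealRoot.reflect i (IsRealRoot.simple (D := D) i)
    rw [D.pairing_simple, D.cartan_diag] at this
    convert this using 1 <;> module
  | reflect j h ih =>
    have := IsRealRoot.reflect j ih
    convert this using 1 <;> simp <;> module

theorem PosRoot.ext_root {β γ : D.PosRoot} (h : β.root = γ.root) : β = γ := by
  obtain ⟨b, bv, hb, hp⟩ := β
  obtain ⟨c, cv, hc, hp'⟩ := γ
  dsimp only at h
  subst h
  obtain rfl := hb.coroot_unique hc
  rfl

/-- The coordinates of a positive coroot are nonnegative, and not all zero. -/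
theorem PosRoot.fundamentalWeight_nonneg (β : D.PosRoot) (i : I) :
    0 ≤ D.pairing (D.fundamentalWeight i) β.coroot := by
  obtain ⟨κ, hκ, n, m, hβ, hv, hnm⟩ := β.isRealRoot.exists_coeff
  obtain ⟨n', hn', hβ'⟩ := D.mem_posCone_iff.1 β.positive
  obtain rfl : n = n' := D.coeff_unique (hβ.symm.trans hβ')
  have : D.pairing (D.fundamentalWeight i) β.coroot = m i := by
    rw [hv]; simp [map_sum, D.pairing_fundamentalWeight]
  rw [this]
  have h1 : 0 ≤ D.symmetrizer i * (m i : ℚ) := by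
    rw [hnm]; exact mul_nonneg hκ.le (by exact_mod_cast hn' i)
  have := nonneg_of_mul_nonneg_right h1 (D.symmetrizer_pos i)
  exact_mod_cast this

theorem IsRealRoot.coroot_eq_sum {β : P} {βv : Pv} (h : D.IsRealRoot β βv) :
    βv = ∑ i, D.pairing (D.fundamentalWeight i) βv • D.simpleCoroot i := by
  obtain ⟨κ, hκ, n, m, hβ, hv, hnm⟩ := h.exists_coeff
  have : ∀ i, D.pairing (D.fundamentalWeight i) βv = m i := fun i => by
    rw [hv]; simp [map_sum, D.pairing_fundamentalWeight]
  rw [Finset.sum_congr rfl fun i _ => by rw [this i]]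
  exact hv

theorem PosRoot.exists_fundamentalWeight_pos (β : D.PosRoot) :
    ∃ i, 0 < D.pairing (D.fundamentalWeight i) β.coroot := by
  by_contra! h
  have h0 : β.coroot = 0 := by
    rw [β.isRealRoot.coroot_eq_sum]
    refine Finset.sum_eq_zero fun i _ => ?_
    rw [le_antisymm (h i) (β.fundamentalWeight_nonneg i), zero_smul]
  have := β.isRealRoot.pairing_eq_two
  simp [h0] at this

theorem PosRoot.height_pos (β : D.PosRoot) : 0 < D.height β := by
  obtain ⟨i, hi⟩ := β.exists_fundamentalWeight_pos
  have : D.height β = ∑ i, D.pairing (D.fundamentalWeight i) β.coroot := by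
    simp [height, rho, map_sum]
  rw [this]
  exact Finset.sum_pos' (fun i _ => β.fundamentalWeight_nonneg i) ⟨i, Finset.mem_univ _, hi⟩

/-- A weight that is nonnegative on the simple coroots is nonnegative on the positive coroots. -/
theorem PosRoot.pairing_nonneg (β : D.PosRoot) {lam : P}
    (h : ∀ i, 0 ≤ D.pairing lam (D.simpleCoroot i)) : 0 ≤ D.pairing lam β.coroot := by
  rw [β.isRealRoot.coroot_eq_sum, map_sum]
  refine Finset.sum_nonneg fun i _ => ?_
  rw [map_smul, smul_eq_mul]
  exact mul_nonneg (β.fundamentalWeight_nonneg i) (h i)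

/-! ### The Weyl group -/

variable (D)

/-- The Weyl group, generated by the simple reflections. -/
def weyl : Subgroup (P ≃ₗ[ℤ] P) := Subgroup.closure (Set.range D.simpleReflection)

/-- The product of a word in the simple reflections. -/
noncomputable def wordProd (l : List I) : P ≃ₗ[ℤ] P := (l.map D.simpleReflection).prod

@[simp] theorem wordProd_nil : D.wordProd [] = 1 := rfl

@[simp] theorem wordProd_cons (i : I) (l : List I) :
    D.wordProd (i :: l) = D.simpleReflection i * D.wordProd l := by simp [wordProd]

@[simp] theorem wordProd_append (l l' : List I) :
    D.wordProd (l ++ l') = D.wordProd l * D.wordProd l' := by simp [wordProd]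

theorem reflection_apply (β : D.PosRoot) (x : P) :
    D.reflection β x = x - D.pairing x β.coroot • β.root := by
  exact Module.reflection_apply (f := D.pairing.flip β.coroot) x β.isRealRoot.pairing_eq_two

theorem simpleReflection_apply (i : I) (x : P) :
    D.simpleReflection i x = x - D.pairing x (D.simpleCoroot i) • D.simpleRoot i :=
  D.reflection_apply _ _

@[simp] theorem reflection_mul_self (β : D.PosRoot) : D.reflection β * D.reflection β = 1 := by
  ext x
  exact Module.involutive_reflection (f := D.pairing.flip β.coroot) β.isRealRoot.pairing_eq_two x

@[simp] theorem simpleReflection_mul_self (i : I) :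
    D.simpleReflection i * D.simpleReflection i = 1 := D.reflection_mul_self _

@[simp] theorem simpleReflection_mul_self_mul (i : I) (w : P ≃ₗ[ℤ] P) :
    D.simpleReflection i * (D.simpleReflection i * w) = w := by
  rw [← mul_assoc, simpleReflection_mul_self, one_mul]

theorem simpleReflection_inv (i : I) : (D.simpleReflection i)⁻¹ = D.simpleReflection i :=
  inv_eq_of_mul_eq_one_left (D.simpleReflection_mul_self i)

theorem reflection_root (β : D.PosRoot) : D.reflection β β.root = -β.root := by
  rw [reflection_apply, β.isRealRoot.pairing_eq_two]; module

theorem simpleReflection_root (i : I) :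
    D.simpleReflection i (D.simpleRoot i) = -D.simpleRoot i := D.reflection_root (D.simplePosRoot i)

theorem simpleReflection_mem (i : I) : D.simpleReflection i ∈ D.weyl :=
  Subgroup.subset_closure ⟨i, rfl⟩

theorem wordProd_mem (l : List I) : D.wordProd l ∈ D.weyl := by
  induction l with
  | nil => exact one_mem _
  | cons i l ih => rw [wordProd_cons]; exact mul_mem (D.simpleReflection_mem i) ih

theorem wordProd_reverse (l : List I) : D.wordProd l.reverse = (D.wordProd l)⁻¹ := by
  induction l with
  | nil => simp
  | cons i l ih => simp [ih, simpleReflection_inv]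

variable {D}

theorem exists_word {w : P ≃ₗ[ℤ] P} (hw : w ∈ D.weyl) : ∃ l, D.wordProd l = w := by
  induction hw using Subgroup.closure_induction with
  | mem x hx => obtain ⟨i, rfl⟩ := hx; exact ⟨[i], by simp⟩
  | one => exact ⟨[], rfl⟩
  | mul x y _ _ hx hy =>
    obtain ⟨l, rfl⟩ := hx
    obtain ⟨l', rfl⟩ := hy
    exact ⟨l ++ l', by simp⟩
  | inv x _ hx =>
    obtain ⟨l, rfl⟩ := hx
    exact ⟨l.reverse, D.wordProd_reverse l⟩

/-- The Weyl group acts on the pairs of a real root and its coroot, and preserves the pairing. -/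
theorem IsRealRoot.exists_map {w : P ≃ₗ[ℤ] P} (hw : w ∈ D.weyl) {β : P} {βv : Pv}
    (h : D.IsRealRoot β βv) :
    ∃ βv', D.IsRealRoot (w β) βv' ∧ ∀ y, D.pairing (w y) βv' = D.pairing y βv := by
  obtain ⟨l, rfl⟩ := exists_word hw
  clear hw
  induction l with
  | nil => exact ⟨βv, h, fun _ => rfl⟩
  | cons j l ih =>
    obtain ⟨v, hv, hp⟩ := ih
    refine ⟨_, by
      rw [wordProd_cons, LinearEquiv.mul_apply, simpleReflection_apply]
      exact hv.reflect j, fun y => ?_⟩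
    rw [wordProd_cons, LinearEquiv.mul_apply, simpleReflection_apply, ← hp]
    simp only [map_sub, map_smul, LinearMap.sub_apply, LinearMap.smul_apply,
      D.pairing_simple, D.cartan_diag, smul_eq_mul]
    ring

theorem IsRealRoot.pairing_map {w : P ≃ₗ[ℤ] P} (hw : w ∈ D.weyl) {β : P} {βv βv' : Pv}
    (h : D.IsRealRoot β βv) (h' : D.IsRealRoot (w β) βv') (y : P) :
    D.pairing (w y) βv' = D.pairing y βv := by
  obtain ⟨v, hv, hp⟩ := h.exists_map hw
  rw [← hp y, h'.coroot_unique hv]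

theorem IsRealRoot.exists_simple {β : P} {βv : Pv} (h : D.IsRealRoot β βv) :
    ∃ w ∈ D.weyl, ∃ i, w (D.simpleRoot i) = β := by
  induction h with
  | simple i => exact ⟨1, one_mem _, i, rfl⟩
  | reflect j h ih =>
    obtain ⟨w, hw, i, rfl⟩ := ih
    exact ⟨D.simpleReflection j * w, mul_mem (D.simpleReflection_mem j) hw, i, by
      rw [LinearEquiv.mul_apply, simpleReflection_apply]⟩

/-- Conjugating a reflection gives the reflection in the image root. -/
theorem mul_reflection_eq {w : P ≃ₗ[ℤ] P} (hw : w ∈ D.weyl) {β γ : D.PosRoot}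
    (h : w β.root = γ.root ∨ w β.root = -γ.root) :
    w * D.reflection β = D.reflection γ * w := by
  ext y
  simp only [LinearEquiv.mul_apply, reflection_apply, map_sub, map_smul]
  rcases h with h | h
  · rw [← β.isRealRoot.pairing_map hw (h ▸ γ.isRealRoot) y, h]
  · rw [← β.isRealRoot.pairing_map hw (h ▸ γ.isRealRoot.neg) y, h]
    simp

theorem reflection_mem (β : D.PosRoot) : D.reflection β ∈ D.weyl := by
  obtain ⟨w, hw, i, h⟩ := β.isRealRoot.exists_simple
  have := mul_reflection_eq hw (β := D.simplePosRoot i) (γ := β) (Or.inl h)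
  rw [← mul_inv_eq_iff_eq_mul] at this
  rw [← this]
  exact mul_mem (mul_mem hw (D.simpleReflection_mem i)) (inv_mem hw)

/-- Real roots are primitive in the root lattice. -/
theorem IsRealRoot.eq_one_of_smul {β γ : P} {βv γv : Pv} (h : D.IsRealRoot β βv)
    (h' : D.IsRealRoot γ γv) {p q : ℤ} (hp : 0 < p) (hq : 0 < q) (hpq : p • β = q • γ) :
    p = q := by
  have key : ∀ {β γ : P} {βv γv : Pv} {p q : ℤ}, D.IsRealRoot β βv → D.IsRealRoot γ γv →
      p • β = q • γ → q ∣ p := by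
    intro β γ βv γv p q h h' hpq
    obtain ⟨w, hw, i, rfl⟩ := h.exists_simple
    obtain ⟨v, hv, -⟩ := h'.exists_map (inv_mem hw)
    obtain ⟨_, _, n, _, hn, -, -⟩ := hv.exists_coeff
    have e : p • D.simpleRoot i = q • ∑ j, n j • D.simpleRoot j := by
      rw [← hn, ← map_smul, ← hpq, map_smul, ← LinearEquiv.mul_apply]; simp
    have := D.coeff_unique (n := Pi.single i p) (m := fun j => q * n j) (by
      simp only [Pi.single_apply, ite_smul, zero_smul, Finset.sum_ite_eq', Finset.mem_univ, if_true,
        e, Finset.smul_sum, smul_smul])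
    exact ⟨n i, by simpa using congrFun this i⟩
  exact Int.dvd_antisymm hp.le hq.le (key h' h hpq.symm) (key h h' hpq)

theorem IsRealRoot.eq_one_of_eq_smul {β : P} {βv : Pv} (h : D.IsRealRoot β βv) {i : I} {p : ℤ}
    (hp : 0 ≤ p) (hpq : β = p • D.simpleRoot i) : p = 1 := by
  rcases hp.eq_or_lt with rfl | hp
  · exact absurd (by simpa using hpq) h.ne_zero
  · exact (h.eq_one_of_smul (.simple i) one_pos hp (by rw [one_smul, hpq])).symm

/-- Positive real roots with proportional coroots are equal. -/
theorem PosRoot.eq_of_proportional {β γ : D.PosRoot} {r : ℚ}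
    (h : ∀ i, (D.pairing (D.fundamentalWeight i) β.coroot : ℚ) =
      r * (D.pairing (D.fundamentalWeight i) γ.coroot : ℚ)) : β = γ := by
  obtain ⟨κ, hκ, n, m, hβ, hv, hnm⟩ := β.isRealRoot.exists_coeff
  obtain ⟨κ', hκ', n', m', hβ', hv', hnm'⟩ := γ.isRealRoot.exists_coeff
  have hm : ∀ i, D.pairing (D.fundamentalWeight i) β.coroot = m i := fun i => by
    rw [hv]; simp [map_sum, D.pairing_fundamentalWeight]
  have hm' : ∀ i, D.pairing (D.fundamentalWeight i) γ.coroot = m' i := fun i => by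
    rw [hv']; simp [map_sum, D.pairing_fundamentalWeight]
  have hr : 0 < r := by
    obtain ⟨i, hi⟩ := β.exists_fundamentalWeight_pos
    have h1 : (0 : ℚ) < D.pairing (D.fundamentalWeight i) β.coroot := by exact_mod_cast hi
    have h2 : (0 : ℚ) ≤ D.pairing (D.fundamentalWeight i) γ.coroot := by
      exact_mod_cast γ.fundamentalWeight_nonneg i
    rw [h i] at h1
    exact pos_of_mul_pos_left h1 h2
  have hn : ∀ i, (n i : ℚ) = (r * κ' / κ) * n' i := fun i => by
    have := h i
    rw [hm, hm'] at this
    have h1 := hnm i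
    have h2 := hnm' i
    field_simp
    linear_combination -h1 + r * h2 + D.symmetrizer i * this
  obtain ⟨s, hs, hs0⟩ : ∃ s : ℚ, s = r * κ' / κ ∧ 0 < s := ⟨_, rfl, by positivity⟩
  rw [← hs] at hn
  have hpq : (s.den : ℤ) • β.root = s.num • γ.root := by
    rw [hβ, hβ', Finset.smul_sum, Finset.smul_sum]
    refine Finset.sum_congr rfl fun i _ => ?_
    rw [smul_smul, smul_smul]
    congr 1
    have : (s.den : ℚ) * n i = s.num * n' i := by
      rw [hn i, ← mul_assoc, mul_comm (s.den : ℚ), Rat.mul_den_eq_num]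
    exact_mod_cast this
  have := β.isRealRoot.eq_one_of_smul γ.isRealRoot (by exact_mod_cast s.pos)
    (Rat.num_pos.2 hs0) hpq
  rw [← this] at hpq
  refine PosRoot.ext_root ?_
  obtain rfl : n = n' := by
    funext i
    have h1 := hn i
    have : s = 1 := by
      rw [← Rat.num_div_den s, ← this]; simp
    rw [this, one_mul] at h1
    exact_mod_cast h1
  rw [hβ, hβ']

end WeylGroup

end KacMoodyDatum

namespace KacMoodyDatum

section Length

variable {I P Pv : Type*} [Fintype I] [DecidableEq I] [AddCommGroup P] [AddCommGroup Pv]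
variable {D : KacMoodyDatum I P Pv}

/-! ### Exchange, and the signs of real roots -/

/-- A simple reflection changes the sign of no positive real root but its own. -/
theorem IsRealRoot.eq_simpleRoot {β : P} {βv : Pv} (h : D.IsRealRoot β βv) {r : I}
    (hp : β ∈ D.posCone) (hn : -(D.simpleReflection r β) ∈ D.posCone) : β = D.simpleRoot r := by
  obtain ⟨n, hn0, hβ⟩ := D.mem_posCone_iff.1 hp
  obtain ⟨m, hm0, hβ'⟩ := D.mem_posCone_iff.1 hn
  rw [simpleReflection_apply] at hβ'
  have hnm : n + m = Pi.single r (D.pairing β (D.simpleCoroot r)) := by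
    refine D.coeff_unique ?_
    simp only [Pi.add_apply, add_smul, Finset.sum_add_distrib, ← hβ, ← hβ', Pi.single_apply,
      ite_smul, zero_smul, Finset.sum_ite_eq', Finset.mem_univ, if_true]
    module
  have h1 : β = n r • D.simpleRoot r := by
    rw [hβ]
    refine Finset.sum_eq_single r (fun j _ hj => ?_) (by simp)
    have := congrFun hnm j
    simp only [Pi.add_apply, Pi.single_apply, hj, if_false] at this
    have := hn0 j; have := hm0 j
    rw [show n j = 0 by omega, zero_smul]
  rw [h1, h.eq_one_of_eq_smul (hn0 r) h1, one_smul]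

/-- The exchange property for words over a set `K` of indices, given that these words send `β` to
positive or negative elements. -/
theorem exchange_of_dichotomy {K : Set I} {β : D.PosRoot}
    (hK : ∀ l : List I, (∀ i ∈ l, i ∈ K) →
      D.wordProd l β.root ∈ D.posCone ∨ -D.wordProd l β.root ∈ D.posCone)
    (l : List I) (hl : ∀ i ∈ l, i ∈ K) (hneg : -D.wordProd l β.root ∈ D.posCone) :
    ∃ l' : List I, (∀ i ∈ l', i ∈ K) ∧ l'.length + 1 = l.length ∧
      D.wordProd l' = D.wordProd l * D.reflection β := by
  induction l with
  | nil => exact absurd (D.eq_zero_of_mem_of_neg_mem β.positive hneg) β.isRealRoot.ne_zero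
  | cons r l ih =>
    have hl' : ∀ i ∈ l, i ∈ K := fun i hi => hl i (List.mem_cons_of_mem _ hi)
    rcases hK l hl' with hp | hn
    · obtain ⟨v, hv, -⟩ := β.isRealRoot.exists_map (D.wordProd_mem l)
      have h1 := hv.eq_simpleRoot hp (r := r) (by simpa using hneg)
      have h2 := mul_reflection_eq (D.wordProd_mem l) (β := β) (γ := D.simplePosRoot r) (Or.inl h1)
      refine ⟨l, hl', rfl, ?_⟩
      rw [wordProd_cons, mul_assoc, h2]
      exact (D.simpleReflection_mul_self_mul r _).symm
    · obtain ⟨l', h1, h2, h3⟩ := ih hl' hn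
      refine ⟨r :: l', ?_, by simp [h2], by simp [h3, mul_assoc]⟩
      intro i hi
      rcases List.mem_cons.1 hi with rfl | hi
      · exact hl _ List.mem_cons_self
      · exact h1 i hi

/-- The orbit of a simple root under a rank two subgroup stays on a level set of the invariant
form. -/
theorem exists_rank_two_coeff {s t : I} (hst : s ≠ t) (l : List I) (hl : ∀ i ∈ l, i = s ∨ i = t) :
    ∃ p q : ℤ, D.wordProd l (D.simpleRoot s) = p • D.simpleRoot s + q • D.simpleRoot t ∧
      D.symmetrizer t * p ^ 2 + D.symmetrizer t * D.cartan t s * p * q + D.symmetrizer s * q ^ 2 =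
        D.symmetrizer t := by
  induction l with
  | nil => exact ⟨1, 0, by simp, by simp⟩
  | cons i l ih =>
    obtain ⟨p, q, h, hQ⟩ := ih fun i hi => hl i (List.mem_cons_of_mem _ hi)
    have hd := D.symmetrizer_mul s t
    rcases hl i List.mem_cons_self with rfl | rfl
    · refine ⟨-p - D.cartan t i * q, q, ?_, ?_⟩
      · rw [wordProd_cons, LinearEquiv.mul_apply, h, simpleReflection_apply]
        simp only [map_add, map_smul, LinearMap.add_apply, LinearMap.smul_apply, D.pairing_simple,
          D.cartan_diag, smul_eq_mul]
        module
      · push_cast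
        linear_combination hQ
    · refine ⟨p, -q - D.cartan s i * p, ?_, ?_⟩
      · rw [wordProd_cons, LinearEquiv.mul_apply, h, simpleReflection_apply]
        simp only [map_add, map_smul, LinearMap.add_apply, LinearMap.smul_apply, D.pairing_simple,
          D.cartan_diag, smul_eq_mul]
        module
      · push_cast
        linear_combination hQ + (2 * p * q + D.cartan s i * p ^ 2 : ℚ) * hd

/-- In a rank two subgroup the images of a simple root have coordinates of one sign, because on
vectors with coordinates of opposite signs the invariant form exceeds its value at a simple
root. -/
theorem rank_two_dichotomy {s t : I} (hst : s ≠ t) (l : List I) (hl : ∀ i ∈ l, i = s ∨ i = t) :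
    ∃ p q : ℕ, D.wordProd l (D.simpleRoot s) = p • D.simpleRoot s + q • D.simpleRoot t ∨
      -D.wordProd l (D.simpleRoot s) = p • D.simpleRoot s + q • D.simpleRoot t := by
  obtain ⟨p, q, h, hQ⟩ := D.exists_rank_two_coeff hst l hl
  have ht := D.symmetrizer_pos t
  have hs := D.symmetrizer_pos s
  have ha : (D.cartan t s : ℚ) ≤ 0 := by exact_mod_cast D.cartan_nonpos t s hst.symm
  -- opposite signs are impossible
  have hpq : ¬ (p * q < 0) := by
    intro hpq
    have hp : p ≠ 0 := by rintro rfl; simp at hpq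
    have hq : q ≠ 0 := by rintro rfl; simp at hpq
    have h1 : (1 : ℚ) ≤ (p : ℚ) ^ 2 := by
      have : 0 < p ^ 2 := by positivity
      exact_mod_cast this
    have h2 : (0 : ℚ) < (q : ℚ) ^ 2 := by positivity
    have h3 : ((p : ℚ) * q) ≤ 0 := by exact_mod_cast hpq.le
    have h4 : 0 ≤ D.symmetrizer t * (D.cartan t s * (p * q)) :=
      mul_nonneg ht.le (mul_nonneg_of_nonpos_of_nonpos ha h3)
    have h5 : D.symmetrizer t ≤ D.symmetrizer t * (p : ℚ) ^ 2 := le_mul_of_one_le_right ht.le h1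
    have h6 : 0 < D.symmetrizer s * (q : ℚ) ^ 2 := mul_pos hs h2
    linarith
  have : (0 ≤ p ∧ 0 ≤ q) ∨ (p ≤ 0 ∧ q ≤ 0) := by
    rcases le_total 0 p with hp | hp <;> rcases le_total 0 q with hq | hq
    · exact Or.inl ⟨hp, hq⟩
    · rcases hp.eq_or_lt with rfl | hp
      · exact Or.inr ⟨le_rfl, hq⟩
      · rcases hq.eq_or_lt with rfl | hq
        · exact Or.inl ⟨hp.le, le_rfl⟩
        · exact absurd (mul_neg_of_pos_of_neg hp hq) hpq
    · rcases hp.eq_or_lt with rfl | hp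
      · exact Or.inl ⟨le_rfl, hq⟩
      · rcases hq.eq_or_lt with rfl | hq
        · exact Or.inr ⟨hp.le, le_rfl⟩
        · exact absurd (mul_neg_of_neg_of_pos hp hq) hpq
    · exact Or.inr ⟨hp, hq⟩
  rcases this with ⟨hp, hq⟩ | ⟨hp, hq⟩
  · lift p to ℕ using hp
    lift q to ℕ using hq
    exact ⟨p, q, Or.inl (by rw [h, natCast_zsmul, natCast_zsmul])⟩
  · obtain ⟨p', rfl⟩ : ∃ p' : ℕ, p = -p' := ⟨p.natAbs, by omega⟩
    obtain ⟨q', rfl⟩ : ∃ q' : ℕ, q = -q' := ⟨q.natAbs, by omega⟩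
    exact ⟨p', q', Or.inr (by rw [h, neg_smul, neg_smul, natCast_zsmul, natCast_zsmul]; abel)⟩

theorem length_wordProd_le (l : List I) : D.length (D.wordProd l) ≤ l.length :=
  Nat.sInf_le ⟨l, rfl, rfl⟩

theorem exists_reduced_word {w : P ≃ₗ[ℤ] P} (hw : w ∈ D.weyl) :
    ∃ l, l.length = D.length w ∧ D.wordProd l = w := by
  obtain ⟨l, hl⟩ := exists_word hw
  exact Nat.sInf_mem (s := {n | ∃ s : List I, s.length = n ∧ (s.map D.simpleReflection).prod = w})
    ⟨l.length, l, rfl, hl⟩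

theorem length_mul_le {u v : P ≃ₗ[ℤ] P} (hu : u ∈ D.weyl) (hv : v ∈ D.weyl) :
    D.length (u * v) ≤ D.length u + D.length v := by
  obtain ⟨l, hl, rfl⟩ := exists_reduced_word hu
  obtain ⟨l', hl', rfl⟩ := exists_reduced_word hv
  rw [← wordProd_append, ← hl, ← hl', ← List.length_append]
  exact length_wordProd_le _

theorem length_simpleReflection_mul_le {w : P ≃ₗ[ℤ] P} (hw : w ∈ D.weyl) (i : I) :
    D.length (D.simpleReflection i * w) ≤ D.length w + 1 := by
  obtain ⟨l, hl, rfl⟩ := exists_reduced_word hw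
  rw [← wordProd_cons, ← hl]
  exact length_wordProd_le _

/-- If `w s` is not shorter than `w`, then `w α_s` is positive. The proof writes `w = v x` with `x`
a word in `s` and a second simple reflection `t`, and `v` as short as possible: then `v` sends
`α_s` and `α_t` to positive roots by induction, and the rank two case applies to `x`. -/
theorem map_simpleRoot_mem_of_length_le {w : P ≃ₗ[ℤ] P} (hw : w ∈ D.weyl) (s : I)
    (h : D.length w ≤ D.length (w * D.simpleReflection s)) :
    w (D.simpleRoot s) ∈ D.posCone := by
  induction hn : D.length w using Nat.strong_induction_on generalizing w s with
  | _ n ih =>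
  subst hn
  obtain ⟨lw, hlw, hlw'⟩ := exists_reduced_word hw
  rcases List.eq_nil_or_concat lw with rfl | ⟨l₀, t, rfl⟩
  · rw [← hlw']
    exact D.simpleRoot_mem s
  rw [List.concat_eq_append] at hlw hlw'
  simp only [List.length_append, List.length_singleton] at hlw
  have hlen : D.length (D.wordProd l₀) < D.length w := by
    have := length_wordProd_le (D := D) l₀; omega
  have hst : s ≠ t := by
    rintro rfl
    have : w * D.simpleReflection s = D.wordProd l₀ := by
      rw [← hlw']; simp [mul_assoc]
    rw [this] at h
    omega
  -- the factorization `w = v x` with `v` of least length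
  let S : Set ℕ := {m | ∃ v ∈ D.weyl, ∃ l : List I, (∀ i ∈ l, i = s ∨ i = t) ∧
    w = v * D.wordProd l ∧ D.length v + l.length = D.length w ∧ D.length v = m}
  have hlen' : D.length w ≤ D.length (D.wordProd l₀) + 1 := by
    rw [← hlw', wordProd_append]
    refine (length_mul_le (D.wordProd_mem _) (D.wordProd_mem _)).trans ?_
    exact Nat.add_le_add_left (length_wordProd_le [t]) _
  have hmem : D.length (D.wordProd l₀) ∈ S :=
    ⟨_, D.wordProd_mem l₀, [t], by simp, by rw [← hlw']; simp, by
      simp only [List.length_singleton]; omega, rfl⟩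
  obtain ⟨v, hv, l, hl, hwl, hsum, hvS⟩ := Nat.sInf_mem ⟨_, hmem⟩
  have hmin : ∀ m ∈ S, D.length v ≤ m := fun m hm => hvS.trans_le (Nat.sInf_le hm)
  have hvw : D.length v < D.length w := (hmin _ hmem).trans_lt hlen
  have hvr : ∀ r, r = s ∨ r = t → v (D.simpleRoot r) ∈ D.posCone := by
    intro r hr
    refine ih _ hvw hv r ?_ rfl
    by_contra! hlt
    have hle : D.length w ≤ D.length (v * D.simpleReflection r) + (l.length + 1) := by
      have e : w = v * D.simpleReflection r * D.wordProd (r :: l) := by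
        rw [hwl, wordProd_cons, mul_assoc, simpleReflection_mul_self_mul]
      nth_rewrite 1 [e]
      refine (length_mul_le (mul_mem hv (D.simpleReflection_mem r)) (D.wordProd_mem _)).trans ?_
      exact Nat.add_le_add_left (length_wordProd_le (r :: l)) _
    have := hmin _ ⟨v * D.simpleReflection r, mul_mem hv (D.simpleReflection_mem r), r :: l, by
      intro i hi
      rcases List.mem_cons.1 hi with rfl | hi
      · exact hr
      · exact hl i hi, by
        rw [hwl, wordProd_cons, mul_assoc, simpleReflection_mul_self_mul], by
        simp only [List.length_cons]; omega, rfl⟩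
    omega
  have hcone : ∀ p q : ℕ, v (p • D.simpleRoot s + q • D.simpleRoot t) ∈ D.posCone := fun p q => by
    rw [map_add, map_nsmul, map_nsmul]
    exact add_mem (AddSubmonoid.nsmul_mem _ (hvr s (Or.inl rfl)) _)
      (AddSubmonoid.nsmul_mem _ (hvr t (Or.inr rfl)) _)
  obtain ⟨p, q, hpq | hpq⟩ := D.rank_two_dichotomy hst l hl
  · rw [hwl, LinearEquiv.mul_apply, hpq]
    exact hcone p q
  · -- otherwise the word can be shortened, against the assumption on `w s`
    have hmem' : ∀ p q : ℕ, p • D.simpleRoot s + q • D.simpleRoot t ∈ D.posCone := fun p q =>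
      add_mem (AddSubmonoid.nsmul_mem _ (D.simpleRoot_mem s) _)
        (AddSubmonoid.nsmul_mem _ (D.simpleRoot_mem t) _)
    obtain ⟨l', -, hl', hl''⟩ := exchange_of_dichotomy (K := {i | i = s ∨ i = t})
      (β := D.simplePosRoot s) (fun l hl => by
        obtain ⟨p, q, h | h⟩ := D.rank_two_dichotomy hst l hl
        · exact Or.inl (h ▸ hmem' p q)
        · exact Or.inr (h ▸ hmem' p q)) l hl (hpq ▸ hmem' p q)
    have : w * D.simpleReflection s = v * D.wordProd l' := by
      rw [hl'', hwl, mul_assoc]; rfl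
    rw [this] at h
    have h1 := length_mul_le hv (D.wordProd_mem l')
    have h2 := length_wordProd_le (D := D) l'
    omega

/-- Every real root is positive or negative. -/
theorem IsRealRoot.mem_or_neg_mem {β : P} {βv : Pv} (h : D.IsRealRoot β βv) :
    β ∈ D.posCone ∨ -β ∈ D.posCone := by
  obtain ⟨w, hw, s, rfl⟩ := h.exists_simple
  rcases le_total (D.length w) (D.length (w * D.simpleReflection s)) with h | h
  · exact Or.inl (map_simpleRoot_mem_of_length_le hw s h)
  · right
    have := map_simpleRoot_mem_of_length_le (mul_mem hw (D.simpleReflection_mem s)) s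
      (by rwa [mul_assoc, simpleReflection_mul_self, mul_one])
    rwa [LinearEquiv.mul_apply, simpleReflection_root, map_neg] at this

theorem PosRoot.map_mem_or_neg_mem {u : P ≃ₗ[ℤ] P} (hu : u ∈ D.weyl) (β : D.PosRoot) :
    u β.root ∈ D.posCone ∨ -u β.root ∈ D.posCone := by
  obtain ⟨v, hv, -⟩ := β.isRealRoot.exists_map hu
  exact hv.mem_or_neg_mem

/-- The strong exchange property. -/
theorem exists_word_mul_reflection {l : List I} {β : D.PosRoot}
    (h : -D.wordProd l β.root ∈ D.posCone) :
    ∃ l' : List I, l'.length + 1 = l.length ∧ D.wordProd l' = D.wordProd l * D.reflection β := by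
  obtain ⟨l', -, h1, h2⟩ := exchange_of_dichotomy (K := Set.univ) (β := β)
    (fun l _ => β.map_mem_or_neg_mem (D.wordProd_mem l)) l (by simp) h
  exact ⟨l', h1, h2⟩

theorem length_mul_reflection_lt {u : P ≃ₗ[ℤ] P} (hu : u ∈ D.weyl) {β : D.PosRoot}
    (h : -u β.root ∈ D.posCone) : D.length (u * D.reflection β) < D.length u := by
  obtain ⟨l, hl, rfl⟩ := exists_reduced_word hu
  obtain ⟨l', h1, h2⟩ := exists_word_mul_reflection h
  have := length_wordProd_le (D := D) l'
  rw [← h2]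
  omega

theorem length_lt_mul_reflection {u : P ≃ₗ[ℤ] P} (hu : u ∈ D.weyl) {β : D.PosRoot}
    (h : u β.root ∈ D.posCone) : D.length u < D.length (u * D.reflection β) := by
  have := length_mul_reflection_lt (mul_mem hu (reflection_mem β)) (β := β)
    (by rwa [LinearEquiv.mul_apply, reflection_root, map_neg, neg_neg])
  rwa [mul_assoc, reflection_mul_self, mul_one] at this

/-! ### Left ascents and descents -/

variable (D) in
/-- `i` is a left ascent of `u`: the root `u⁻¹ α_i` is positive. -/
def IsAscent (i : I) (u : P ≃ₗ[ℤ] P) : Prop := ∃ β : D.PosRoot, u β.root = D.simpleRoot i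

variable (D) in
/-- `i` is a left descent of `u`: the root `u⁻¹ α_i` is negative. -/
def IsDescent (i : I) (u : P ≃ₗ[ℤ] P) : Prop := ∃ β : D.PosRoot, u β.root = -D.simpleRoot i

theorem isAscent_one (i : I) : D.IsAscent i 1 := ⟨D.simplePosRoot i, rfl⟩

theorem isAscent_or_isDescent {u : P ≃ₗ[ℤ] P} (hu : u ∈ D.weyl) (i : I) :
    D.IsAscent i u ∨ D.IsDescent i u := by
  obtain ⟨v, hv, -⟩ := (IsRealRoot.simple (D := D) i).exists_map (inv_mem hu)
  have hui : u (u⁻¹ (D.simpleRoot i)) = D.simpleRoot i := by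
    rw [← LinearEquiv.mul_apply]; simp
  rcases hv.mem_or_neg_mem with h | h
  · exact Or.inl ⟨⟨_, _, hv, h⟩, hui⟩
  · exact Or.inr ⟨⟨_, _, hv.neg, h⟩, by rw [map_neg, hui]⟩

theorem IsAscent.not_isDescent {i : I} {u : P ≃ₗ[ℤ] P} (h : D.IsAscent i u) :
    ¬ D.IsDescent i u := by
  rintro ⟨γ, hγ⟩
  obtain ⟨β, hβ⟩ := h
  have : γ.root = -β.root := by apply u.injective; rw [hγ, map_neg, hβ]
  exact γ.isRealRoot.ne_zero (D.eq_zero_of_mem_of_neg_mem γ.positive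
    (by rw [this, neg_neg]; exact β.positive))

theorem isDescent_simpleReflection_mul {i : I} {u : P ≃ₗ[ℤ] P} :
    D.IsDescent i (D.simpleReflection i * u) ↔ D.IsAscent i u := by
  refine exists_congr fun β => ?_
  rw [LinearEquiv.mul_apply, ← simpleReflection_root, (D.simpleReflection i).injective.eq_iff]

theorem isAscent_simpleReflection_mul {i : I} {u : P ≃ₗ[ℤ] P} :
    D.IsAscent i (D.simpleReflection i * u) ↔ D.IsDescent i u := by
  rw [← isDescent_simpleReflection_mul, simpleReflection_mul_self_mul]

theorem simpleReflection_mul_eq {i : I} {u : P ≃ₗ[ℤ] P} (hu : u ∈ D.weyl) {β : D.PosRoot}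
    (h : u β.root = D.simpleRoot i ∨ u β.root = -D.simpleRoot i) :
    u * D.reflection β = D.simpleReflection i * u :=
  mul_reflection_eq hu (γ := D.simplePosRoot i) h

theorem IsAscent.length_eq {i : I} {u : P ≃ₗ[ℤ] P} (hu : u ∈ D.weyl) (h : D.IsAscent i u) :
    D.length (D.simpleReflection i * u) = D.length u + 1 := by
  obtain ⟨β, hβ⟩ := h
  have h1 := length_simpleReflection_mul_le hu i
  have h2 := length_lt_mul_reflection hu (β := β) (hβ ▸ D.simpleRoot_mem i)
  rw [simpleReflection_mul_eq hu (Or.inl hβ)] at h2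
  omega

theorem IsDescent.length_eq {i : I} {u : P ≃ₗ[ℤ] P} (hu : u ∈ D.weyl) (h : D.IsDescent i u) :
    D.length u = D.length (D.simpleReflection i * u) + 1 := by
  have := IsAscent.length_eq (mul_mem (D.simpleReflection_mem i) hu)
    (isAscent_simpleReflection_mul.2 h)
  rwa [simpleReflection_mul_self_mul] at this

/-- Left multiplication by `s_i` is a Bruhat cover at an ascent: `s_i u = u s_β` if `u β = α_i`. -/
theorem bruhatCover_of_isAscent {i : I} {u : P ≃ₗ[ℤ] P} (hu : u ∈ D.weyl) {β : D.PosRoot}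
    (h : u β.root = D.simpleRoot i) : D.BruhatCover u (u * D.reflection β) :=
  ⟨⟨β, rfl⟩, by rw [simpleReflection_mul_eq hu (Or.inl h), IsAscent.length_eq hu ⟨β, h⟩]⟩

theorem BruhatCover.map_root_mem {u : P ≃ₗ[ℤ] P} (hu : u ∈ D.weyl) {β : D.PosRoot}
    (h : D.BruhatCover u (u * D.reflection β)) : u β.root ∈ D.posCone := by
  rcases β.map_mem_or_neg_mem hu with h' | h'
  · exact h'
  · have := length_mul_reflection_lt hu h'
    have := h.2
    omega

/-- The lifting property: a Bruhat cover can turn a left ascent into a descent only by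
multiplication with the simple reflection. -/
theorem BruhatCover.map_root_eq {i : I} {u : P ≃ₗ[ℤ] P} (hu : u ∈ D.weyl) {β : D.PosRoot}
    (h : D.BruhatCover u (u * D.reflection β)) (ha : D.IsAscent i u)
    (hd : D.IsDescent i (u * D.reflection β)) : u β.root = D.simpleRoot i := by
  have hv := mul_mem hu (reflection_mem β)
  obtain ⟨l, hl, hl'⟩ := exists_reduced_word (mul_mem (D.simpleReflection_mem i) hv)
  have h1 := hd.length_eq hv
  have h2 := ha.length_eq hu
  have h3 := h.2
  have hβ : (u * D.reflection β) β.root = -u β.root := by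
    rw [LinearEquiv.mul_apply, reflection_root, map_neg]
  obtain ⟨v, hr, -⟩ := β.isRealRoot.exists_map (D.wordProd_mem l)
  rcases hr.mem_or_neg_mem with hp | hn
  · have h4 := hr.eq_simpleRoot hp (r := i) (by
      rw [hl', ← LinearEquiv.mul_apply, simpleReflection_mul_self_mul, hβ, neg_neg]
      exact h.map_root_mem hu)
    rw [hl', LinearEquiv.mul_apply, hβ] at h4
    apply (D.simpleReflection i).injective
    rw [simpleReflection_root, ← h4, map_neg, neg_neg]
  · obtain ⟨l', h4, h5⟩ := exists_word_mul_reflection hn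
    have h6 := length_wordProd_le (D := D) l'
    rw [h5, hl', mul_assoc, mul_assoc, reflection_mul_self, mul_one] at h6
    omega

end Length

end KacMoodyDatum

namespace KacMoodyDatum

/-! ### Lattice paths with steps `-1`, `0`, `1` -/

section LatticePath

variable {N : ℕ} {s : ℕ → ℤ}

/-- The first passage of a lattice path below the level `c`. -/
theorem exists_first_passage (hs : ∀ n < N, s (n + 1) = s n - 1 ∨ s (n + 1) = s n ∨
    s (n + 1) = s n + 1) {a b : ℕ} {c : ℤ} (hab : a ≤ b) (hb : b ≤ N) (ha : c ≤ s a)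
    (hc : s b < c) :
    ∃ n, a ≤ n ∧ n < b ∧ s n = c ∧ s (n + 1) = c - 1 ∧ ∀ l, a ≤ l → l ≤ n → c ≤ s l := by
  classical
  have hex : ∃ n, a ≤ n ∧ s n < c := ⟨b, hab, hc⟩
  obtain ⟨h1, h2⟩ := Nat.find_spec hex
  have hmin : ∀ l, a ≤ l → l < Nat.find hex → c ≤ s l := fun l hl hlt => by
    have := Nat.find_min hex hlt
    push Not at this
    exact this hl
  have hle : Nat.find hex ≤ b := Nat.find_min' hex ⟨hab, hc⟩
  obtain ⟨n, hn⟩ : ∃ n, Nat.find hex = n + 1 := by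
    refine Nat.exists_eq_succ_of_ne_zero fun h0 => ?_
    rw [h0] at h1 h2
    obtain rfl : a = 0 := by omega
    omega
  rw [hn] at h1 h2 hmin hle
  have han : a ≤ n := by
    by_contra h
    obtain rfl : a = n + 1 := by omega
    omega
  have := hmin n han (by omega)
  have := hs n (by omega)
  exact ⟨n, han, by omega, by omega, by omega, fun l hl hl' => hmin l hl (by omega)⟩

/-- The last passage of a lattice path up to the level `c`. -/
theorem exists_last_passage (hs : ∀ n < N, s (n + 1) = s n - 1 ∨ s (n + 1) = s n ∨
    s (n + 1) = s n + 1) {a b : ℕ} {c : ℤ} (hab : a ≤ b) (hb : b ≤ N) (ha : s a < c)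
    (hc : c ≤ s b) :
    ∃ m, a ≤ m ∧ m < b ∧ s m = c - 1 ∧ s (m + 1) = c ∧ ∀ l, m < l → l ≤ b → c ≤ s l := by
  classical
  induction b, hab using Nat.le_induction with
  | base => omega
  | succ b hab ih =>
    by_cases h : s b < c
    · have := hs b (by omega)
      refine ⟨b, hab, by omega, by omega, by omega, fun l hl hl' => ?_⟩
      obtain rfl : l = b + 1 := by omega
      exact hc
    · obtain ⟨m, h1, h2, h3, h4, h5⟩ := ih (by omega) (by omega)
      refine ⟨m, h1, by omega, h3, h4, fun l hl hl' => ?_⟩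
      rcases Nat.lt_or_ge b l with hbl | hbl
      · obtain rfl : l = b + 1 := by omega
        exact hc
      · exact h5 l hl hbl

theorem exists_min (s : ℕ → ℤ) (N : ℕ) : ∃ M : ℤ, (∀ l ≤ N, M ≤ s l) ∧ ∃ l ≤ N, s l = M := by
  obtain ⟨l, hl, h⟩ := Finset.exists_min_image (Finset.range (N + 1)) s ⟨0, by simp⟩
  exact ⟨s l, fun l' hl' => h l' (by simpa [Nat.lt_succ_iff] using hl'), l,
    by simpa [Nat.lt_succ_iff] using hl, rfl⟩

/-- The up step `m` and the down step `n` are the two ends of an excursion of the path. -/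
def IsExcursion (s : ℕ → ℤ) (m n : ℕ) : Prop :=
  m < n ∧ s (m + 1) = s m + 1 ∧ s (n + 1) = s n - 1 ∧ s (n + 1) = s m ∧
    ∀ l, m < l → l ≤ n → s m < s l

end LatticePath

namespace RootChain

variable {I P Pv : Type*} [Fintype I] [DecidableEq I] [AddCommGroup P] [AddCommGroup Pv]
variable {D : KacMoodyDatum I P Pv} (C : D.RootChain)

/-! ### The reduced signature as a lattice path -/

/-- The `i`-signature of `J` as a lattice path `s`. The positions `x 0 < ⋯ < x (N - 1)` are
those of `I_{α_i}`; the step from `s n` to `s (n + 1)` is `-1` for a `+` at `x n`, is `1` for a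
`-`, and is `0` if `x n` belongs to `J`. -/
structure IsSignaturePath (i : I) (J : List D.Position) (N : ℕ) (x : ℕ → D.Position)
    (s : ℕ → ℤ) : Prop where
  mem_rootSet_iff : ∀ z, z ∈ C.rootSet i J ↔ ∃ n < N, x n = z
  lt_iff : ∀ m < N, ∀ n < N, C.lt (x m) (x n) ↔ m < n
  plus_iff : ∀ n < N, C.IsPlus i J (x n) ↔ s (n + 1) = s n - 1
  minus_iff : ∀ n < N, C.IsMinus i J (x n) ↔ s (n + 1) = s n + 1
  mem_iff : ∀ n < N, x n ∈ J ↔ s (n + 1) = s n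

variable {C} {i : I} {J : List D.Position} {N : ℕ} {x : ℕ → D.Position} {s : ℕ → ℤ}

theorem IsPlus.mem_rootSet {z : D.Position} (h : C.IsPlus i J z) : z ∈ C.rootSet i J :=
  ⟨h.1, Or.inl h.2.2⟩

theorem IsMinus.mem_rootSet {z : D.Position} (h : C.IsMinus i J z) : z ∈ C.rootSet i J :=
  ⟨h.1, Or.inr h.2.2⟩

theorem Cancels.isMinus {y z : D.Position} (h : C.Cancels i J y z) : C.IsMinus i J y := by
  cases h; assumption

theorem Cancels.isPlus {y z : D.Position} (h : C.Cancels i J y z) : C.IsPlus i J z := by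
  cases h; assumption

namespace IsSignaturePath

theorem step (h : C.IsSignaturePath i J N x s) :
    ∀ n < N, s (n + 1) = s n - 1 ∨ s (n + 1) = s n ∨ s (n + 1) = s n + 1 := by
  intro n hn
  rw [← h.plus_iff n hn, ← h.minus_iff n hn, ← h.mem_iff n hn]
  obtain ⟨h1, h2⟩ := (h.mem_rootSet_iff (x n)).2 ⟨n, hn, rfl⟩
  by_cases hJ : x n ∈ J
  · exact Or.inr (Or.inl hJ)
  · rcases h2 with h2 | h2
    · exact Or.inl ⟨h1, hJ, h2⟩
    · exact Or.inr (Or.inr ⟨h1, hJ, h2⟩)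

theorem injective (h : C.IsSignaturePath i J N x s) {m n : ℕ} (hm : m < N) (hn : n < N)
    (hmn : x m = x n) : m = n := by
  have h1 := h.lt_iff m hm n hn
  have h2 := h.lt_iff n hn m hm
  have h3 := h.lt_iff n hn n hn
  rw [hmn] at h1 h2
  have : ¬ C.lt (x n) (x n) := by rw [h3]; exact lt_irrefl n
  have h4 : ¬ m < n := fun h => this (h1.2 h)
  have h5 : ¬ n < m := fun h => this (h2.2 h)
  omega

/-- The letters at the two ends of an excursion cancel: the letters strictly between them are
themselves the ends of shorter excursions. -/
theorem cancels_of_isExcursion (h : C.IsSignaturePath i J N x s) {m n : ℕ} (hn : n < N)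
    (hmn : IsExcursion s m n) : C.Cancels i J (x m) (x n) := by
  induction hk : n - m using Nat.strong_induction_on generalizing m n with
  | _ k ih =>
  subst hk
  obtain ⟨hlt, h1, h2, h3, h4⟩ := hmn
  have hpart : ∀ z, ∃ w,
      (C.IsMinus i J z → C.lt (x m) z → C.lt z (x n) → C.lt w (x n) ∧ C.Cancels i J z w) ∧
      (C.IsPlus i J z → C.lt (x m) z → C.lt z (x n) → C.lt (x m) w ∧ C.Cancels i J w z) := by
    intro z
    by_cases hz : z ∈ C.rootSet i J
    swap
    · exact ⟨z, fun hz' => absurd hz'.mem_rootSet hz, fun hz' => absurd hz'.mem_rootSet hz⟩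
    obtain ⟨l, hl, rfl⟩ := (h.mem_rootSet_iff z).1 hz
    rw [h.lt_iff m (by omega) l hl, h.lt_iff l hl n hn, h.minus_iff l hl, h.plus_iff l hl]
    by_cases hin : m < l ∧ l < n
    swap
    · exact ⟨x l, fun _ h1 h2 => absurd ⟨h1, h2⟩ hin, fun _ h1 h2 => absurd ⟨h1, h2⟩ hin⟩
    have hml := h4 l hin.1 hin.2.le
    have hml' := h4 (l + 1) (by omega) (by omega)
    rcases h.step l hl with hst | hst | hst
    · obtain ⟨m', h5, h6, h7, h8, h9⟩ := exists_last_passage h.step (c := s l) hin.1.le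
        (by omega) hml le_rfl
      have hm' : m ≠ m' := by rintro rfl; omega
      refine ⟨x m', fun _ => by omega, fun _ _ _ => ⟨(h.lt_iff _ (by omega) _ (by omega)).2
        (by omega), ih (l - m') (by omega) hl ⟨h6, by omega, hst, by omega, fun k hk hk' => ?_⟩
          rfl⟩⟩
      have := h9 k hk hk'
      omega
    · exact ⟨x l, fun _ => by omega, fun _ => by omega⟩
    · obtain ⟨n', h5, h6, h7, h8, h9⟩ := exists_first_passage h.step (c := s l + 1)
        (a := l + 1) (b := n + 1) (by omega) (by omega) (by omega) (by omega)
      have hn' : n ≠ n' := by rintro rfl; omega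
      refine ⟨x n', fun _ _ _ => ⟨(h.lt_iff _ (by omega) _ (by omega)).2
        (by omega), ih (n' - l) (by omega) (by omega) ⟨h5, hst, by omega, by omega,
          fun k hk hk' => ?_⟩ rfl⟩, fun _ => by omega⟩
      have := h9 k hk hk'
      omega
  choose p hp using hpart
  exact .intro p ((h.minus_iff m (by omega)).2 h1) ((h.plus_iff n hn).2 h2)
    ((h.lt_iff m (by omega) n hn).2 hlt)
    (fun z hz h1 h2 => ((hp z).1 hz h1 h2).1) (fun z hz h1 h2 => ((hp z).1 hz h1 h2).2)
    (fun z hz h1 h2 => ((hp z).2 hz h1 h2).1) (fun z hz h1 h2 => ((hp z).2 hz h1 h2).2)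

theorem isExcursion_of_cancels (h : C.IsSignaturePath i J N x s) {y z : D.Position}
    (hyz : C.Cancels i J y z) {m n : ℕ} (hm : m < N) (hn : n < N) (hy : x m = y)
    (hz : x n = z) : IsExcursion s m n := by
  induction hyz generalizing m n with
  | @intro y z p hyM hzP hyz hr hcr hl hcl ihr ihl =>
  subst hy hz
  rw [h.lt_iff m hm n hn] at hyz
  rw [h.minus_iff m hm] at hyM
  rw [h.plus_iff n hn] at hzP
  -- every letter strictly between is the end of an excursion that stays strictly between
  have hup : ∀ l, m < l → l < n → s (l + 1) = s l + 1 →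
      ∃ l' < n, IsExcursion s l l' := fun l h1 h2 h3 => by
    have hlN : l < N := by omega
    have ha := (h.minus_iff l hlN).2 h3
    have hb := (h.lt_iff m hm l hlN).2 h1
    have hc := (h.lt_iff l hlN n hn).2 h2
    have hd := hr _ ha hb hc
    obtain ⟨l', hl', he⟩ := (h.mem_rootSet_iff _).1 (hcr _ ha hb hc).isPlus.mem_rootSet
    exact ⟨l', by rwa [← he, h.lt_iff l' hl' n hn] at hd, ihr _ ha hb hc hlN hl' rfl he⟩
  have hdown : ∀ l, m < l → l < n → s (l + 1) = s l - 1 →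
      ∃ l', m < l' ∧ IsExcursion s l' l := fun l h1 h2 h3 => by
    have hlN : l < N := by omega
    have ha := (h.plus_iff l hlN).2 h3
    have hb := (h.lt_iff m hm l hlN).2 h1
    have hc := (h.lt_iff l hlN n hn).2 h2
    have hd := hl _ ha hb hc
    obtain ⟨l', hl', he⟩ := (h.mem_rootSet_iff _).1 (hcl _ ha hb hc).isMinus.mem_rootSet
    exact ⟨l', by rwa [← he, h.lt_iff m hm l' hl'] at hd, ihl _ ha hb hc hl' hlN he rfl⟩
  have low : ∀ l, m < l → l ≤ n → s (m + 1) ≤ s l := by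
    intro l
    induction l using Nat.strong_induction_on with
    | _ l ih =>
    intro h1 h2
    rcases Nat.lt_or_ge (m + 1) l with h3 | h3
    swap
    · rw [show l = m + 1 by omega]
    obtain ⟨l, rfl⟩ : ∃ l', l = l' + 1 := ⟨l - 1, by omega⟩
    have h4 := ih l (by omega) (by omega) (by omega)
    rcases h.step l (by omega) with h5 | h5 | h5
    · obtain ⟨l', h6, h7, -, -, h8, -⟩ := hdown l (by omega) (by omega) h5
      have := ih l' (by omega) h6 (by omega)
      omega
    · omega
    · omega
  have high : ∀ k l, n = l + k → m < l → s n ≤ s l := by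
    intro k
    induction k using Nat.strong_induction_on with
    | _ k ih =>
    intro l h1 h2
    rcases Nat.eq_zero_or_pos k with rfl | hk
    · rw [h1]; rfl
    have h4 := ih (k - 1) (by omega) (l + 1) (by omega) (by omega)
    rcases h.step l (by omega) with h5 | h5 | h5
    · omega
    · omega
    · obtain ⟨l', h6, h7, -, -, h8, -⟩ := hup l (by omega) (by omega) h5
      have := ih (n - (l' + 1)) (by omega) (l' + 1) (by omega) (by omega)
      omega
  have h1 := low n (by omega) le_rfl
  have h2 := high (n - (m + 1)) (m + 1) (by omega) (by omega)
  exact ⟨hyz, hyM, hzP, by omega, fun l h3 h4 => by have := low l h3 h4; omega⟩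

/-- A `+` survives the cancellation if it takes the path to a new minimum. -/
theorem isReducedPlus_iff (h : C.IsSignaturePath i J N x s) {n : ℕ} (hn : n < N) :
    C.IsReducedPlus i J (x n) ↔ s (n + 1) = s n - 1 ∧ ∀ l ≤ n, s n ≤ s l := by
  rw [IsReducedPlus, h.plus_iff n hn]
  refine and_congr_right fun h1 => ⟨fun h2 l hl => ?_, fun h2 y hy => ?_⟩
  · by_contra! hlt
    obtain ⟨m, h3, h4, h5, h6, h7⟩ := exists_last_passage h.step hl (by omega) hlt le_rfl
    refine h2 (x m) (h.cancels_of_isExcursion hn ⟨h4, by omega, h1, by omega, fun k hk hk' => ?_⟩)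
    have := h7 k hk hk'
    omega
  · obtain ⟨m, hm', rfl⟩ := (h.mem_rootSet_iff _).1 hy.isMinus.mem_rootSet
    obtain ⟨h3, -, -, h4, -⟩ := h.isExcursion_of_cancels hy hm' hn rfl rfl
    have := h2 m h3.le
    omega

/-- A `-` survives the cancellation if the path never returns below its end. -/
theorem isReducedMinus_iff (h : C.IsSignaturePath i J N x s) {m : ℕ} (hm : m < N) :
    C.IsReducedMinus i J (x m) ↔
      s (m + 1) = s m + 1 ∧ ∀ l, m < l → l ≤ N → s (m + 1) ≤ s l := by
  rw [IsReducedMinus, h.minus_iff m hm]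
  refine and_congr_right fun h1 => ⟨fun h2 l hl hl' => ?_, fun h2 y hy => ?_⟩
  · by_contra! hlt
    obtain ⟨n, h3, h4, h5, h6, h7⟩ := exists_first_passage h.step (a := m + 1) (by omega) hl'
      le_rfl hlt
    refine h2 (x n) (h.cancels_of_isExcursion (by omega) ⟨h3, h1, by omega, by omega,
      fun k hk hk' => ?_⟩)
    have := h7 k hk hk'
    omega
  · obtain ⟨n, hn', rfl⟩ := (h.mem_rootSet_iff _).1 hy.isPlus.mem_rootSet
    obtain ⟨h3, -, -, h4, -⟩ := h.isExcursion_of_cancels hy hm hn' rfl rfl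
    have := h2 (n + 1) (by omega) (by omega)
    omega

/-- The rightmost `+` of the reduced signature is the step that first reaches the minimum of the
path. -/
theorem isRightmostPlus_iff (h : C.IsSignaturePath i J N x s) {n : ℕ} (hn : n < N) :
    C.IsRightmostPlus i J (x n) ↔ s (n + 1) = s n - 1 ∧ (∀ l ≤ n, s n ≤ s l) ∧
      ∀ l, n < l → l ≤ N → s n - 1 ≤ s l := by
  rw [IsRightmostPlus, h.isReducedPlus_iff hn, and_assoc]
  refine and_congr_right fun h1 => and_congr_right fun h2 => ⟨fun h3 l hl hl' => ?_,
    fun h3 z hz => ?_⟩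
  · by_contra! hlt
    obtain ⟨n', h4, h5, h6, h7, h8⟩ := exists_first_passage h.step (a := n + 1) (by omega) hl'
      (c := s n - 1) (by omega) hlt
    have hn' : n' < N := by omega
    have := h3 (x n') ((h.isReducedPlus_iff hn').2 ⟨by omega, fun k hk => ?_⟩)
    · rcases this with h9 | h9
      · have := h.injective hn' hn h9; omega
      · rw [h.lt_iff n' hn' n hn] at h9; omega
    · rcases Nat.lt_or_ge n k with h9 | h9
      · have := h8 k (by omega) hk; omega
      · have := h2 k h9; omega
  · obtain ⟨n', hn', rfl⟩ := (h.mem_rootSet_iff z).1 hz.1.mem_rootSet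
    rw [h.isReducedPlus_iff hn'] at hz
    rw [h.lt_iff n' hn' n hn]
    rcases lt_trichotomy n n' with h4 | rfl | h4
    · have h5 := hz.2 (n + 1) (by omega)
      have h6 := h3 (n' + 1) (by omega) (by omega)
      have h7 := hz.1
      omega
    · exact Or.inl rfl
    · exact Or.inr h4

/-- The leftmost `-` of the reduced signature is the step that leaves the minimum of the path for
the last time. -/
theorem isLeftmostMinus_iff (h : C.IsSignaturePath i J N x s) {n : ℕ} (hn : n < N) :
    C.IsLeftmostMinus i J (x n) ↔ s (n + 1) = s n + 1 ∧
      (∀ l, n < l → l ≤ N → s (n + 1) ≤ s l) ∧ ∀ l ≤ n, s n ≤ s l := by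
  rw [IsLeftmostMinus, h.isReducedMinus_iff hn, and_assoc]
  refine and_congr_right fun h1 => and_congr_right fun h2 => ⟨fun h3 l hl => ?_,
    fun h3 z hz => ?_⟩
  · by_contra! hlt
    obtain ⟨m, h4, h5, h6, h7, h8⟩ := exists_last_passage h.step hl (by omega) hlt le_rfl
    have hm : m < N := by omega
    have := h3 (x m) ((h.isReducedMinus_iff hm).2 ⟨by omega, fun k hk hk' => ?_⟩)
    · rcases this with h9 | h9
      · have := h.injective hm hn h9; omega
      · rw [h.lt_iff n hn m hm] at h9; omega
    · rcases Nat.lt_or_ge n k with h9 | h9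
      · have := h2 k h9 hk'; omega
      · have := h8 k hk h9; omega
  · obtain ⟨m, hm, rfl⟩ := (h.mem_rootSet_iff z).1 hz.1.mem_rootSet
    rw [h.isReducedMinus_iff hm] at hz
    rw [h.lt_iff n hn m hm]
    rcases lt_trichotomy m n with h4 | rfl | h4
    · have h5 := hz.2 n h4 (by omega)
      have h6 := h3 m h4.le
      have h7 := hz.1
      omega
    · exact Or.inl rfl
    · exact Or.inr h4

theorem exists_index_of_isRightmostPlus (h : C.IsSignaturePath i J N x s) {a : D.Position}
    (ha : C.IsRightmostPlus i J a) : ∃ n < N, x n = a :=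
  (h.mem_rootSet_iff a).1 ha.1.1.mem_rootSet

theorem exists_index_of_isLeftmostMinus (h : C.IsSignaturePath i J N x s) {a : D.Position}
    (ha : C.IsLeftmostMinus i J a) : ∃ n < N, x n = a :=
  (h.mem_rootSet_iff a).1 ha.1.1.mem_rootSet

theorem exists_isRightmostPlus (h : C.IsSignaturePath i J N x s) {l : ℕ} (hl : l ≤ N)
    (hlt : s l < s 0) : ∃ a, C.IsRightmostPlus i J a := by
  obtain ⟨M, hM, k, hk, rfl⟩ := exists_min s N
  have := hM l hl
  obtain ⟨n, -, h1, h2, h3, h4⟩ := exists_first_passage h.step (Nat.zero_le k) hk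
    (c := s k + 1) (by omega) (by omega)
  refine ⟨x n, (h.isRightmostPlus_iff (by omega)).2 ⟨by omega, fun l hl => ?_, fun l _ hl => ?_⟩⟩
  · have := h4 l (Nat.zero_le l) hl; omega
  · have := hM l hl; omega

theorem exists_isLeftmostMinus (h : C.IsSignaturePath i J N x s) {l : ℕ} (hl : l ≤ N)
    (hlt : s l < s N) : ∃ a, C.IsLeftmostMinus i J a := by
  obtain ⟨M, hM, k, hk, rfl⟩ := exists_min s N
  have := hM l hl
  obtain ⟨n, -, h1, h2, h3, h4⟩ := exists_last_passage h.step hk le_rfl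
    (c := s k + 1) (by omega) (by omega)
  refine ⟨x n, (h.isLeftmostMinus_iff (by omega)).2 ⟨by omega, fun l hl hl' => ?_,
    fun l hl => ?_⟩⟩
  · have := h4 l hl hl'; omega
  · have := hM l (by omega); omega

end IsSignaturePath

theorem IsRightmostPlus.unique (hasymm : ∀ y z, C.lt y z → ¬ C.lt z y) {a b : D.Position}
    (ha : C.IsRightmostPlus i J a) (hb : C.IsRightmostPlus i J b) : a = b := by
  rcases ha.2 b hb.1 with h | h
  · exact h.symm
  · rcases hb.2 a ha.1 with h' | h'
    · exact h'
    · exact absurd h' (hasymm _ _ h)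

theorem IsLeftmostMinus.unique (hasymm : ∀ y z, C.lt y z → ¬ C.lt z y) {a b : D.Position}
    (ha : C.IsLeftmostMinus i J a) (hb : C.IsLeftmostMinus i J b) : a = b := by
  rcases ha.2 b hb.1 with h | h
  · exact h.symm
  · rcases hb.2 a ha.1 with h' | h'
    · exact h'
    · exact absurd h' (hasymm _ _ h)

end RootChain

end KacMoodyDatum

namespace KacMoodyDatum

section Chains

variable {I P Pv : Type*} [Fintype I] [DecidableEq I] [AddCommGroup P] [AddCommGroup Pv]
variable {D : KacMoodyDatum I P Pv}

/-! ### Saturated Bruhat chains and a simple reflection -/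

@[simp] theorem reflectionProd_nil : D.reflectionProd [] = 1 := rfl

@[simp] theorem reflectionProd_cons (j : D.Position) (J : List D.Position) :
    D.reflectionProd (j :: J) = D.reflection j.1 * D.reflectionProd J := by simp [reflectionProd]

@[simp] theorem reflectionProd_append (J K : List D.Position) :
    D.reflectionProd (J ++ K) = D.reflectionProd J * D.reflectionProd K := by
  simp [reflectionProd]

theorem reflectionProd_mem (J : List D.Position) : D.reflectionProd J ∈ D.weyl := by
  induction J with
  | nil => exact one_mem _
  | cons j J ih => rw [reflectionProd_cons]; exact mul_mem (reflection_mem _) ih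

theorem isBruhatChain_append {w : P ≃ₗ[ℤ] P} {J K : List D.Position} :
    D.IsBruhatChain w (J ++ K) ↔
      D.IsBruhatChain w J ∧ D.IsBruhatChain (w * D.reflectionProd J) K := by
  induction J generalizing w with
  | nil => simp [IsBruhatChain]
  | cons j J ih => simp [IsBruhatChain, ih, and_assoc, mul_assoc]

/-- A saturated chain that starts at an ascent and never multiplies by `s_i` consists of ascents,
and `s_i` carries it to a saturated chain. -/
theorem IsBruhatChain.flip_of_isAscent {i : I} {u : P ≃ₗ[ℤ] P} (hu : u ∈ D.weyl)
    {L : List D.Position} (hL : D.IsBruhatChain u L) (ha : D.IsAscent i u)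
    (hno : ∀ A j B, L = A ++ j :: B → (u * D.reflectionProd A) j.1.root ≠ D.simpleRoot i) :
    D.IsBruhatChain (D.simpleReflection i * u) L ∧ D.IsAscent i (u * D.reflectionProd L) := by
  induction L generalizing u with
  | nil => exact ⟨trivial, by simpa using ha⟩
  | cons j L ih =>
    have hv := mul_mem hu (reflection_mem j.1)
    have ha' : D.IsAscent i (u * D.reflection j.1) := by
      rcases isAscent_or_isDescent hv i with h | h
      · exact h
      · exact absurd (hL.1.map_root_eq hu ha h) (by simpa using hno [] j L rfl)
    obtain ⟨h1, h2⟩ := ih hv hL.2 ha' fun A k B hk => by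
      have := hno (j :: A) k B (by simp [hk])
      simpa [mul_assoc] using this
    refine ⟨⟨⟨⟨j.1, rfl⟩, ?_⟩, by rwa [mul_assoc]⟩, by simpa [mul_assoc] using h2⟩
    rw [mul_assoc, ha'.length_eq hv, ha.length_eq hu, hL.1.2]

/-- `s_i` carries a saturated chain of descents to a saturated chain. -/
theorem IsBruhatChain.flip_of_isDescent {i : I} {u : P ≃ₗ[ℤ] P} (hu : u ∈ D.weyl)
    {L : List D.Position} (hL : D.IsBruhatChain u L)
    (hd : ∀ A B, L = A ++ B → D.IsDescent i (u * D.reflectionProd A)) :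
    D.IsBruhatChain (D.simpleReflection i * u) L := by
  induction L generalizing u with
  | nil => trivial
  | cons j L ih =>
    have hv := mul_mem hu (reflection_mem j.1)
    have h0 : D.IsDescent i u := by simpa using hd [] _ rfl
    have h1 : D.IsDescent i (u * D.reflection j.1) := by simpa using hd [j] L rfl
    refine ⟨⟨⟨j.1, rfl⟩, ?_⟩, ?_⟩
    · have := h0.length_eq hu
      have := h1.length_eq hv
      have := hL.1.2
      rw [mul_assoc]
      omega
    · rw [mul_assoc]
      refine ih hv hL.2 fun A B hAB => ?_
      have := hd (j :: A) B (by simp [hAB])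
      simpa [mul_assoc] using this

/-- A saturated chain from an ascent to a descent multiplies by `s_i` at some step, after the last
of which it consists of descents. -/
theorem IsBruhatChain.exists_last_fold {i : I} {u : P ≃ₗ[ℤ] P} (hu : u ∈ D.weyl)
    {L : List D.Position} (hL : D.IsBruhatChain u L) (ha : D.IsAscent i u)
    (hd : D.IsDescent i (u * D.reflectionProd L)) :
    ∃ A m B, L = A ++ m :: B ∧ (u * D.reflectionProd A) m.1.root = D.simpleRoot i ∧
      ∀ B₁ B₂, B = B₁ ++ B₂ → D.IsDescent i (u * D.reflectionProd (A ++ m :: B₁)) := by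
  induction L using List.reverseRecOn with
  | nil => exact absurd (by simpa using hd) ha.not_isDescent
  | append_singleton L j ih =>
    obtain ⟨h1, h2⟩ := isBruhatChain_append.1 hL
    have hv := mul_mem hu (reflectionProd_mem L)
    rcases isAscent_or_isDescent hv i with h3 | h3
    · refine ⟨L, j, [], rfl, h2.1.map_root_eq hv h3 (by simpa [mul_assoc] using hd), ?_⟩
      intro B₁ B₂ hB
      obtain ⟨rfl, rfl⟩ := List.nil_eq_append_iff.1 hB
      exact hd
    · obtain ⟨A, m, B, rfl, h4, h5⟩ := ih h1 h3
      refine ⟨A, m, B ++ [j], by simp, h4, fun B₁ B₂ hB => ?_⟩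
      rcases List.eq_nil_or_concat B₂ with rfl | ⟨B₂, k, rfl⟩
      · rw [List.append_nil] at hB
        subst hB
        simpa using hd
      · rw [List.concat_eq_append, ← List.append_assoc] at hB
        exact h5 B₁ B₂ (List.append_inj_left' hB rfl)

namespace RootChain

variable (C : D.RootChain)

/-! ### Increasing sequences of positions -/

/-- The ordering of the chain is transitive and asymmetric, and total on the chain. -/
structure IsStrictLinear : Prop where
  asymm : ∀ x y, C.lt x y → ¬ C.lt y x
  trans : ∀ x y z, C.lt x y → C.lt y z → C.lt x z
  trichotomy : ∀ x ∈ C.carrier, ∀ y ∈ C.carrier, C.lt x y ∨ x = y ∨ C.lt y x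

/-- A finite increasing sequence of positions of the chain. -/
def IsIncreasing (J : List D.Position) : Prop := (∀ j ∈ J, j ∈ C.carrier) ∧ J.Pairwise C.lt

variable {C}

theorem Admissible.isIncreasing {J : List D.Position} (h : C.Admissible J) : C.IsIncreasing J :=
  ⟨h.1, h.2.1⟩

theorem IsStrictLinear.irrefl (hC : C.IsStrictLinear) (x : D.Position) : ¬ C.lt x x :=
  fun h => hC.asymm x x h h

theorem IsIncreasing.nodup (hC : C.IsStrictLinear) {J : List D.Position} (h : C.IsIncreasing J) :
    J.Nodup :=
  h.2.imp fun {a b} hab => by rintro rfl; exact hC.irrefl a hab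

theorem IsIncreasing.ext (hC : C.IsStrictLinear) {J K : List D.Position} (hJ : C.IsIncreasing J)
    (hK : C.IsIncreasing K) (h : ∀ z, z ∈ J ↔ z ∈ K) : J = K := by
  have hp : J.Perm K := (List.perm_ext_iff_of_nodup (hJ.nodup hC) (hK.nodup hC)).2 h
  exact hp.eq_of_pairwise (fun a b _ _ h1 h2 => absurd h2 (hC.asymm _ _ h1)) hJ.2 hK.2

theorem IsIncreasing.of_append_left {J K : List D.Position} (h : C.IsIncreasing (J ++ K)) :
    C.IsIncreasing J :=
  ⟨fun j hj => h.1 j (List.mem_append_left _ hj), (List.pairwise_append.1 h.2).1⟩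

theorem IsIncreasing.of_append_right {J K : List D.Position} (h : C.IsIncreasing (J ++ K)) :
    C.IsIncreasing K :=
  ⟨fun j hj => h.1 j (List.mem_append_right _ hj), (List.pairwise_append.1 h.2).2.1⟩

theorem IsIncreasing.lt_of_append {J K : List D.Position} (h : C.IsIncreasing (J ++ K))
    {j k : D.Position} (hj : j ∈ J) (hk : k ∈ K) : C.lt j k :=
  (List.pairwise_append.1 h.2).2.2 j hj k hk

theorem IsIncreasing.filter {J : List D.Position} (h : C.IsIncreasing J) (p : D.Position → Bool) :
    C.IsIncreasing (J.filter p) :=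
  ⟨fun j hj => h.1 j (List.mem_of_mem_filter hj), h.2.filter p⟩

/-- An increasing sequence is cut by a position into the elements below it and the others. -/
theorem IsIncreasing.exists_split (hC : C.IsStrictLinear) {J : List D.Position}
    (hJ : C.IsIncreasing J) (y : D.Position) :
    ∃ L₁ L₂, J = L₁ ++ L₂ ∧ (∀ j ∈ L₁, C.lt j y) ∧ ∀ j ∈ L₂, ¬ C.lt j y := by
  induction J with
  | nil => exact ⟨[], [], rfl, by simp, by simp⟩
  | cons k J ih =>
    obtain ⟨L₁, L₂, rfl, h1, h2⟩ := ih (IsIncreasing.of_append_right (J := [k]) hJ)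
    by_cases hk : C.lt k y
    · refine ⟨k :: L₁, L₂, rfl, ?_, h2⟩
      intro j hj
      rcases List.mem_cons.1 hj with rfl | hj
      · exact hk
      · exact h1 j hj
    · refine ⟨[], k :: (L₁ ++ L₂), rfl, by simp, ?_⟩
      intro j hj hjy
      rcases List.mem_cons.1 hj with rfl | hj
      · exact hk hjy
      · exact hk (hC.trans _ _ _ (List.rel_of_pairwise_cons hJ.2 hj) hjy)

/-- Cutting an increasing sequence at a position of the chain that it does not contain. -/
theorem IsIncreasing.exists_split_of_notMem (hC : C.IsStrictLinear) {J : List D.Position}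
    (hJ : C.IsIncreasing J) {a : D.Position} (ha : a ∈ C.carrier) (haJ : a ∉ J) :
    ∃ L₁ L₂, J = L₁ ++ L₂ ∧ (∀ j ∈ L₁, C.lt j a) ∧ ∀ j ∈ L₂, C.lt a j := by
  obtain ⟨L₁, L₂, rfl, h1, h2⟩ := hJ.exists_split hC a
  refine ⟨L₁, L₂, rfl, h1, fun j hj => ?_⟩
  have hj' := List.mem_append_right L₁ hj
  rcases hC.trichotomy j (hJ.1 j hj') a ha with h | h | h
  · exact absurd h (h2 j hj)
  · exact absurd (h ▸ hj') haJ
  · exact h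

theorem IsIncreasing.insert (hC : C.IsStrictLinear) {L₁ L₂ : List D.Position}
    (hJ : C.IsIncreasing (L₁ ++ L₂)) {a : D.Position} (ha : a ∈ C.carrier)
    (h1 : ∀ j ∈ L₁, C.lt j a) (h2 : ∀ j ∈ L₂, C.lt a j) : C.IsIncreasing (L₁ ++ a :: L₂) := by
  refine ⟨fun j hj => ?_, ?_⟩
  · rcases List.mem_append.1 hj with hj | hj
    · exact hJ.1 j (List.mem_append_left _ hj)
    · rcases List.mem_cons.1 hj with rfl | hj
      · exact ha
      · exact hJ.1 j (List.mem_append_right _ hj)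
  · rw [List.pairwise_append] at *
    refine ⟨hJ.of_append_left.2, List.pairwise_cons.2 ⟨h2, hJ.of_append_right.2⟩, ?_⟩
    intro x hx y hy
    rcases List.mem_cons.1 hy with rfl | hy
    · exact h1 x hx
    · exact hC.trans _ _ _ (h1 x hx) (h2 y hy)

open Classical in
theorem orderedInsert_append (hC : C.IsStrictLinear) {L₁ L₂ : List D.Position} {a : D.Position}
    (h1 : ∀ j ∈ L₁, C.lt j a) (h2 : ∀ j ∈ L₂, C.lt a j) :
    (L₁ ++ L₂).orderedInsert C.lt a = L₁ ++ a :: L₂ := by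
  induction L₁ with
  | nil =>
    cases L₂ with
    | nil => rfl
    | cons k L₂ => simp [h2 k List.mem_cons_self]
  | cons k L₁ ih =>
    have : ¬ C.lt a k := hC.asymm _ _ (h1 k List.mem_cons_self)
    simp only [List.cons_append, List.orderedInsert_cons, this, if_false]
    rw [ih fun j hj => h1 j (List.mem_cons_of_mem _ hj)]

open Classical in
theorem IsIncreasing.orderedInsert (hC : C.IsStrictLinear) {J : List D.Position}
    (hJ : C.IsIncreasing J) {a : D.Position} (ha : a ∈ C.carrier) (haJ : a ∉ J) :
    C.IsIncreasing (J.orderedInsert C.lt a) := by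
  obtain ⟨L₁, L₂, rfl, h1, h2⟩ := hJ.exists_split_of_notMem hC ha haJ
  rw [orderedInsert_append hC h1 h2]
  exact hJ.insert hC ha h1 h2

theorem IsIncreasing.sublist {J K : List D.Position} (hJ : C.IsIncreasing J) (h : K.Sublist J) :
    C.IsIncreasing K :=
  ⟨fun j hj => hJ.1 j (h.subset hj), hJ.2.sublist h⟩

theorem IsIncreasing.head?_eq (hC : C.IsStrictLinear) {J : List D.Position}
    (hJ : C.IsIncreasing J) {m : D.Position} (hm : m ∈ J) (h : ∀ z ∈ J, z = m ∨ C.lt m z) :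
    J.head? = some m := by
  cases J with
  | nil => simp at hm
  | cons k J =>
    rcases h k List.mem_cons_self with rfl | hk
    · rfl
    · rcases List.mem_cons.1 hm with rfl | hm
      · rfl
      · exact absurd hk (hC.asymm _ _ (List.rel_of_pairwise_cons hJ.2 hm))

theorem IsIncreasing.getLast?_eq (hC : C.IsStrictLinear) {J : List D.Position}
    (hJ : C.IsIncreasing J) {m : D.Position} (hm : m ∈ J) (h : ∀ z ∈ J, z = m ∨ C.lt z m) :
    J.getLast? = some m := by
  rcases List.eq_nil_or_concat J with rfl | ⟨J, k, rfl⟩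
  · simp at hm
  · rw [List.concat_eq_append] at *
    rw [List.getLast?_append_of_ne_nil _ (by simp), List.getLast?_singleton]
    rcases h k (by simp) with rfl | hk
    · rfl
    · rcases List.mem_append.1 hm with hm | hm
      · exact absurd hk (hC.asymm _ _ (hJ.lt_of_append hm (by simp)))
      · rw [List.mem_singleton.1 hm]

theorem gamma_append {L₁ L₂ : List D.Position} {z : D.Position} (h1 : ∀ j ∈ L₁, C.lt j z)
    (h2 : ∀ j ∈ L₂, ¬ C.lt j z) : C.gamma (L₁ ++ L₂) z = D.reflectionProd L₁ z.1.root := by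
  classical
  rw [gamma, List.filter_append, List.filter_eq_self.2 (by simpa using h1),
    List.filter_eq_nil_iff.2 (by simpa using h2), List.append_nil]

theorem gamma_eq_of_append_cons (hC : C.IsStrictLinear) {A B : List D.Position} {m : D.Position}
    (h : C.IsIncreasing (A ++ m :: B)) :
    C.gamma (A ++ m :: B) m = D.reflectionProd A m.1.root := by
  refine gamma_append (fun j hj => h.lt_of_append hj List.mem_cons_self) fun j hj => ?_
  rcases List.mem_cons.1 hj with rfl | hj
  · exact hC.irrefl _
  · exact hC.asymm _ _ (List.rel_of_pairwise_cons h.of_append_right.2 hj)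

end RootChain

end Chains

end KacMoodyDatum

namespace KacMoodyDatum

namespace RootChain

section Operators

variable {I P Pv : Type*} [Fintype I] [DecidableEq I] [AddCommGroup P] [AddCommGroup Pv]
variable {D : KacMoodyDatum I P Pv} {C : D.RootChain}
variable {i : I} {J J' : List D.Position} {N : ℕ} {x : ℕ → D.Position} {s : ℕ → ℤ}

/-! ### Folds and descents along an admissible sequence -/

variable (D) in
theorem simpleRoot_ne_neg (i : I) : D.simpleRoot i ≠ -D.simpleRoot i := fun h =>
  (IsRealRoot.simple (D := D) i).ne_zero
    (D.eq_zero_of_mem_of_neg_mem (D.simpleRoot_mem i) (h ▸ D.simpleRoot_mem i))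

/-- In an admissible sequence a fold at a hyperplane orthogonal to `α_i` goes up in the Bruhat
order, so that it has `γ = α_i` and not `-α_i`. -/
theorem Admissible.gamma_eq (hC : C.IsStrictLinear) (hJ : C.Admissible J) {m : D.Position}
    (hm : m ∈ J) (hX : m ∈ C.rootSet i J) : C.gamma J m = D.simpleRoot i := by
  obtain ⟨A, B, rfl⟩ := List.append_of_mem hm
  rcases hX.2 with h | h
  · exact h
  · have h1 := gamma_eq_of_append_cons hC hJ.isIncreasing
    have h2 := (isBruhatChain_append.1 hJ.2.2).2.1
    rw [one_mul] at h2
    have h3 := h2.map_root_mem (reflectionProd_mem A)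
    rw [← h1, h] at h3
    exact absurd (D.eq_zero_of_mem_of_neg_mem (D.simpleRoot_mem i) h3)
      (IsRealRoot.simple (D := D) i).ne_zero

/-- If the part `L₁` of `J` to the left of some cut has a descent as its product, then the last
position of `I_{α_i}` to the left of the cut belongs to `J` or carries a `-`. -/
theorem IsSignaturePath.exists_pred (hC : C.IsStrictLinear) {L₁ L₂ : List D.Position}
    (hJ : C.Admissible (L₁ ++ L₂)) (h : C.IsSignaturePath i (L₁ ++ L₂) N x s)
    (hd : D.IsDescent i (D.reflectionProd L₁)) {n : ℕ} (hn : n ≤ N)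
    (h1 : ∀ k < n, ∀ j ∈ L₂, ¬ C.lt j (x k)) (h2 : ∀ k < N, x k ∈ L₁ → k < n) :
    ∃ k, n = k + 1 ∧ s k ≤ s (k + 1) := by
  have hch := isBruhatChain_append.1 hJ.2.2
  obtain ⟨A, m, B, rfl, h3, h4⟩ := hch.1.exists_last_fold (one_mem _) (isAscent_one i)
    (by rwa [one_mul])
  simp only [one_mul] at h3 h4
  have hinc := hJ.isIncreasing
  have e1 : A ++ m :: B ++ L₂ = A ++ m :: (B ++ L₂) := by simp
  have hmX : m ∈ C.rootSet i (A ++ m :: B ++ L₂) := by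
    refine ⟨hinc.1 m (by simp), Or.inl ?_⟩
    rw [e1] at hinc ⊢
    rw [gamma_eq_of_append_cons hC hinc, h3]
  obtain ⟨k', hk', rfl⟩ := (h.mem_rootSet_iff m).1 hmX
  have hk'n := h2 k' hk' (by simp)
  obtain ⟨k, rfl⟩ : ∃ k, n = k + 1 := ⟨n - 1, by omega⟩
  refine ⟨k, rfl, ?_⟩
  rcases Nat.lt_or_ge k' k with hlt | hge
  swap
  · obtain rfl : k = k' := by omega
    exact ((h.mem_iff k hk').1 (by simp)).ge
  have hmk : C.lt (x k') (x k) := (h.lt_iff _ hk' _ (by omega)).2 hlt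
  have hkX := (h.mem_rootSet_iff (x k)).2 ⟨k, by omega, rfl⟩
  have hincB : C.IsIncreasing B := (IsIncreasing.of_append_left hinc).sublist
    ((List.sublist_cons_self _ _).trans (List.sublist_append_right _ _))
  obtain ⟨B₁, B₂, rfl, h5, h6⟩ := hincB.exists_split hC (x k)
  have hg : C.gamma (A ++ x k' :: (B₁ ++ B₂) ++ L₂) (x k)
      = D.reflectionProd (A ++ x k' :: B₁) (x k).1.root := by
    have e : A ++ x k' :: (B₁ ++ B₂) ++ L₂ = (A ++ x k' :: B₁) ++ (B₂ ++ L₂) := by simp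
    rw [e]
    refine gamma_append (fun j hj => ?_) fun j hj => ?_
    · rcases List.mem_append.1 hj with hj | hj
      · exact hC.trans _ _ _ ((IsIncreasing.of_append_left hinc).lt_of_append hj
          List.mem_cons_self) hmk
      · rcases List.mem_cons.1 hj with rfl | hj
        · exact hmk
        · exact h5 j hj
    · rcases List.mem_append.1 hj with hj | hj
      · exact h6 j hj
      · exact h1 k (by omega) j hj
  have hneg : C.gamma (A ++ x k' :: (B₁ ++ B₂) ++ L₂) (x k) = -D.simpleRoot i := by
    rcases hkX.2 with h7 | h7
    · rw [hg] at h7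
      exact absurd (h4 B₁ B₂ rfl) (IsAscent.not_isDescent ⟨_, h7⟩)
    · exact h7
  have hkJ : x k ∉ A ++ x k' :: (B₁ ++ B₂) ++ L₂ := fun hmem =>
    simpleRoot_ne_neg D i ((hJ.gamma_eq hC hmem hkX).symm.trans hneg)
  rw [(h.minus_iff k (by omega)).1 ⟨hkX.1, hkJ, hneg⟩]
  omega

/-- The letter `-` is preceded in `I_{α_i}` by an element of `J` or another `-`. -/
theorem IsSignaturePath.exists_pred_of_minus (hC : C.IsStrictLinear) (hJ : C.Admissible J)
    (h : C.IsSignaturePath i J N x s) {n : ℕ} (hn : n < N) (hs : s (n + 1) = s n + 1) :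
    ∃ k, n = k + 1 ∧ s k ≤ s (k + 1) := by
  have hmin := (h.minus_iff n hn).2 hs
  obtain ⟨L₁, L₂, rfl, h1, h2⟩ := hJ.isIncreasing.exists_split hC (x n)
  refine h.exists_pred hC hJ ⟨(x n).1, ?_⟩ hn.le (fun k hk j hj hjk => ?_) fun k hk hkL => ?_
  · rw [← hmin.2.2, gamma_append h1 h2]
  · exact h2 j hj (hC.trans _ _ _ hjk ((h.lt_iff _ (by omega) _ hn).2 hk))
  · exact (h.lt_iff _ hk _ hn).1 (h1 _ hkL)

/-- If `τ(J)` has the descent `i`, then `I_{α_i}` ends with an element of `J` or a `-`. -/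
theorem IsSignaturePath.exists_pred_of_isDescent (hC : C.IsStrictLinear) (hJ : C.Admissible J)
    (h : C.IsSignaturePath i J N x s) (hd : D.IsDescent i (D.reflectionProd J)) :
    ∃ k, N = k + 1 ∧ s k ≤ s (k + 1) := by
  have e : J = J ++ [] := by simp
  rw [e] at hJ h
  exact h.exists_pred hC hJ hd le_rfl (by simp) fun k hk _ => hk

/-! ### Adding and removing a position of `I_{α_i}` -/

open Classical in
theorem gamma_eq_of_mem_iff (hC : C.IsStrictLinear) (hJ : C.IsIncreasing J)
    (hJ' : C.IsIncreasing J') {z : D.Position} (h : ∀ y, C.lt y z → (y ∈ J' ↔ y ∈ J)) :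
    C.gamma J' z = C.gamma J z := by
  rw [gamma, gamma, IsIncreasing.ext hC (hJ.filter _) (hJ'.filter _) fun y => ?_]
  simp only [List.mem_filter, decide_eq_true_eq]
  constructor
  · rintro ⟨h1, h2⟩; exact ⟨(h y h2).2 h1, h2⟩
  · rintro ⟨h1, h2⟩; exact ⟨(h y h2).1 h1, h2⟩

/-- A position of `I_{α_i}`, when added to `J`, applies `s_i` to every `γ_z` to its right. -/
theorem gamma_insert (hC : C.IsStrictLinear) (hJ : C.IsIncreasing J) (hJ' : C.IsIncreasing J')
    {a z : D.Position} (haX : a ∈ C.rootSet i J) (haJ : a ∉ J)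
    (hmem : ∀ y, y ∈ J' ↔ y = a ∨ y ∈ J) (hz : C.lt a z) :
    C.gamma J' z = D.simpleReflection i (C.gamma J z) := by
  obtain ⟨L₁, L₂, rfl, h1, h2⟩ := hJ.exists_split_of_notMem hC haX.1 haJ
  obtain rfl : J' = L₁ ++ a :: L₂ := hJ'.ext hC (hJ.insert hC haX.1 h1 h2) fun y => by
    rw [hmem]; simp only [List.mem_append, List.mem_cons]; tauto
  obtain ⟨M₁, M₂, rfl, h3, h4⟩ := hJ.of_append_right.exists_split hC z
  have ha : C.gamma (L₁ ++ (M₁ ++ M₂)) a = D.reflectionProd L₁ a.1.root :=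
    gamma_append h1 fun j hj => hC.asymm _ _ (h2 j hj)
  have hz' : ∀ j ∈ L₁, C.lt j z := fun j hj => hC.trans _ _ _ (h1 j hj) hz
  have hX := haX.2
  rw [ha] at hX
  rw [show L₁ ++ (M₁ ++ M₂) = (L₁ ++ M₁) ++ M₂ by simp,
    show L₁ ++ a :: (M₁ ++ M₂) = (L₁ ++ a :: M₁) ++ M₂ by simp,
    gamma_append (fun j hj => (List.mem_append.1 hj).elim (hz' j) (h3 j)) h4,
    gamma_append (fun j hj => ?_) h4, ← LinearEquiv.mul_apply, reflectionProd_append,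
    reflectionProd_append, reflectionProd_cons, ← mul_assoc,
    simpleReflection_mul_eq (reflectionProd_mem L₁) hX, mul_assoc]
  rcases List.mem_append.1 hj with hj | hj
  · exact hz' j hj
  · rcases List.mem_cons.1 hj with rfl | hj
    · exact hz
    · exact h3 j hj

/-- The sequence `J'` arises from `J` by adding `x n` and removing the next position `x (n + 1)`
of `I_{α_i}`, if there is one. -/
structure IsLowering (N : ℕ) (x : ℕ → D.Position) (n : ℕ) (J J' : List D.Position) : Prop where
  lt : n < N
  notMem : x n ∉ J
  mem' : x n ∈ J'
  mem : n + 1 < N → x (n + 1) ∈ J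
  notMem' : n + 1 < N → x (n + 1) ∉ J'
  mem_iff : ∀ z, z ≠ x n → (n + 1 < N → z ≠ x (n + 1)) → (z ∈ J' ↔ z ∈ J)

/-- Adding `x n` and removing `x (n + 1)` applies `s_i` to `γ_z` for `z` between these positions,
and changes no other `γ_z`. Here `K` stands for `J` or `J'`. -/
theorem IsLowering.gamma_eq (hC : C.IsStrictLinear) (hJ : C.IsIncreasing J)
    (hJ' : C.IsIncreasing J') {n : ℕ} (h : IsLowering N x n J J')
    (hlt : n + 1 < N → C.lt (x n) (x (n + 1)))
    (hX : (x n ∈ C.rootSet i J ∧ (n + 1 < N → x (n + 1) ∈ C.rootSet i J)) ∨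
      (x n ∈ C.rootSet i J' ∧ (n + 1 < N → x (n + 1) ∈ C.rootSet i J'))) (z : D.Position) :
    (C.lt (x n) z → (n + 1 < N → ¬ C.lt (x (n + 1)) z) →
      C.gamma J' z = D.simpleReflection i (C.gamma J z)) ∧
    ((C.lt (x n) z → n + 1 < N ∧ C.lt (x (n + 1)) z) → C.gamma J' z = C.gamma J z) := by
  classical
  -- below `x n` nothing changes
  have hlow : ∀ z, ¬ C.lt (x n) z → C.gamma J' z = C.gamma J z := fun z hz =>
    gamma_eq_of_mem_iff hC hJ hJ' fun y hy => h.mem_iff y (by rintro rfl; exact hz hy)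
      fun hn => by rintro rfl; exact hz (hC.trans _ _ _ (hlt hn) hy)
  have hnX : x n ∈ C.rootSet i J := by
    rcases hX with hX | hX
    · exact hX.1
    · obtain ⟨h1, h2⟩ := hX.1
      rw [hlow _ (hC.irrefl _)] at h2
      exact ⟨h1, h2⟩
  -- the sequence that contains both positions
  set K := J.orderedInsert C.lt (x n) with hK
  have hKinc : C.IsIncreasing K := hJ.orderedInsert hC hnX.1 h.notMem
  have hKmem : ∀ y, y ∈ K ↔ y = x n ∨ y ∈ J := fun y => by rw [hK, List.mem_orderedInsert]
  have hKJ : ∀ z, C.lt (x n) z → C.gamma K z = D.simpleReflection i (C.gamma J z) := fun z hz =>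
    gamma_insert hC hJ hKinc hnX h.notMem hKmem hz
  by_cases hn : n + 1 < N
  swap
  · obtain rfl : J' = K := hJ'.ext hC hKinc fun y => by
      rw [hKmem]
      by_cases hy : y = x n
      · subst hy; simp [h.mem']
      · rw [h.mem_iff y hy fun h => absurd h hn]; simp [hy]
    exact ⟨fun hz _ => hKJ z hz, fun hz => hlow z fun h => hn (hz h).1⟩
  have hKmem' : ∀ y, y ∈ K ↔ y = x (n + 1) ∨ y ∈ J' := fun y => by
    rw [hKmem]
    by_cases hy : y = x n
    · subst hy; simp [h.mem']
    · by_cases hy' : y = x (n + 1)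
      · subst hy'; simp [h.mem hn]
      · rw [h.mem_iff y hy fun _ => hy']; simp [hy, hy']
  have hmid : ∀ z, ¬ C.lt (x (n + 1)) z → C.gamma J' z = C.gamma K z := fun z hz =>
    (gamma_eq_of_mem_iff hC hJ' hKinc fun y hy => by
      rw [hKmem']; exact or_iff_right (by rintro rfl; exact hz hy)).symm
  have hmX : x (n + 1) ∈ C.rootSet i J' := by
    rcases hX with hX | hX
    · obtain ⟨h1, h2⟩ := hX.2 hn
      refine ⟨h1, ?_⟩
      rw [hmid _ (hC.irrefl _), hKJ _ (hlt hn)]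
      rcases h2 with h2 | h2 <;> rw [h2]
      · exact Or.inr (D.simpleReflection_root i)
      · rw [map_neg, simpleReflection_root, neg_neg]; exact Or.inl rfl
    · exact hX.2 hn
  refine ⟨fun hz hz' => by rw [hmid z (hz' hn), hKJ z hz], fun hz => ?_⟩
  by_cases hz1 : C.lt (x n) z
  · have h1 := gamma_insert hC hJ' hKinc hmX (h.notMem' hn) hKmem' (hz hz1).2
    rw [hKJ z hz1] at h1
    exact ((D.simpleReflection i).injective h1).symm
  · exact hlow z hz1

theorem simpleReflection_eq_or_iff {y : P} :
    (D.simpleReflection i y = D.simpleRoot i ∨ D.simpleReflection i y = -D.simpleRoot i) ↔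
      (y = D.simpleRoot i ∨ y = -D.simpleRoot i) := by
  have h1 : D.simpleReflection i y = D.simpleRoot i ↔ y = -D.simpleRoot i := by
    rw [← (D.simpleReflection i).injective.eq_iff (a := y), map_neg, simpleReflection_root, neg_neg]
  have h2 : D.simpleReflection i y = -D.simpleRoot i ↔ y = D.simpleRoot i := by
    rw [← simpleReflection_root, (D.simpleReflection i).injective.eq_iff]
  rw [h1, h2, or_comm]

/-- The set `I_{α_i}` is the same for `J` and `J'`, because `s_i` preserves `{α_i, -α_i}`. -/
theorem IsLowering.rootSet_eq (hC : C.IsStrictLinear) (hJ : C.IsIncreasing J)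
    (hJ' : C.IsIncreasing J') {n : ℕ} (h : IsLowering N x n J J')
    (hlt : n + 1 < N → C.lt (x n) (x (n + 1)))
    (hX : (x n ∈ C.rootSet i J ∧ (n + 1 < N → x (n + 1) ∈ C.rootSet i J)) ∨
      (x n ∈ C.rootSet i J' ∧ (n + 1 < N → x (n + 1) ∈ C.rootSet i J'))) :
    C.rootSet i J' = C.rootSet i J := by
  ext z
  refine and_congr_right fun _ => ?_
  obtain ⟨h1, h2⟩ := h.gamma_eq hC hJ hJ' hlt hX z
  by_cases hz : C.lt (x n) z ∧ (n + 1 < N → ¬ C.lt (x (n + 1)) z)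
  · rw [h1 hz.1 hz.2, simpleReflection_eq_or_iff]
  · rw [h2 fun h => by by_contra h'; exact hz ⟨h, fun h1 h2 => h' ⟨h1, h2⟩⟩]

/-- The effect of adding `x n` and removing `x (n + 1)` on the signature path. -/
def lowerPath (n : ℕ) (s : ℕ → ℤ) (l : ℕ) : ℤ :=
  if l ≤ n then s l else if l = n + 1 then s l + 1 else s l + 2

/-- The inverse of `lowerPath`. -/
def raisePath (n : ℕ) (s : ℕ → ℤ) (l : ℕ) : ℤ :=
  if l ≤ n then s l else if l = n + 1 then s l - 1 else s l - 2

/-- Adding the `+` at `x n` and removing the next position from `J` makes the first of these letters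
neutral and the second one a `-`. -/
theorem IsSignaturePath.lower (hC : C.IsStrictLinear) (hJ : C.IsIncreasing J)
    (hJ' : C.IsIncreasing J') (h : C.IsSignaturePath i J N x s) {n : ℕ}
    (hl : IsLowering N x n J J') (hplus : s (n + 1) = s n - 1)
    (hfold : n + 1 < N → C.gamma J (x (n + 1)) = D.simpleRoot i) :
    C.IsSignaturePath i J' N x (lowerPath n s) := by
  have hn := hl.lt
  have hlt : n + 1 < N → C.lt (x n) (x (n + 1)) := fun hn' => (h.lt_iff _ hn _ hn').2 (by omega)
  have hX : ∀ k < N, x k ∈ C.rootSet i J := fun k hk => (h.mem_rootSet_iff _).2 ⟨k, hk, rfl⟩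
  have hg := hl.gamma_eq hC hJ hJ' hlt (Or.inl ⟨hX n hn, fun h => hX _ h⟩)
  have hR := hl.rootSet_eq hC hJ hJ' hlt (Or.inl ⟨hX n hn, fun h => hX _ h⟩)
  have hother : ∀ k < N, k ≠ n → k ≠ n + 1 → (x k ∈ J' ↔ x k ∈ J) ∧
      C.gamma J' (x k) = C.gamma J (x k) := fun k hk h1 h2 => by
    refine ⟨hl.mem_iff _ (fun e => h1 (h.injective hk hn e))
      fun hn' e => h2 (h.injective hk hn' e), (hg (x k)).2 fun h3 => ?_⟩
    rw [h.lt_iff _ hn _ hk] at h3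
    have : n + 1 < N := by omega
    exact ⟨this, (h.lt_iff _ this _ hk).2 (by omega)⟩
  have hst : ∀ k, k ≠ n → k ≠ n + 1 → lowerPath n s (k + 1) - lowerPath n s k
      = s (k + 1) - s k := fun k h1 h2 => by
    unfold lowerPath; split_ifs <;> omega
  have hst1 : lowerPath n s (n + 1) = lowerPath n s n := by
    unfold lowerPath; split_ifs <;> omega
  have hst2 : n + 1 < N → lowerPath n s (n + 1 + 1) = lowerPath n s (n + 1) + 1 := fun hn' => by
    have := (h.mem_iff _ hn').1 (hl.mem hn')
    unfold lowerPath; split_ifs <;> omega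
  have hgm : n + 1 < N → C.gamma J' (x (n + 1)) = -D.simpleRoot i := fun hn' => by
    rw [(hg _).1 (hlt hn') fun _ => hC.irrefl _, hfold hn', simpleReflection_root]
  refine ⟨fun z => by rw [hR, h.mem_rootSet_iff], h.lt_iff, fun k hk => ?_, fun k hk => ?_,
    fun k hk => ?_⟩
  · by_cases h1 : k = n
    · subst h1
      rw [hst1]
      exact ⟨fun h => absurd hl.mem' h.2.1, fun h => by omega⟩
    by_cases h2 : k = n + 1
    · subst h2
      rw [hst2 hk]
      exact ⟨fun h => absurd (h.2.2.symm.trans (hgm hk)) (simpleRoot_ne_neg D i),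
        fun h => by omega⟩
    · have h3 := hst k h1 h2
      have h4 := h.plus_iff k hk
      rw [IsPlus, (hother k hk h1 h2).1, (hother k hk h1 h2).2]
      rw [IsPlus] at h4
      rw [h4]; omega
  · by_cases h1 : k = n
    · subst h1
      rw [hst1]
      exact ⟨fun h => absurd hl.mem' h.2.1, fun h => by omega⟩
    by_cases h2 : k = n + 1
    · subst h2
      exact ⟨fun _ => hst2 hk, fun _ => ⟨(hX _ hk).1, hl.notMem' hk, hgm hk⟩⟩
    · have h3 := hst k h1 h2
      have h4 := h.minus_iff k hk
      rw [IsMinus, (hother k hk h1 h2).1, (hother k hk h1 h2).2]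
      rw [IsMinus] at h4
      rw [h4]; omega
  · by_cases h1 : k = n
    · subst h1
      exact ⟨fun _ => hst1, fun _ => hl.mem'⟩
    by_cases h2 : k = n + 1
    · subst h2
      rw [hst2 hk]
      exact ⟨fun h => absurd h (hl.notMem' hk), fun h => by omega⟩
    · have h3 := hst k h1 h2
      rw [(hother k hk h1 h2).1, h.mem_iff k hk]; omega

/-- The converse of `IsSignaturePath.lower`. -/
theorem IsSignaturePath.raise (hC : C.IsStrictLinear) (hJ : C.IsIncreasing J)
    (hJ' : C.IsIncreasing J') (h : C.IsSignaturePath i J' N x s) {n : ℕ}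
    (hl : IsLowering N x n J J') (hminus : n + 1 < N → s (n + 1 + 1) = s (n + 1) + 1)
    (hfold : C.gamma J' (x n) = D.simpleRoot i) :
    C.IsSignaturePath i J N x (raisePath n s) := by
  have hn := hl.lt
  have hlt : n + 1 < N → C.lt (x n) (x (n + 1)) := fun hn' => (h.lt_iff _ hn _ hn').2 (by omega)
  have hX : ∀ k < N, x k ∈ C.rootSet i J' := fun k hk => (h.mem_rootSet_iff _).2 ⟨k, hk, rfl⟩
  have hg := hl.gamma_eq hC hJ hJ' hlt (Or.inr ⟨hX n hn, fun h => hX _ h⟩)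
  have hR := hl.rootSet_eq hC hJ hJ' hlt (Or.inr ⟨hX n hn, fun h => hX _ h⟩)
  have hother : ∀ k < N, k ≠ n → k ≠ n + 1 → (x k ∈ J' ↔ x k ∈ J) ∧
      C.gamma J' (x k) = C.gamma J (x k) := fun k hk h1 h2 => by
    refine ⟨hl.mem_iff _ (fun e => h1 (h.injective hk hn e))
      fun hn' e => h2 (h.injective hk hn' e), (hg (x k)).2 fun h3 => ?_⟩
    rw [h.lt_iff _ hn _ hk] at h3
    have : n + 1 < N := by omega
    exact ⟨this, (h.lt_iff _ this _ hk).2 (by omega)⟩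
  have hst : ∀ k, k ≠ n → k ≠ n + 1 → raisePath n s (k + 1) - raisePath n s k
      = s (k + 1) - s k := fun k h1 h2 => by
    unfold raisePath; split_ifs <;> omega
  have hst1 : raisePath n s (n + 1) = raisePath n s n - 1 := by
    have := (h.mem_iff _ hn).1 hl.mem'
    unfold raisePath; split_ifs <;> omega
  have hst2 : n + 1 < N → raisePath n s (n + 1 + 1) = raisePath n s (n + 1) := fun hn' => by
    have := hminus hn'
    unfold raisePath; split_ifs <;> omega
  have hgn : C.gamma J (x n) = D.simpleRoot i := by
    rw [← (hg _).2 fun h => absurd h (hC.irrefl _), hfold]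
  refine ⟨fun z => by rw [← hR, h.mem_rootSet_iff], h.lt_iff, fun k hk => ?_, fun k hk => ?_,
    fun k hk => ?_⟩
  · by_cases h1 : k = n
    · subst h1
      exact ⟨fun _ => hst1, fun _ => ⟨(hX _ hk).1, hl.notMem, hgn⟩⟩
    by_cases h2 : k = n + 1
    · subst h2
      rw [hst2 hk]
      exact ⟨fun h => absurd (hl.mem hk) h.2.1, fun h => by omega⟩
    · have h3 := hst k h1 h2
      have h4 := h.plus_iff k hk
      rw [IsPlus, ← (hother k hk h1 h2).1, ← (hother k hk h1 h2).2]
      rw [IsPlus] at h4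
      rw [h4]; omega
  · by_cases h1 : k = n
    · subst h1
      rw [hst1]
      exact ⟨fun h => absurd (hgn.symm.trans h.2.2) (simpleRoot_ne_neg D i), fun h => by omega⟩
    by_cases h2 : k = n + 1
    · subst h2
      rw [hst2 hk]
      exact ⟨fun h => absurd (hl.mem hk) h.2.1, fun h => by omega⟩
    · have h3 := hst k h1 h2
      have h4 := h.minus_iff k hk
      rw [IsMinus, ← (hother k hk h1 h2).1, ← (hother k hk h1 h2).2]
      rw [IsMinus] at h4
      rw [h4]; omega
  · by_cases h1 : k = n
    · subst h1
      rw [hst1]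
      exact ⟨fun h => absurd h hl.notMem, fun h => by omega⟩
    by_cases h2 : k = n + 1
    · subst h2
      exact ⟨fun _ => hst2 hk, fun _ => hl.mem hk⟩
    · have h3 := hst k h1 h2
      rw [← (hother k hk h1 h2).1, h.mem_iff k hk]; omega

end Operators

end RootChain

end KacMoodyDatum

namespace KacMoodyDatum

namespace RootChain

section CrystalOperators

variable {I P Pv : Type*} [Fintype I] [DecidableEq I] [AddCommGroup P] [AddCommGroup Pv]
variable {D : KacMoodyDatum I P Pv} {C : D.RootChain}
variable {i : I} {J J' : List D.Position} {N : ℕ} {x : ℕ → D.Position} {s : ℕ → ℤ}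

/-! ### The crystal operators preserve admissibility -/

/-- An element of `J` between consecutive positions of `I_{α_i}` is not a fold at `α_i`. -/
theorem IsSignaturePath.map_root_ne (hC : C.IsStrictLinear) (h : C.IsSignaturePath i J N x s)
    (hJ : C.IsIncreasing J) {n : ℕ} (hn : n < N) {A B : List D.Position} {j : D.Position}
    (hAB : J = A ++ j :: B) (h1 : C.lt (x n) j) (h2 : n + 1 < N → C.lt j (x (n + 1))) :
    D.reflectionProd A j.1.root ≠ D.simpleRoot i := by
  subst hAB
  intro he
  obtain ⟨k, hk, rfl⟩ := (h.mem_rootSet_iff j).1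
    ⟨hJ.1 j (by simp), Or.inl (by rw [gamma_eq_of_append_cons hC hJ, he])⟩
  rw [h.lt_iff _ hn _ hk] at h1
  have hn' : n + 1 < N := by omega
  have := (h.lt_iff _ hk _ hn').1 (h2 hn')
  omega

/-- `f_i` preserves admissibility: the new fold at `x n` starts from an ascent of `i`, and the
saturated chain after it is multiplied by `s_i` up to the position that is removed. -/
theorem Admissible.lower (hC : C.IsStrictLinear) (hJ : C.Admissible J)
    (hJ' : C.IsIncreasing J') (h : C.IsSignaturePath i J N x s) {n : ℕ}
    (hl : IsLowering N x n J J') (hplus : C.IsPlus i J (x n)) :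
    C.Admissible J' ∧ (N = n + 1 → D.IsAscent i (D.reflectionProd J) ∧
      D.reflectionProd J' = D.simpleReflection i * D.reflectionProd J) ∧
      (n + 1 < N → D.reflectionProd J' = D.reflectionProd J) := by
  have hinc := hJ.isIncreasing
  have hn := hl.lt
  obtain ⟨L₁, L₂, rfl, h1, h2⟩ := hinc.exists_split_of_notMem hC hplus.1 hl.notMem
  obtain ⟨hc1, hc2⟩ := isBruhatChain_append.1 hJ.2.2
  rw [one_mul] at hc2
  have hu := reflectionProd_mem (D := D) L₁
  have ha : D.reflectionProd L₁ (x n).1.root = D.simpleRoot i := by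
    rw [← hplus.2.2, gamma_append h1 fun j hj => hC.asymm _ _ (h2 j hj)]
  have hus := simpleReflection_mul_eq hu (Or.inl ha)
  by_cases hn' : n + 1 < N
  · have hlt : C.lt (x n) (x (n + 1)) := (h.lt_iff _ hn _ hn').2 (by omega)
    have hmL : x (n + 1) ∈ L₂ := (List.mem_append.1 (hl.mem hn')).resolve_left
      fun hm => hC.asymm _ _ hlt (h1 _ hm)
    obtain ⟨B, L₃, rfl⟩ := List.append_of_mem hmL
    have hinc2 := IsIncreasing.of_append_right hinc
    have hins := IsIncreasing.insert hC hinc hplus.1 h1 h2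
    obtain rfl : J' = L₁ ++ x n :: (B ++ L₃) := by
      refine hJ'.ext hC (hins.sublist (by simp)) fun z => ?_
      by_cases hz : z = x n
      · subst hz; simp [hl.mem']
      by_cases hz' : z = x (n + 1)
      · subst hz'
        have := hins.nodup hC
        simp only [hl.notMem' hn', false_iff]
        rw [show L₁ ++ x n :: (B ++ x (n + 1) :: L₃) = (L₁ ++ x n :: B) ++ x (n + 1) :: L₃ by simp,
          List.nodup_middle, List.nodup_cons] at this
        simpa using this.1
      · rw [hl.mem_iff z hz fun _ => hz']
        simp [hz, hz']
    obtain ⟨hc3, hc4⟩ := isBruhatChain_append.1 hc2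
    have hno : ∀ A j B', B = A ++ j :: B' →
        (D.reflectionProd L₁ * D.reflectionProd A) j.1.root ≠ D.simpleRoot i := by
      rintro A j B' rfl
      rw [← reflectionProd_append]
      exact h.map_root_ne hC hinc hn (B := B' ++ x (n + 1) :: L₃) (by simp) (h2 _ (by simp))
        fun _ => hinc2.lt_of_append (by simp) List.mem_cons_self
    obtain ⟨hf1, hf2⟩ := hc3.flip_of_isAscent hu ⟨_, ha⟩ hno
    have hmX := Admissible.gamma_eq hC hJ (i := i) (m := x (n + 1)) (by simp)
      ((h.mem_rootSet_iff _).2 ⟨_, hn', rfl⟩)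
    have hm : (D.reflectionProd L₁ * D.reflectionProd B) (x (n + 1)).1.root = D.simpleRoot i := by
      rw [← hmX, ← reflectionProd_append,
        show L₁ ++ (B ++ x (n + 1) :: L₃) = (L₁ ++ B) ++ x (n + 1) :: L₃ by simp] at *
      rw [gamma_eq_of_append_cons hC hinc]
    have hms := simpleReflection_mul_eq (mul_mem hu (reflectionProd_mem B)) (Or.inl hm)
    refine ⟨⟨hJ'.1, hJ'.2, isBruhatChain_append.2 ⟨hc1, ?_⟩⟩, fun h => by omega, fun _ => ?_⟩
    · rw [one_mul]
      refine ⟨bruhatCover_of_isAscent hu ha, ?_⟩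
      rw [hus, isBruhatChain_append]
      refine ⟨hf1, ?_⟩
      rw [mul_assoc, ← hms]
      exact hc4.2
    · simp only [reflectionProd_append, reflectionProd_cons]
      rw [← mul_assoc, hus, ← mul_assoc, ← mul_assoc, ← mul_assoc, hms]
      simp only [mul_assoc]
  · obtain rfl : J' = L₁ ++ x n :: L₂ := by
      refine hJ'.ext hC (hinc.insert hC hplus.1 h1 h2) fun z => ?_
      by_cases hz : z = x n
      · subst hz; simp [hl.mem']
      · rw [hl.mem_iff z hz fun h => absurd h hn']; simp [hz]
    have hno : ∀ A j B', L₂ = A ++ j :: B' →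
        (D.reflectionProd L₁ * D.reflectionProd A) j.1.root ≠ D.simpleRoot i := by
      rintro A j B' rfl
      rw [← reflectionProd_append]
      exact h.map_root_ne hC hinc hn (B := B') (by simp) (h2 _ (by simp)) fun h => absurd h hn'
    obtain ⟨hf1, hf2⟩ := hc2.flip_of_isAscent hu ⟨_, ha⟩ hno
    refine ⟨⟨hJ'.1, hJ'.2, isBruhatChain_append.2 ⟨hc1, ?_⟩⟩,
      fun _ => ⟨by rwa [reflectionProd_append], ?_⟩, fun h => absurd h hn'⟩
    · rw [one_mul]
      refine ⟨bruhatCover_of_isAscent hu ha, ?_⟩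
      rwa [hus]
    · simp only [reflectionProd_append, reflectionProd_cons]
      rw [← mul_assoc, hus, mul_assoc]

/-- If a saturated chain folds at `a`, and neither folds nor has an ascent at its end after that,
then all its elements after `a` are descents. -/
theorem isDescent_of_last_fold {A B : List D.Position} {a : D.Position}
    (hch : D.IsBruhatChain 1 (A ++ a :: B)) (ha : D.reflectionProd A a.1.root = D.simpleRoot i)
    (hd : D.IsDescent i (D.reflectionProd (A ++ a :: B)))
    (hno : ∀ B₁ j B₂, B = B₁ ++ j :: B₂ →
      D.reflectionProd (A ++ a :: B₁) j.1.root ≠ D.simpleRoot i)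
    (B₁ B₂ : List D.Position) (hB : B = B₁ ++ B₂) :
    D.IsDescent i (D.reflectionProd (A ++ a :: B₁)) := by
  obtain ⟨A', m, B', he, hm, hdes⟩ := hch.exists_last_fold (one_mem _) (isAscent_one i)
    (by rwa [one_mul])
  simp only [one_mul] at hm hdes
  rcases List.append_eq_append_iff.1 he with ⟨c, rfl, hc⟩ | ⟨c, rfl, hc⟩
  · cases c with
    | nil =>
      obtain ⟨rfl, rfl⟩ := List.cons.inj hc
      simpa using hdes B₁ B₂ hB
    | cons k c =>
      obtain ⟨rfl, rfl⟩ := List.cons.inj hc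
      exact absurd hm (hno c m B' rfl)
  · cases c with
    | nil =>
      obtain ⟨rfl, rfl⟩ := List.cons.inj hc
      simpa using hdes B₁ B₂ hB
    | cons k c =>
      obtain ⟨rfl, rfl⟩ := List.cons.inj hc
      exact absurd (hdes c (a :: B) rfl) (IsAscent.not_isDescent ⟨_, ha⟩)

/-- `e_i` preserves admissibility: all partial products between the fold at `x n` and the next
position of `I_{α_i}` are descents of `i`, so that the multiplication by `s_i` keeps the chain
saturated. -/
theorem Admissible.raise (hC : C.IsStrictLinear) (hJ : C.IsIncreasing J)
    (hJ' : C.Admissible J') (h : C.IsSignaturePath i J' N x s) {n : ℕ}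
    (hl : IsLowering N x n J J') (hminus : n + 1 < N → C.IsMinus i J' (x (n + 1)))
    (hdes : N = n + 1 → D.IsDescent i (D.reflectionProd J')) : C.Admissible J := by
  have hinc := hJ'.isIncreasing
  have hn := hl.lt
  have haX := hJ'.gamma_eq hC hl.mem' ((h.mem_rootSet_iff _).2 ⟨n, hn, rfl⟩)
  obtain ⟨L₁, L₂, rfl⟩ := List.append_of_mem hl.mem'
  obtain ⟨hc1, hc2⟩ := isBruhatChain_append.1 hJ'.2.2
  rw [one_mul] at hc2
  have ha : D.reflectionProd L₁ (x n).1.root = D.simpleRoot i := by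
    rw [← haX, gamma_eq_of_append_cons hC hinc]
  have hu := reflectionProd_mem (D := D) L₁
  have hus := simpleReflection_mul_eq hu (Or.inl ha)
  have h2 : ∀ j ∈ L₂, C.lt (x n) j := fun j hj =>
    List.rel_of_pairwise_cons hinc.of_append_right.2 hj
  by_cases hn' : n + 1 < N
  · have hlt : C.lt (x n) (x (n + 1)) := (h.lt_iff _ hn _ hn').2 (by omega)
    have hm := hminus hn'
    have hmL : x (n + 1) ∉ L₂ := fun hmem => hl.notMem' hn' (by simp [hmem])
    obtain ⟨B, L₃, rfl, h3, h4⟩ := (hinc.sublist (K := L₂) (by simp)).exists_split_of_notMem hC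
      hm.1 hmL
    have h3' : ∀ j ∈ L₁ ++ x n :: B, C.lt j (x (n + 1)) := fun j hj => by
      rcases List.mem_append.1 hj with hj | hj
      · exact hC.trans _ _ _ (hinc.lt_of_append hj List.mem_cons_self) hlt
      · rcases List.mem_cons.1 hj with rfl | hj
        · exact hlt
        · exact h3 j hj
    obtain rfl : J = L₁ ++ (B ++ x (n + 1) :: L₃) := by
      have e : L₁ ++ x n :: (B ++ L₃) = (L₁ ++ x n :: B) ++ L₃ := by simp
      have hins := IsIncreasing.insert hC (e ▸ hinc) hm.1 h3' h4
      refine hJ.ext hC (hins.sublist (by simp)) fun z => ?_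
      by_cases hz : z = x n
      · subst hz
        have := hins.nodup hC
        rw [show (L₁ ++ x n :: B) ++ x (n + 1) :: L₃ = L₁ ++ x n :: (B ++ x (n + 1) :: L₃) by simp,
          List.nodup_middle, List.nodup_cons] at this
        simp only [hl.notMem, false_iff]
        exact this.1
      by_cases hz' : z = x (n + 1)
      · subst hz'; simp [hl.mem hn']
      · rw [← hl.mem_iff z hz fun _ => hz']
        simp [hz, hz']
    have hno : ∀ B₁ j B₂, B = B₁ ++ j :: B₂ →
        D.reflectionProd (L₁ ++ x n :: B₁) j.1.root ≠ D.simpleRoot i := by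
      rintro B₁ j B₂ rfl
      exact h.map_root_ne hC hinc hn (B := B₂ ++ L₃) (by simp) (h2 _ (by simp))
        fun _ => h3 _ (by simp)
    have hmg : D.reflectionProd (L₁ ++ x n :: B) (x (n + 1)).1.root = -D.simpleRoot i := by
      rw [← hm.2.2, show L₁ ++ x n :: (B ++ L₃) = (L₁ ++ x n :: B) ++ L₃ by simp,
        gamma_append h3' fun j hj => hC.asymm _ _ (h4 j hj)]
    have hc3 := hc2.2
    rw [isBruhatChain_append, hus] at hc3
    have hB : D.IsBruhatChain 1 (L₁ ++ x n :: B) :=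
      isBruhatChain_append.2 ⟨hc1, by rw [one_mul]; exact ⟨hc2.1, by rw [hus]; exact hc3.1⟩⟩
    have hprod : ∀ B₁, D.reflectionProd (L₁ ++ x n :: B₁)
        = D.simpleReflection i * (D.reflectionProd L₁ * D.reflectionProd B₁) := fun B₁ => by
      rw [reflectionProd_append, reflectionProd_cons, ← mul_assoc, hus, mul_assoc]
    have hf := hc3.1.flip_of_isDescent (mul_mem (D.simpleReflection_mem i) hu) fun B₁ B₂ hBB => by
      have := isDescent_of_last_fold hB ha ⟨_, hmg⟩ hno B₁ B₂ hBB
      rwa [hprod, ← mul_assoc] at this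
    rw [simpleReflection_mul_self_mul] at hf
    have hv := mul_mem hu (reflectionProd_mem B)
    rw [hprod, LinearEquiv.mul_apply, ← simpleReflection_root,
      (D.simpleReflection i).injective.eq_iff] at hmg
    refine ⟨hJ.1, hJ.2, isBruhatChain_append.2 ⟨hc1, ?_⟩⟩
    rw [one_mul, isBruhatChain_append]
    refine ⟨hf, bruhatCover_of_isAscent hv hmg, ?_⟩
    rw [simpleReflection_mul_eq hv (Or.inl hmg), ← mul_assoc]
    exact hc3.2
  · obtain rfl : J = L₁ ++ L₂ := by
      refine hJ.ext hC (hinc.sublist (by simp)) fun z => ?_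
      by_cases hz : z = x n
      · subst hz
        have := hinc.nodup hC
        rw [List.nodup_middle, List.nodup_cons] at this
        simp only [hl.notMem, false_iff]
        exact this.1
      · rw [← hl.mem_iff z hz fun h => absurd h hn']; simp [hz]
    have hno : ∀ B₁ j B₂, L₂ = B₁ ++ j :: B₂ →
        D.reflectionProd (L₁ ++ x n :: B₁) j.1.root ≠ D.simpleRoot i := by
      rintro B₁ j B₂ rfl
      exact h.map_root_ne hC hinc hn (B := B₂) (by simp) (h2 _ (by simp)) fun h => absurd h hn'
    have hf := IsBruhatChain.flip_of_isDescent (mul_mem (D.simpleReflection_mem i) hu)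
      (L := L₂) (by rw [← hus]; exact hc2.2) fun B₁ B₂ hBB => by
      have := isDescent_of_last_fold hJ'.2.2 ha (hdes (by omega)) hno B₁ B₂ hBB
      rwa [reflectionProd_append, reflectionProd_cons, ← mul_assoc, hus] at this
    rw [simpleReflection_mul_self_mul] at hf
    exact ⟨hJ.1, hJ.2, isBruhatChain_append.2 ⟨hc1, by rwa [one_mul]⟩⟩

/-! ### The crystal operators as inverse partial maps -/

/-- The position of `I_{α_i}` after the rightmost `+` belongs to `J`; hence it is the one that
`f_i` removes. -/
theorem IsSignaturePath.fold_of_isRightmostPlus (hC : C.IsStrictLinear) (hJ : C.Admissible J)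
    (h : C.IsSignaturePath i J N x s) {n : ℕ} (hn : n + 1 < N)
    (ha : C.IsRightmostPlus i J (x n)) : x (n + 1) ∈ J := by
  obtain ⟨h1, h2, h3⟩ := (h.isRightmostPlus_iff (by omega)).1 ha
  rw [h.mem_iff _ hn]
  have := h3 (n + 1 + 1) (by omega) (by omega)
  rcases h.step _ hn with h4 | h4 | h4
  · omega
  · exact h4
  · obtain ⟨k, hk, hk'⟩ := h.exists_pred_of_minus hC hJ hn h4
    obtain rfl : k = n := by omega
    omega

open Classical in
theorem IsSignaturePath.exists_fList_eq (hC : C.IsStrictLinear) (hJ : C.Admissible J)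
    (h : C.IsSignaturePath i J N x s) {n : ℕ} (hn : n < N)
    (ha : C.IsRightmostPlus i J (x n)) :
    ∃ K, C.fList i J = some K ∧ C.IsIncreasing K ∧ IsLowering N x n J K := by
  have hinc := hJ.isIncreasing
  have hex : ∃ a, C.IsRightmostPlus i J a := ⟨_, ha⟩
  have hch : hex.choose = x n := hex.choose_spec.unique hC.asymm ha
  have hxJ := ha.1.1.2.1
  have hxC := ha.1.1.1
  rw [fList, dif_pos hex, hch]
  by_cases hn' : n + 1 < N
  · have hm := h.fold_of_isRightmostPlus hC hJ hn' ha
    have hmX := (h.mem_rootSet_iff _).2 ⟨n + 1, hn', rfl⟩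
    have hlt : C.lt (x n) (x (n + 1)) := (h.lt_iff _ hn _ hn').2 (by omega)
    have hhead : (J.filter fun j => j ∈ C.rootSet i J ∧ C.lt (x n) j).head? =
        some (x (n + 1)) := by
      refine (hinc.filter _).head?_eq hC (by simp [hm, hmX, hlt]) fun z hz => ?_
      simp only [List.mem_filter, decide_eq_true_eq] at hz
      obtain ⟨k, hk, rfl⟩ := (h.mem_rootSet_iff z).1 hz.2.1
      have := (h.lt_iff _ hn _ hk).1 hz.2.2
      rcases (show n + 1 ≤ k from this).eq_or_lt with rfl | hlt
      · exact Or.inl rfl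
      · exact Or.inr ((h.lt_iff _ hn' _ hk).2 hlt)
    simp only [hhead]
    have hxe : x n ∉ J.erase (x (n + 1)) := fun hx => hxJ (List.mem_of_mem_erase hx)
    have hne : x n ≠ x (n + 1) := fun e => by rw [e] at hlt; exact hC.irrefl _ hlt
    have hmem : ∀ z, z ∈ (J.erase (x (n + 1))).orderedInsert C.lt (x n) ↔
        z = x n ∨ (z ≠ x (n + 1) ∧ z ∈ J) := fun z => by
      rw [List.mem_orderedInsert, (hinc.nodup hC).mem_erase_iff]
    refine ⟨_, rfl, (hinc.sublist List.erase_sublist).orderedInsert hC hxC hxe, hn, hxJ,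
      (hmem _).2 (Or.inl rfl), fun _ => hm, fun _ => ?_, fun z h1 h2 => ?_⟩
    · rw [hmem]; simp [hne.symm]
    · rw [hmem]; simp [h1, h2 hn']
  · have hfil : (J.filter fun j => j ∈ C.rootSet i J ∧ C.lt (x n) j) = [] := by
      rw [List.filter_eq_nil_iff]
      intro z _ hz
      simp only [decide_eq_true_eq] at hz
      obtain ⟨k, hk, rfl⟩ := (h.mem_rootSet_iff z).1 hz.1
      have := (h.lt_iff _ hn _ hk).1 hz.2
      omega
    simp only [hfil, List.head?_nil]
    refine ⟨_, rfl, hinc.orderedInsert hC hxC hxJ, hn, hxJ, ?_, fun h => absurd h hn',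
      fun h => absurd h hn', fun z h1 _ => ?_⟩
    · simp
    · simp [h1]

/-- The position of `I_{α_i}` before the leftmost `-` belongs to `J`; hence it is the one that `e_i`
removes. -/
theorem IsSignaturePath.exists_fold_of_isLeftmostMinus (hC : C.IsStrictLinear)
    (hJ : C.Admissible J) (h : C.IsSignaturePath i J N x s) {m : ℕ} (hm : m < N)
    (ha : C.IsLeftmostMinus i J (x m)) : ∃ n, m = n + 1 ∧ x n ∈ J := by
  obtain ⟨h1, h2, h3⟩ := (h.isLeftmostMinus_iff hm).1 ha
  obtain ⟨n, rfl, hk'⟩ := h.exists_pred_of_minus hC hJ hm h1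
  refine ⟨n, rfl, (h.mem_iff _ (by omega)).2 ?_⟩
  have := h3 n (by omega)
  omega

open Classical in
theorem IsSignaturePath.exists_eList_eq (hC : C.IsStrictLinear) (hJ : C.Admissible J)
    (h : C.IsSignaturePath i J N x s) {n : ℕ} (hn : n + 1 < N) (hx : x n ∈ J)
    (ha : C.IsLeftmostMinus i J (x (n + 1))) :
    ∃ K, C.eList i J = some K ∧ C.IsIncreasing K ∧ IsLowering N x n K J := by
  have hinc := hJ.isIncreasing
  have hex : ∃ a, C.IsLeftmostMinus i J a := ⟨_, ha⟩
  have hch : hex.choose = x (n + 1) := hex.choose_spec.unique hC.asymm ha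
  have hxJ := ha.1.1.2.1
  have hxC := ha.1.1.1
  rw [eList, dif_pos hex, hch]
  have hX := (h.mem_rootSet_iff _).2 ⟨n, by omega, rfl⟩
  have hlt : C.lt (x n) (x (n + 1)) := (h.lt_iff _ (by omega) _ hn).2 (by omega)
  have hlast : (J.filter fun j => j ∈ C.rootSet i J ∧ C.lt j (x (n + 1))).getLast? =
      some (x n) := by
    refine (hinc.filter _).getLast?_eq hC (by simp [hx, hX, hlt]) fun z hz => ?_
    simp only [List.mem_filter, decide_eq_true_eq] at hz
    obtain ⟨k, hk, rfl⟩ := (h.mem_rootSet_iff z).1 hz.2.1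
    have := (h.lt_iff _ hk _ hn).1 hz.2.2
    rcases (show k ≤ n by omega).eq_or_lt with rfl | hlt
    · exact Or.inl rfl
    · exact Or.inr ((h.lt_iff _ hk _ (by omega)).2 hlt)
  simp only [hlast]
  have hxe : x (n + 1) ∉ J.erase (x n) := fun hx => hxJ (List.mem_of_mem_erase hx)
  have hne : x n ≠ x (n + 1) := fun e => by rw [e] at hlt; exact hC.irrefl _ hlt
  have hmem : ∀ z, z ∈ (J.erase (x n)).orderedInsert C.lt (x (n + 1)) ↔
      z = x (n + 1) ∨ (z ≠ x n ∧ z ∈ J) := fun z => by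
    rw [List.mem_orderedInsert, (hinc.nodup hC).mem_erase_iff]
  refine ⟨_, rfl, (hinc.sublist List.erase_sublist).orderedInsert hC hxC hxe, by omega, ?_, hx,
    fun _ => (hmem _).2 (Or.inl rfl), fun _ => hxJ, fun z h1 h2 => ?_⟩
  · rw [hmem]; simp [hne]
  · rw [hmem]; simp [h1, h2 hn]

/-- The condition `⟨τ(J) ρ, α_i^∨⟩ < 0` says that `i` is a left descent of `τ(J)`. -/
theorem pairing_rho_neg_iff {u : P ≃ₗ[ℤ] P} (hu : u ∈ D.weyl) :
    D.pairing (u D.rho) (D.simpleCoroot i) < 0 ↔ D.IsDescent i u := by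
  constructor
  · intro hneg
    rcases isAscent_or_isDescent hu i with ⟨β, hβ⟩ | h
    · have := β.isRealRoot.pairing_map hu (βv' := D.simpleCoroot i) (hβ ▸ .simple i) D.rho
      have h2 := β.height_pos
      rw [height] at h2
      omega
    · exact h
  · rintro ⟨β, hβ⟩
    have := β.isRealRoot.pairing_map hu (βv' := -D.simpleCoroot i)
      (hβ ▸ (IsRealRoot.simple i).neg) D.rho
    have h2 := β.height_pos
    rw [height] at h2
    rw [map_neg] at this
    omega

open Classical in
theorem IsSignaturePath.exists_eList_eq_of_isDescent (hC : C.IsStrictLinear)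
    (hJ : C.Admissible J) {n : ℕ} (h : C.IsSignaturePath i J (n + 1) x s) (hx : x n ∈ J)
    (ha : ¬ ∃ a, C.IsLeftmostMinus i J a) (hd : D.IsDescent i (D.reflectionProd J)) :
    ∃ K, C.eList i J = some K ∧ C.IsIncreasing K ∧ IsLowering (n + 1) x n K J := by
  have hinc := hJ.isIncreasing
  rw [eList, dif_neg ha, if_pos ((pairing_rho_neg_iff (reflectionProd_mem J)).2 hd)]
  have hX := (h.mem_rootSet_iff _).2 ⟨n, by omega, rfl⟩
  have hlast : (J.filter fun j => j ∈ C.rootSet i J).getLast? = some (x n) := by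
    refine (hinc.filter _).getLast?_eq hC (by simp [hx, hX]) fun z hz => ?_
    simp only [List.mem_filter, decide_eq_true_eq] at hz
    obtain ⟨k, hk, rfl⟩ := (h.mem_rootSet_iff z).1 hz.2
    rcases (show k ≤ n by omega).eq_or_lt with rfl | hlt
    · exact Or.inl rfl
    · exact Or.inr ((h.lt_iff _ hk _ (by omega)).2 hlt)
  simp only [hlast]
  have hmem : ∀ z, z ∈ J.erase (x n) ↔ z ≠ x n ∧ z ∈ J := fun z =>
    (hinc.nodup hC).mem_erase_iff
  refine ⟨_, rfl, hinc.sublist List.erase_sublist, by omega, by rw [hmem]; simp, hx,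
    fun h => by omega, fun h => by omega, fun z h1 _ => ?_⟩
  rw [hmem]; simp [h1]

end CrystalOperators

end RootChain

end KacMoodyDatum

/-! ### Enumerations and strings of partial maps -/

/-- A finite set with a strict total order is the increasing image of `{0, …, N - 1}`. -/
theorem exists_strict_enumeration {α : Type*} [Nonempty α] {S : Set α} (hS : S.Finite)
    {r : α → α → Prop} (hasymm : ∀ x y, r x y → ¬ r y x)
    (htrans : ∀ x y z, r x y → r y z → r x z)
    (htri : ∀ x ∈ S, ∀ y ∈ S, r x y ∨ x = y ∨ r y x) :
    ∃ (N : ℕ) (x : ℕ → α), (∀ z, z ∈ S ↔ ∃ n < N, x n = z) ∧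
      ∀ m < N, ∀ n < N, r (x m) (x n) ↔ m < n := by
  classical
  have := hS.fintype
  let r' : S → S → Prop := fun x y => r x y
  have : IsStrictTotalOrder S r' :=
    { irrefl := fun x h => hasymm _ _ h h
      trans := fun x y z => htrans _ _ _
      trichotomous := fun x y h1 h2 => by
        rcases htri x x.2 y y.2 with h | h | h
        · exact absurd h h1
        · exact Subtype.ext h
        · exact absurd h h2 }
  let _ := linearOrderOfSTO r'
  let e := Fintype.orderIsoFinOfCardEq S rfl
  refine ⟨Fintype.card S, fun n => if h : n < Fintype.card S then (e ⟨n, h⟩ : α) else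
    Classical.arbitrary α, fun z => ⟨fun hz => ?_, ?_⟩, fun m hm n hn => ?_⟩
  · refine ⟨e.symm ⟨z, hz⟩, (e.symm ⟨z, hz⟩).2, ?_⟩
    dsimp only
    rw [dif_pos (e.symm ⟨z, hz⟩).2, Fin.eta, OrderIso.apply_symm_apply]
  · rintro ⟨n, hn, rfl⟩
    dsimp only
    rw [dif_pos hn]
    exact (e _).2
  · simp only [hm, hn, dif_pos]
    exact (e.lt_iff_lt (x := ⟨m, hm⟩) (y := ⟨n, hn⟩))

namespace CrystalData

section Strings

variable {B : Type*} {g : B → Option B}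

/-- `g ^ n b ≠ 0` and `g ^ (n + 1) b = 0`. -/
def HasString (g : B → Option B) (b : B) (n : ℕ) : Prop :=
  (fun c : Option B => c.bind g)^[n] (some b) ≠ none ∧
    (fun c : Option B => c.bind g)^[n + 1] (some b) = none

theorem HasString.of_none {b : B} (h : g b = none) : HasString g b 0 := by
  simp [HasString, h]

theorem HasString.of_some {b b' : B} {n : ℕ} (h : g b = some b') (h' : HasString g b' n) :
    HasString g b (n + 1) := by
  unfold HasString at *
  rw [Function.iterate_succ_apply, Function.iterate_succ_apply (n := n + 1)]
  simpa [h] using h'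

theorem HasString.stringLength_eq {b : B} {n : ℕ} (h : HasString g b n) :
    stringLength g b = n := by
  have hnone : ∀ k, (fun c : Option B => c.bind g)^[k] none = none := fun k => by
    induction k with
    | zero => rfl
    | succ k ih => rw [Function.iterate_succ_apply]; exact ih
  have hset : {m | (fun c : Option B => c.bind g)^[m] (some b) ≠ none} = Set.Iic n := by
    ext m
    simp only [Set.mem_ofPred_eq, Set.mem_Iic]
    constructor
    · intro hm
      by_contra! hlt
      obtain ⟨k, rfl⟩ := Nat.exists_eq_add_of_le hlt
      apply hm
      rw [Nat.add_comm (n + 1), Function.iterate_add_apply, h.2, hnone]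
    · intro hm hm'
      obtain ⟨k, rfl⟩ := Nat.exists_eq_add_of_le hm
      apply h.1
      rw [Nat.add_comm m, Function.iterate_add_apply, hm', hnone]
  rw [stringLength, hset, csSup_Iic]

end Strings

end CrystalData

namespace KacMoodyDatum

namespace RootChain

section Crystal

variable {I P Pv : Type*} [Fintype I] [DecidableEq I] [AddCommGroup P] [AddCommGroup Pv]
variable {D : KacMoodyDatum I P Pv} {C : D.RootChain}
variable {i : I} {N : ℕ} {x : ℕ → D.Position} {s : ℕ → ℤ}

/-! ### Strings of the crystal operators -/

open Classical in
/-- The letter of the `i`-signature at a position, as a number; it is `0` where there is none. -/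
noncomputable def letter (C : D.RootChain) (i : I) (J : List D.Position) (z : D.Position) : ℤ :=
  if C.IsPlus i J z then 1 else if C.IsMinus i J z then -1 else 0

open Classical in
/-- `1` if `i` is a left descent of `u`, and `0` otherwise. -/
noncomputable def descentIndicator (D : KacMoodyDatum I P Pv) (i : I) (u : P ≃ₗ[ℤ] P) : ℤ :=
  if D.IsDescent i u then 1 else 0

theorem IsSignaturePath.letter_eq {J : List D.Position} (h : C.IsSignaturePath i J N x s) {n : ℕ}
    (hn : n < N) : C.letter i J (x n) = s n - s (n + 1) := by
  have h1 := h.plus_iff n hn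
  have h2 := h.minus_iff n hn
  unfold letter
  rcases h.step n hn with h3 | h3 | h3
  · rw [if_pos (h1.2 h3)]; omega
  · rw [if_neg fun h => by have := h1.1 h; omega, if_neg fun h => by have := h2.1 h; omega]; omega
  · rw [if_neg fun h => by have := h1.1 h; omega, if_pos (h2.2 h3)]; omega

theorem letter_eq_zero {J : List D.Position} {z : D.Position} (hz : z ∉ C.rootSet i J) :
    C.letter i J z = 0 := by
  rw [letter, if_neg fun h => hz h.mem_rootSet, if_neg fun h => hz h.mem_rootSet]

theorem IsSignaturePath.finsum_letter {J : List D.Position} (h : C.IsSignaturePath i J N x s) :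
    ∑ᶠ z, C.letter i J z = s 0 - s N := by
  classical
  rw [finsum_eq_sum_of_support_subset (s := (Finset.range N).image x) _ fun z hz => ?_,
    Finset.sum_image fun m hm n hn => ?_, Finset.sum_congr rfl fun n hn => ?_,
    Finset.sum_range_sub']
  · exact h.letter_eq (Finset.mem_range.1 hn)
  · exact h.injective (by simpa using hm) (by simpa using hn)
  · have : z ∈ C.rootSet i J := by
      by_contra h'
      exact hz (letter_eq_zero h')
    simpa using (h.mem_rootSet_iff z).1 this

theorem exists_isSignaturePath (hC : C.IsStrictLinear) {J : List D.Position}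
    (hfin : (C.rootSet i J).Finite) :
    ∃ N x s, C.IsSignaturePath i J N x s := by
  have : Nonempty D.Position := ⟨(D.simplePosRoot i, 0)⟩
  obtain ⟨N, x, h1, h2⟩ := exists_strict_enumeration hfin hC.asymm hC.trans
    fun y hy z hz => hC.trichotomy y hy.1 z hz.1
  refine ⟨N, x, fun n => -∑ k ∈ Finset.range n, C.letter i J (x k), h1, h2, fun n hn => ?_,
    fun n hn => ?_, fun n hn => ?_⟩
  all_goals
    rw [Finset.sum_range_succ]
    have hX := (h1 (x n)).2 ⟨n, hn, rfl⟩
    have hpm : C.IsPlus i J (x n) → ¬ C.IsMinus i J (x n) := fun h h' =>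
      simpleRoot_ne_neg D i (h.2.2.symm.trans h'.2.2)
    unfold letter
  · by_cases h3 : C.IsPlus i J (x n)
    · simp only [h3, if_true, true_iff]; ring
    · by_cases h4 : C.IsMinus i J (x n)
      · simp only [h3, h4, if_true, if_false, false_iff]; omega
      · simp only [h3, h4, if_false, false_iff]; omega
  · by_cases h3 : C.IsPlus i J (x n)
    · simp only [h3, hpm h3, if_true, false_iff]; omega
    · by_cases h4 : C.IsMinus i J (x n)
      · simp only [h3, h4, if_true, if_false, true_iff]; ring
      · simp only [h3, h4, if_false, false_iff]; omega
  · by_cases h3 : C.IsPlus i J (x n)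
    · simp only [h3, if_true, h3.2.1, false_iff]; omega
    · by_cases h4 : C.IsMinus i J (x n)
      · simp only [h3, h4, if_true, if_false, h4.2.1, false_iff]; omega
      · simp only [h3, h4, if_false]
        have : x n ∈ J := by
          by_contra hJ'
          rcases hX.2 with h5 | h5
          · exact h3 ⟨hX.1, hJ', h5⟩
          · exact h4 ⟨hX.1, hJ', h5⟩
        simp [this]

theorem IsLowering.left_unique (hC : C.IsStrictLinear) {n : ℕ} {J K J' : List D.Position}
    (hJ : C.IsIncreasing J) (hK : C.IsIncreasing K) (h : IsLowering N x n J J')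
    (h' : IsLowering N x n K J') : J = K := by
  refine hJ.ext hC hK fun z => ?_
  by_cases hz : z = x n
  · subst hz; simp [h.notMem, h'.notMem]
  by_cases hz' : n + 1 < N ∧ z = x (n + 1)
  · obtain ⟨hn, rfl⟩ := hz'
    simp [h.mem hn, h'.mem hn]
  · rw [← h.mem_iff z hz fun h1 h2 => hz' ⟨h1, h2⟩, ← h'.mem_iff z hz fun h1 h2 => hz' ⟨h1, h2⟩]

theorem IsLowering.right_unique (hC : C.IsStrictLinear) {n : ℕ} {J J' K : List D.Position}
    (hJ : C.IsIncreasing J') (hK : C.IsIncreasing K) (h : IsLowering N x n J J')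
    (h' : IsLowering N x n J K) : J' = K := by
  refine hJ.ext hC hK fun z => ?_
  by_cases hz : z = x n
  · subst hz; simp [h.mem', h'.mem']
  by_cases hz' : n + 1 < N ∧ z = x (n + 1)
  · obtain ⟨hn, rfl⟩ := hz'
    simp [h.notMem' hn, h'.notMem' hn]
  · rw [h.mem_iff z hz fun h1 h2 => hz' ⟨h1, h2⟩, h'.mem_iff z hz fun h1 h2 => hz' ⟨h1, h2⟩]

theorem f_eq_none {J : C.Al} (h : ¬ ∃ a, C.IsRightmostPlus i J.1 a) : C.f i J = none := by
  rw [f, fList, dif_neg h]; rfl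

theorem e_eq_none {J : C.Al} (h : ¬ ∃ a, C.IsLeftmostMinus i J.1 a)
    (hd : ¬ D.IsDescent i (D.reflectionProd J.1)) : C.e i J = none := by
  rw [e, eList, dif_neg h, if_neg]; · rfl
  rwa [pairing_rho_neg_iff (reflectionProd_mem _)]

theorem toAl_eq {J : List D.Position} (h : C.Admissible J) : C.toAl J = some ⟨J, h⟩ := dif_pos h

theorem lowerPath_of_le {n l : ℕ} (h : l ≤ n) : lowerPath n s l = s l := if_pos h

theorem lowerPath_succ (n : ℕ) : lowerPath n s (n + 1) = s (n + 1) + 1 := by simp [lowerPath]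

theorem lowerPath_of_lt {n l : ℕ} (h : n + 1 < l) : lowerPath n s l = s l + 2 := by
  unfold lowerPath; split_ifs <;> omega

theorem raisePath_of_le {n l : ℕ} (h : l ≤ n) : raisePath n s l = s l := if_pos h

theorem raisePath_succ (n : ℕ) : raisePath n s (n + 1) = s (n + 1) - 1 := by simp [raisePath]

theorem raisePath_of_lt {n l : ℕ} (h : n + 1 < l) : raisePath n s l = s l - 2 := by
  unfold raisePath; split_ifs <;> omega

/-- The operator `f_i` in terms of the signature path. -/
theorem IsSignaturePath.exists_f_eq (hC : C.IsStrictLinear) {J : C.Al}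
    (h : C.IsSignaturePath i J.1 N x s) {n : ℕ} (hn : n < N)
    (ha : C.IsRightmostPlus i J.1 (x n)) :
    ∃ J' : C.Al, C.f i J = some J' ∧ IsLowering N x n J.1 J'.1 ∧
      C.IsSignaturePath i J'.1 N x (lowerPath n s) := by
  obtain ⟨K, h1, h2, h3⟩ := h.exists_fList_eq hC J.2 hn ha
  obtain ⟨hK, -, -⟩ := J.2.lower hC h2 h h3 ha.1.1
  refine ⟨⟨K, hK⟩, by rw [f, h1, Option.bind_some, toAl_eq hK], h3,
    h.lower hC J.2.isIncreasing h2 h3 ((h.plus_iff n hn).1 ha.1.1) fun hn' => ?_⟩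
  exact J.2.gamma_eq hC (h3.mem hn') ((h.mem_rootSet_iff _).2 ⟨_, hn', rfl⟩)

/-- The operator `e_i` in terms of the signature path, if a `-` remains. -/
theorem IsSignaturePath.exists_e_eq (hC : C.IsStrictLinear) {J : C.Al}
    (h : C.IsSignaturePath i J.1 N x s) {n : ℕ} (hn : n + 1 < N) (hx : x n ∈ J.1)
    (ha : C.IsLeftmostMinus i J.1 (x (n + 1))) :
    ∃ K : C.Al, C.e i J = some K ∧ IsLowering N x n K.1 J.1 ∧
      C.IsSignaturePath i K.1 N x (raisePath n s) := by
  obtain ⟨K, h1, h2, h3⟩ := h.exists_eList_eq hC J.2 hn hx ha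
  have hK := Admissible.raise hC h2 J.2 h h3 (fun _ => ha.1.1) fun h => by omega
  exact ⟨⟨K, hK⟩, by rw [e, h1, Option.bind_some, toAl_eq hK], h3,
    h.raise hC h2 J.2.isIncreasing h3 (fun _ => (h.minus_iff _ hn).1 ha.1.1)
      (J.2.gamma_eq hC hx ((h.mem_rootSet_iff _).2 ⟨n, by omega, rfl⟩))⟩

/-- The operator `e_i` in terms of the signature path, if no `-` remains. -/
theorem IsSignaturePath.exists_e_eq_of_isDescent (hC : C.IsStrictLinear) {J : C.Al} {n : ℕ}
    (h : C.IsSignaturePath i J.1 (n + 1) x s) (hx : x n ∈ J.1)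
    (ha : ¬ ∃ a, C.IsLeftmostMinus i J.1 a) (hd : D.IsDescent i (D.reflectionProd J.1)) :
    ∃ K : C.Al, C.e i J = some K ∧ IsLowering (n + 1) x n K.1 J.1 ∧
      C.IsSignaturePath i K.1 (n + 1) x (raisePath n s) := by
  obtain ⟨K, h1, h2, h3⟩ := h.exists_eList_eq_of_isDescent hC J.2 hx ha hd
  have hK := Admissible.raise hC h2 J.2 h h3 (fun h => by omega) fun _ => hd
  exact ⟨⟨K, hK⟩, by rw [e, h1, Option.bind_some, toAl_eq hK], h3,
    h.raise hC h2 J.2.isIncreasing h3 (fun h => by omega)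
      (J.2.gamma_eq hC hx ((h.mem_rootSet_iff _).2 ⟨n, by omega, rfl⟩))⟩

/-- If no `-` remains and `i` is a descent of `τ(J)`, then the last position of `I_{α_i}` belongs
to `J`; it is the one that `e_i` removes. -/
theorem IsSignaturePath.fold_of_not_exists (hC : C.IsStrictLinear) {J : List D.Position}
    (hJ : C.Admissible J) (h : C.IsSignaturePath i J N x s)
    (ha : ¬ ∃ a, C.IsLeftmostMinus i J a) (hd : D.IsDescent i (D.reflectionProd J)) :
    ∃ n, N = n + 1 ∧ x n ∈ J := by
  obtain ⟨n, rfl, hn⟩ := h.exists_pred_of_isDescent hC hJ hd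
  refine ⟨n, rfl, (h.mem_iff n (by omega)).2 ?_⟩
  rcases hn.eq_or_lt with h1 | h1
  · exact h1.symm
  · exact absurd (h.exists_isLeftmostMinus (l := n) (by omega) h1) ha

/-- The linear part of `s_{β_1, -ℓ_1} ⋯ s_{β_p, -ℓ_p}` is `s_{β_1} ⋯ s_{β_p}`. -/
theorem foldr_affineReflection_sub (L : List D.Position) (y : P) (c : ℤ) (β : P) :
    L.foldr D.affineReflection (y - c • β) =
      L.foldr D.affineReflection y - c • D.reflectionProd L β := by
  induction L with
  | nil => rfl
  | cons j L ih =>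
    rw [List.foldr_cons, ih, List.foldr_cons, reflectionProd_cons, LinearEquiv.mul_apply,
      reflection_apply]
    simp only [affineReflection, map_sub, map_smul, LinearMap.sub_apply, LinearMap.smul_apply,
      smul_eq_mul]
    module

variable (hC : C.IsStrictLinear) (hfin : ∀ i, ∀ J : C.Al, (C.rootSet i J.1).Finite)
include hC hfin

/-- `e_i` and `f_i` are inverse to each other where they do not vanish. -/
theorem f_eq_some_iff (i : I) (J J' : C.Al) : C.f i J = some J' ↔ C.e i J' = some J := by
  constructor
  · intro hf
    obtain ⟨N, x, s, h⟩ := exists_isSignaturePath hC (hfin i J)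
    by_cases hex : ∃ a, C.IsRightmostPlus i J.1 a
    swap
    · rw [f_eq_none hex] at hf; cases hf
    obtain ⟨a, ha⟩ := hex
    obtain ⟨n, hn, rfl⟩ := h.exists_index_of_isRightmostPlus ha
    obtain ⟨J'', h1, h2, h3⟩ := h.exists_f_eq hC hn ha
    obtain rfl : J'' = J' := Option.some.inj (h1.symm.trans hf)
    obtain ⟨h4, h5, h6⟩ := (h.isRightmostPlus_iff hn).1 ha
    by_cases hn' : n + 1 < N
    · have h7 := (h.mem_iff _ hn').1 (h2.mem hn')
      have ha' : C.IsLeftmostMinus i J''.1 (x (n + 1)) := by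
        refine (h3.isLeftmostMinus_iff hn').2 ⟨?_, fun l hl hl' => ?_, fun l hl => ?_⟩
        · rw [lowerPath_succ, lowerPath_of_lt (by omega)]; omega
        · have := h6 l (by omega) hl'
          rw [lowerPath_of_lt (by omega), lowerPath_of_lt hl]; omega
        · rcases hl.eq_or_lt with rfl | hl
          · exact le_rfl
          · have := h5 l (by omega)
            rw [lowerPath_succ, lowerPath_of_le (by omega)]; omega
      obtain ⟨K, h8, h9, -⟩ := h3.exists_e_eq hC hn' h2.mem' ha'
      rw [h8, Option.some.injEq]
      exact Subtype.ext (h9.left_unique hC K.2.isIncreasing J.2.isIncreasing h2)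
    · obtain rfl : N = n + 1 := by omega
      have hd : D.IsDescent i (D.reflectionProd J''.1) := by
        obtain ⟨-, h7, -⟩ := J.2.lower hC J''.2.isIncreasing h h2 ha.1.1
        rw [(h7 rfl).2, isDescent_simpleReflection_mul]
        exact (h7 rfl).1
      have hno : ¬ ∃ a, C.IsLeftmostMinus i J''.1 a := by
        rintro ⟨a, ha'⟩
        obtain ⟨m, hm, rfl⟩ := h3.exists_index_of_isLeftmostMinus ha'
        obtain ⟨h7, h8, -⟩ := (h3.isLeftmostMinus_iff hm).1 ha'
        have h9 := h8 (n + 1) hm le_rfl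
        rw [lowerPath_succ] at h9
        rcases (show m ≤ n by omega).eq_or_lt with rfl | hlt
        · have := (h3.mem_iff _ hm).1 h2.mem'
          omega
        · rw [h7, lowerPath_of_le hlt.le] at h9
          have := h5 m hlt.le
          omega
      obtain ⟨K, h8, h9, -⟩ := h3.exists_e_eq_of_isDescent hC h2.mem' hno hd
      rw [h8, Option.some.injEq]
      exact Subtype.ext (h9.left_unique hC K.2.isIncreasing J.2.isIncreasing h2)
  · intro he
    obtain ⟨N, x, s, h⟩ := exists_isSignaturePath hC (hfin i J')
    by_cases hex : ∃ a, C.IsLeftmostMinus i J'.1 a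
    · obtain ⟨a, ha⟩ := hex
      obtain ⟨m, hm, rfl⟩ := h.exists_index_of_isLeftmostMinus ha
      obtain ⟨n, rfl, hx⟩ := h.exists_fold_of_isLeftmostMinus hC J'.2 hm ha
      obtain ⟨K, h1, h2, h3⟩ := h.exists_e_eq hC hm hx ha
      obtain rfl : K = J := Option.some.inj (h1.symm.trans he)
      obtain ⟨h4, h5, h6⟩ := (h.isLeftmostMinus_iff hm).1 ha
      have h7 := (h.mem_iff n (by omega)).1 hx
      have ha' : C.IsRightmostPlus i K.1 (x n) := by
        refine (h3.isRightmostPlus_iff (by omega)).2 ⟨?_, fun l hl => ?_, fun l hl hl' => ?_⟩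
        · rw [raisePath_succ, raisePath_of_le le_rfl]; omega
        · have := h6 l (by omega)
          rw [raisePath_of_le le_rfl, raisePath_of_le hl]; omega
        · rw [raisePath_of_le le_rfl]
          rcases (show n + 1 ≤ l from hl).eq_or_lt with rfl | hl
          · rw [raisePath_succ]; omega
          · have := h5 l hl hl'
            rw [raisePath_of_lt hl]; omega
      obtain ⟨J'', h8, h9, -⟩ := h3.exists_f_eq hC (by omega) ha'
      rw [h8, Option.some.injEq]
      exact Subtype.ext (h9.right_unique hC J''.2.isIncreasing J'.2.isIncreasing h2)
    · by_cases hd : D.IsDescent i (D.reflectionProd J'.1)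
      swap
      · rw [e_eq_none hex hd] at he; cases he
      obtain ⟨n, rfl, hx⟩ := h.fold_of_not_exists hC J'.2 hex hd
      obtain ⟨K, h1, h2, h3⟩ := h.exists_e_eq_of_isDescent hC hx hex hd
      obtain rfl : K = J := Option.some.inj (h1.symm.trans he)
      have hmin : ∀ l ≤ n + 1, s (n + 1) ≤ s l := fun l hl => by
        by_contra! hlt
        exact hex (h.exists_isLeftmostMinus hl hlt)
      have h7 := (h.mem_iff n (by omega)).1 hx
      have ha' : C.IsRightmostPlus i K.1 (x n) := by
        refine (h3.isRightmostPlus_iff (by omega)).2 ⟨?_, fun l hl => ?_, fun l hl hl' => ?_⟩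
        · rw [raisePath_succ, raisePath_of_le le_rfl]; omega
        · have := hmin l (by omega)
          rw [raisePath_of_le le_rfl, raisePath_of_le hl]; omega
        · obtain rfl : l = n + 1 := by omega
          rw [raisePath_of_le le_rfl, raisePath_succ]; omega
      obtain ⟨J'', h8, h9, -⟩ := h3.exists_f_eq hC (by omega) ha'
      rw [h8, Option.some.injEq]
      exact Subtype.ext (h9.right_unique hC J''.2.isIncreasing J'.2.isIncreasing h2)

omit hfin in
/-- The length of an `f_i`-string is the depth of the minimum of the path below its start. -/
theorem IsSignaturePath.hasString_f {J : C.Al} (h : C.IsSignaturePath i J.1 N x s) {M : ℤ}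
    (hM : ∀ l ≤ N, M ≤ s l) (hM' : ∃ l ≤ N, s l = M) {k : ℕ} (hk : s 0 - M = k) :
    CrystalData.HasString (C.f i) J k := by
  induction k generalizing J s M with
  | zero =>
    refine .of_none (f_eq_none ?_)
    rintro ⟨a, ha⟩
    obtain ⟨n, hn, rfl⟩ := h.exists_index_of_isRightmostPlus ha
    obtain ⟨h1, h2, -⟩ := (h.isRightmostPlus_iff hn).1 ha
    have := h2 0 (Nat.zero_le n)
    have := hM (n + 1) (by omega)
    omega
  | succ k ih =>
    obtain ⟨l, hl, rfl⟩ := hM'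
    obtain ⟨a, ha⟩ := h.exists_isRightmostPlus hl (by omega)
    obtain ⟨n, hn, rfl⟩ := h.exists_index_of_isRightmostPlus ha
    obtain ⟨h1, h2, h3⟩ := (h.isRightmostPlus_iff hn).1 ha
    obtain ⟨J', h4, h5, h6⟩ := h.exists_f_eq hC hn ha
    have hmin : s (n + 1) = s l := by
      have := hM (n + 1) (by omega)
      rcases Nat.lt_or_ge n l with hnl | hnl
      · have := h3 l hnl hl; omega
      · have := h2 l hnl; omega
    refine .of_some h4 (ih h6 (M := s l + 1) (fun l' hl' => ?_) ⟨n + 1, by omega, ?_⟩ ?_)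
    · rcases lt_trichotomy l' (n + 1) with h7 | rfl | h7
      · have := h2 l' (by omega)
        rw [lowerPath_of_le (by omega)]; omega
      · rw [lowerPath_succ]; omega
      · have := h3 l' (by omega) hl'
        rw [lowerPath_of_lt h7]; omega
    · rw [lowerPath_succ]; omega
    · rw [lowerPath_of_le (Nat.zero_le n)]; push_cast at hk; omega

omit hfin in
/-- The length of an `e_i`-string is the height of the end of the path over its minimum, plus one
if `τ(J)` has the descent `i`. -/
theorem IsSignaturePath.hasString_e {J : C.Al} (h : C.IsSignaturePath i J.1 N x s) {M : ℤ}
    (hM : ∀ l ≤ N, M ≤ s l) (hM' : ∃ l ≤ N, s l = M) {k : ℕ}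
    (hk : s N - M + descentIndicator D i (D.reflectionProd J.1) = k) :
    CrystalData.HasString (C.e i) J k := by
  induction k generalizing J s M with
  | zero =>
    have h0 := hM N le_rfl
    have hd : ¬ D.IsDescent i (D.reflectionProd J.1) := fun hd => by
      rw [descentIndicator, if_pos hd] at hk; omega
    rw [descentIndicator, if_neg hd] at hk
    refine .of_none (e_eq_none ?_ hd)
    rintro ⟨a, ha⟩
    obtain ⟨n, hn, rfl⟩ := h.exists_index_of_isLeftmostMinus ha
    obtain ⟨h1, h2, h3⟩ := (h.isLeftmostMinus_iff hn).1 ha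
    have := h2 N (by omega) le_rfl
    have := hM n hn.le
    omega
  | succ k ih =>
    by_cases hex : ∃ a, C.IsLeftmostMinus i J.1 a
    · obtain ⟨a, ha⟩ := hex
      obtain ⟨m, hm, rfl⟩ := h.exists_index_of_isLeftmostMinus ha
      obtain ⟨n, rfl, hx⟩ := h.exists_fold_of_isLeftmostMinus hC J.2 hm ha
      obtain ⟨h1, h2, h3⟩ := (h.isLeftmostMinus_iff hm).1 ha
      obtain ⟨K, h4, h5, h6⟩ := h.exists_e_eq hC hm hx ha
      have h7 := (h.mem_iff n (by omega)).1 hx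
      obtain ⟨-, -, h8⟩ := K.2.lower hC J.2.isIncreasing h6 h5
        ((h6.plus_iff n (by omega)).2 (by rw [raisePath_succ, raisePath_of_le le_rfl]; omega))
      have hmin : s (n + 1) = M := by
        obtain ⟨l, hl, rfl⟩ := hM'
        have := hM (n + 1) (by omega)
        rcases Nat.lt_or_ge (n + 1) l with hnl | hnl
        · have := h2 l hnl hl; omega
        · have := h3 l hnl; omega
      refine .of_some h4 (ih h6 (M := M - 1) (fun l' hl' => ?_) ⟨n + 1, by omega, ?_⟩ ?_)
      · rcases lt_trichotomy l' (n + 1) with h9 | rfl | h9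
        · have := hM l' hl'
          rw [raisePath_of_le (by omega)]; omega
        · rw [raisePath_succ]; omega
        · have := h2 l' (by omega) hl'
          rw [raisePath_of_lt h9]; omega
      · rw [raisePath_succ]; omega
      · rw [raisePath_of_lt hm, ← h8 hm]; push_cast at hk; omega
    · have hmin : s N = M := by
        obtain ⟨l, hl, rfl⟩ := hM'
        have := hM N le_rfl
        by_contra hne
        exact hex (h.exists_isLeftmostMinus hl (by omega))
      have hd : D.IsDescent i (D.reflectionProd J.1) := by
        by_contra hd
        rw [descentIndicator, if_neg hd] at hk; push_cast at hk; omega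
      obtain ⟨n, rfl, hx⟩ := h.fold_of_not_exists hC J.2 hex hd
      obtain ⟨K, h4, h5, h6⟩ := h.exists_e_eq_of_isDescent hC hx hex hd
      have h7 := (h.mem_iff n (by omega)).1 hx
      obtain ⟨-, h8, -⟩ := K.2.lower hC J.2.isIncreasing h6 h5
        ((h6.plus_iff n (by omega)).2 (by rw [raisePath_succ, raisePath_of_le le_rfl]; omega))
      have hnd := (h8 rfl).1.not_isDescent
      rw [descentIndicator, if_pos hd] at hk
      refine .of_some h4 (ih h6 (M := M - 1) (fun l' hl' => ?_) ⟨n + 1, by omega, ?_⟩ ?_)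
      · rcases hl'.eq_or_lt with rfl | h9
        · rw [raisePath_succ]; omega
        · have := hM l' hl'
          rw [raisePath_of_le (by omega)]; omega
      · rw [raisePath_succ]; omega
      · rw [raisePath_succ, descentIndicator, if_neg hnd]; push_cast at hk; omega

/-- The lengths of the two strings through `J` differ by the drop of the signature path, corrected
by one at a descent of `τ(J)`. -/
theorem exists_hasString (i : I) (J : C.Al) :
    ∃ p q : ℕ, CrystalData.HasString (C.f i) J p ∧ CrystalData.HasString (C.e i) J q ∧
      (p : ℤ) - q = ∑ᶠ z, C.letter i J.1 z - descentIndicator D i (D.reflectionProd J.1) := by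
  obtain ⟨N, x, s, h⟩ := exists_isSignaturePath hC (hfin i J)
  obtain ⟨M, hM, hM'⟩ := exists_min s N
  have h0 := hM 0 (Nat.zero_le N)
  have hN := hM N le_rfl
  have hd : 0 ≤ descentIndicator D i (D.reflectionProd J.1) := by
    unfold descentIndicator; split_ifs <;> omega
  refine ⟨(s 0 - M).toNat, (s N - M + descentIndicator D i (D.reflectionProd J.1)).toNat,
    h.hasString_f hC hM hM' (by omega), h.hasString_e hC hM hM' (by omega), ?_⟩
  rw [h.finsum_letter]
  omega

omit hfin in
/-- Adding a position of `I_{α_i}` changes the weight by a multiple of `α_i`. -/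
theorem exists_foldr_insert {J J' : List D.Position} (hJ : C.IsIncreasing J)
    (hJ' : C.IsIncreasing J') {a : D.Position} (haX : a ∈ C.rootSet i J) (haJ : a ∉ J)
    (hmem : ∀ y, y ∈ J' ↔ y = a ∨ y ∈ J) (v : P) :
    ∃ c : ℤ, J'.foldr D.affineReflection v = J.foldr D.affineReflection v + c • D.simpleRoot i := by
  obtain ⟨L₁, L₂, rfl, h1, h2⟩ := hJ.exists_split_of_notMem hC haX.1 haJ
  obtain rfl : J' = L₁ ++ a :: L₂ := hJ'.ext hC (hJ.insert hC haX.1 h1 h2) fun y => by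
    rw [hmem]; simp only [List.mem_append, List.mem_cons]; tauto
  have ha : C.gamma (L₁ ++ L₂) a = D.reflectionProd L₁ a.1.root :=
    gamma_append h1 fun j hj => hC.asymm _ _ (h2 j hj)
  rw [List.foldr_append, List.foldr_cons, List.foldr_append, affineReflection,
    foldr_affineReflection_sub, ← ha]
  rcases haX.2 with h | h
  · exact ⟨-_, by rw [h, neg_smul, sub_eq_add_neg]⟩
  · exact ⟨_, by rw [h, smul_neg, sub_neg_eq_add]⟩

omit hfin in
/-- Adding a position of `I_{α_i}` and removing another one changes the weight along `α_i`. -/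
theorem IsLowering.exists_wt_eq {J J' : C.Al} (h : C.IsSignaturePath i J.1 N x s)
    {s' : ℕ → ℤ} (h' : C.IsSignaturePath i J'.1 N x s') {n : ℕ}
    (hl : IsLowering N x n J.1 J'.1) (lam : P) :
    ∃ c : ℤ, C.wt lam J' = C.wt lam J + c • D.simpleRoot i := by
  classical
  have hnX := (h.mem_rootSet_iff _).2 ⟨n, hl.lt, rfl⟩
  set K := J.1.orderedInsert C.lt (x n) with hK
  have hKinc : C.IsIncreasing K := J.2.isIncreasing.orderedInsert hC hnX.1 hl.notMem
  have hKmem : ∀ y, y ∈ K ↔ y = x n ∨ y ∈ J.1 := fun y => by rw [hK, List.mem_orderedInsert]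
  obtain ⟨c, hc⟩ := exists_foldr_insert hC J.2.isIncreasing hKinc hnX hl.notMem hKmem (-lam)
  by_cases hn : n + 1 < N
  · have hKmem' : ∀ y, y ∈ K ↔ y = x (n + 1) ∨ y ∈ J'.1 := fun y => by
      rw [hKmem]
      by_cases hy : y = x n
      · subst hy; simp [hl.mem']
      · by_cases hy' : y = x (n + 1)
        · subst hy'; simp [hl.mem hn]
        · rw [hl.mem_iff y hy fun _ => hy']; simp [hy, hy']
    obtain ⟨c', hc'⟩ := exists_foldr_insert hC J'.2.isIncreasing hKinc
      ((h'.mem_rootSet_iff _).2 ⟨n + 1, hn, rfl⟩) (hl.notMem' hn) hKmem' (-lam)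
    refine ⟨c' - c, ?_⟩
    have : J'.1.foldr D.affineReflection (-lam) = J.1.foldr D.affineReflection (-lam) +
        c • D.simpleRoot i - c' • D.simpleRoot i := eq_sub_of_add_eq (hc'.symm.trans hc)
    rw [wt, wt, this]
    module
  · have hKJ : J'.1 = K := J'.2.isIncreasing.ext hC hKinc fun y => by
      rw [hKmem]
      by_cases hy : y = x n
      · subst hy; simp [hl.mem']
      · rw [hl.mem_iff y hy fun h => absurd h hn]; simp [hy]
    refine ⟨-c, ?_⟩
    rw [wt, wt, hKJ, hc]
    module

/-- If the weight pairs with the simple coroots as the signature predicts, then `f_i` subtracts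
`α_i` from the weight. -/
theorem wt_f_eq {lam : P}
    (hwt : ∀ i, ∀ J : C.Al, D.pairing (C.wt lam J) (D.simpleCoroot i) =
      ∑ᶠ z, C.letter i J.1 z - descentIndicator D i (D.reflectionProd J.1))
    (i : I) (J J' : C.Al) (hf : C.f i J = some J') : C.wt lam J' = C.wt lam J - D.simpleRoot i := by
  obtain ⟨N, x, s, h⟩ := exists_isSignaturePath hC (hfin i J)
  by_cases hex : ∃ a, C.IsRightmostPlus i J.1 a
  swap
  · rw [f_eq_none hex] at hf; cases hf
  obtain ⟨a, ha⟩ := hex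
  obtain ⟨n, hn, rfl⟩ := h.exists_index_of_isRightmostPlus ha
  obtain ⟨J'', h1, h2, h3⟩ := h.exists_f_eq hC hn ha
  obtain rfl : J'' = J' := Option.some.inj (h1.symm.trans hf)
  obtain ⟨c, hc⟩ := h2.exists_wt_eq hC h h3 lam
  obtain ⟨-, h4, h5⟩ := J.2.lower hC J''.2.isIncreasing h h2 ha.1.1
  have e1 := hwt i J
  have e2 := hwt i J''
  rw [h.finsum_letter] at e1
  rw [h3.finsum_letter, lowerPath_of_le (Nat.zero_le n), hc, map_add, LinearMap.add_apply, e1,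
    map_smul, LinearMap.smul_apply, D.pairing_simple, D.cartan_diag, smul_eq_mul] at e2
  have hc1 : c = -1 := by
    by_cases hn' : n + 1 < N
    · rw [h5 hn', lowerPath_of_lt hn'] at e2
      omega
    · obtain rfl : N = n + 1 := by omega
      obtain ⟨h6, h7⟩ := h4 rfl
      rw [h7, descentIndicator, if_neg h6.not_isDescent, descentIndicator,
        if_pos (isDescent_simpleReflection_mul.2 h6), lowerPath_succ] at e2
      omega
  rw [hc, hc1]
  module

/-- The crystal axioms for the admissible sequences of a chain in which every `I_{α_i}` is
finite. -/
theorem isCrystal {lam : P} (hne : Nonempty C.Al)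
    (hwt : ∀ i, ∀ J : C.Al, D.pairing (C.wt lam J) (D.simpleCoroot i) =
      ∑ᶠ z, C.letter i J.1 z - descentIndicator D i (D.reflectionProd J.1)) :
    CrystalData.IsCrystal D
      { e := C.e
        f := C.f
        eps := fun i J => ((CrystalData.stringLength (C.e i) J : ℤ) : WithBot ℤ)
        phi := fun i J => ((CrystalData.stringLength (C.f i) J : ℤ) : WithBot ℤ)
        wt := C.wt lam } := by
  have hfe := f_eq_some_iff hC hfin
  have hwf := wt_f_eq hC hfin hwt
  have he : ∀ i J J', C.e i J = some J' → CrystalData.stringLength (C.e i) J =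
      CrystalData.stringLength (C.e i) J' + 1 := fun i J J' h => by
    obtain ⟨p, q, -, h2, -⟩ := exists_hasString hC hfin i J'
    rw [h2.stringLength_eq, (h2.of_some h).stringLength_eq]
  have hf : ∀ i J J', C.f i J = some J' → CrystalData.stringLength (C.f i) J =
      CrystalData.stringLength (C.f i) J' + 1 := fun i J J' h => by
    obtain ⟨p, q, h2, -, -⟩ := exists_hasString hC hfin i J'
    rw [h2.stringLength_eq, (h2.of_some h).stringLength_eq]
  refine ⟨hne, fun i J => ?_, fun i J J' h => ?_, fun i J J' h => ?_, fun i J J' h => ?_,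
    fun i J J' h => ?_, fun i J J' h => ?_, fun i J J' h => hwf i J J' h, hfe, fun i J h => ?_⟩
  · obtain ⟨p, q, h1, h2, h3⟩ := exists_hasString hC hfin i J
    rw [← hwt] at h3
    dsimp only
    rw [h1.stringLength_eq, h2.stringLength_eq, ← WithBot.coe_add, WithBot.coe_inj]
    omega
  · dsimp only at h ⊢
    rw [he i J J' h, ← WithBot.coe_add, WithBot.coe_inj]; push_cast; omega
  · dsimp only at h ⊢
    rw [hf i J' J ((hfe i J' J).2 h), ← WithBot.coe_add, WithBot.coe_inj]; push_cast; omega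
  · dsimp only at h ⊢
    rw [hwf i J' J ((hfe i J' J).2 h)]; abel
  · dsimp only at h ⊢
    rw [he i J' J ((hfe i J J').1 h), ← WithBot.coe_add, WithBot.coe_inj]; push_cast; omega
  · dsimp only at h ⊢
    rw [hf i J J' h, ← WithBot.coe_add, WithBot.coe_inj]; push_cast; omega
  · exact absurd h (WithBot.coe_ne_bot)

end Crystal

end RootChain

end KacMoodyDatum

/-! ### The lexicographic time axis -/

/-- The values in which the lex chains compare positions: a rational number, refined by a vector
of infinitesimals. -/
abbrev LexTime (I : Type*) : Type _ := ℚ ×ₗ Lex (I → ℚ)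

namespace LexTime

variable {I : Type*}

/-- The main part of a lexicographic value. -/
def main : LexTime I →+ ℚ where
  toFun r := (ofLex r).1
  map_zero' := rfl
  map_add' _ _ := rfl

/-- The coordinates of the infinitesimal part of a lexicographic value. -/
def coord (i : I) : LexTime I →+ ℚ where
  toFun r := ofLex (ofLex r).2 i
  map_zero' := rfl
  map_add' _ _ := rfl

theorem ext {r t : LexTime I} (h : main r = main t) (h' : ∀ i, coord i r = coord i t) : r = t :=
  Prod.ext (α := ℚ) (β := I → ℚ) h (funext h')

/-- An integer, as a lexicographic value. -/
def ofInt : ℤ →+ LexTime I where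
  toFun n := toLex ((n : ℚ), 0)
  map_zero' := by
    refine LexTime.ext ?_ fun i => rfl
    exact Int.cast_zero
  map_add' m n := by
    refine LexTime.ext ?_ fun i => ?_
    · exact Int.cast_add m n
    · exact (add_zero (0 : ℚ)).symm

@[simp] theorem main_ofInt (n : ℤ) : main (ofInt n : LexTime I) = n := rfl

@[simp] theorem coord_ofInt (i : I) (n : ℤ) : coord i (ofInt n : LexTime I) = 0 := rfl

variable [Fintype I] [LinearOrder I]

/-- `F` is the integral part of `r`. -/
def IsFloor (r : LexTime I) (F : ℤ) : Prop := ∀ n : ℤ, ofInt n ≤ r ↔ n ≤ F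

omit [Fintype I] in
theorem ofInt_le_iff {n : ℤ} {r : LexTime I} :
    ofInt n ≤ r ↔ (n : ℚ) < main r ∨ (n : ℚ) = main r ∧ 0 ≤ (ofLex r).2 := Prod.Lex.le_iff

theorem exists_isFloor (r : LexTime I) : ∃ F, IsFloor r F := by
  by_cases h : 0 ≤ (ofLex r).2
  · refine ⟨⌊main r⌋, fun n => ?_⟩
    rw [ofInt_le_iff, and_iff_left h, ← le_iff_lt_or_eq, Int.le_floor]
  · refine ⟨⌈main r⌉ - 1, fun n => ?_⟩
    rw [ofInt_le_iff, or_iff_left fun h' => h h'.2, Int.le_sub_one_iff, Int.lt_ceil]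

omit [Fintype I] in
theorem isFloor_ofInt (n : ℤ) : IsFloor (ofInt n : LexTime I) n := fun m => by
  rw [ofInt_le_iff, main_ofInt,
    and_iff_left (show (0 : Lex (I → ℚ)) ≤ (ofLex (ofInt n : LexTime I)).2 from le_rfl),
    ← le_iff_lt_or_eq, Int.cast_le]

omit [Fintype I] in
theorem IsFloor.sub_ofInt {r : LexTime I} {F : ℤ} (h : IsFloor r F) (m : ℤ) :
    IsFloor (r - ofInt m) (F - m) := fun n => by
  rw [le_sub_iff_add_le, ← map_add, h, le_sub_iff_add_le]

theorem IsFloor.neg {r : LexTime I} {F : ℤ} (h : IsFloor r F) (hr : ∀ n, r ≠ ofInt n) :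
    IsFloor (-r) (-F - 1) := fun n => by
  have h1 := h (-n)
  have h2 : ofInt n ≤ -r ↔ ¬ ofInt (-n) ≤ r := by
    rw [le_neg, map_neg, not_le]
    refine ⟨fun h => h.lt_of_ne fun e => hr (-n) ?_, le_of_lt⟩
    rw [e, map_neg]
  rw [h2, h1]
  omega

theorem ofInt_add_lt_iff {q q' : ℤ} {r t : LexTime I} (hr : 0 ≤ main r)
    (hr' : main r < 1) (ht : 0 ≤ main t) (ht' : main t < 1) :
    ofInt q + r < ofInt q' + t ↔ q < q' ∨ q = q' ∧ r < t := by
  have key : ∀ (m n : ℤ) (a b : LexTime I), 0 ≤ main b → main a < 1 → m < n →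
      ofInt m + a < ofInt n + b := fun m n a b hb ha hmn => by
    refine Prod.Lex.lt_iff.2 (Or.inl ?_)
    change main (ofInt m + a) < main (ofInt n + b)
    have : (m : ℚ) + 1 ≤ n := by exact_mod_cast hmn
    rw [map_add, map_add, main_ofInt, main_ofInt]
    linarith
  rcases lt_trichotomy q q' with h | rfl | h
  · exact iff_of_true (key _ _ _ _ ht hr' h) (Or.inl h)
  · simp
  · refine iff_of_false (key _ _ _ _ hr ht' h).le.not_gt ?_
    rintro (h' | ⟨rfl, -⟩)
    · exact lt_asymm h h'
    · exact lt_irrefl _ h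

end LexTime

namespace KacMoodyDatum

open LexTime

section LexChain

variable {I P Pv : Type*} [Fintype I] [LinearOrder I] [AddCommGroup P] [AddCommGroup Pv]
variable (D : KacMoodyDatum I P Pv) (lam : P)

/-- The vector `(h, c_1, …, c_n) / ⟨lam, β^∨⟩` by which the lex chain compares positions: the
time at which the path `t ↦ -t lam + ε`, with infinitesimal `⟨ε, α_i^∨⟩`, crosses the hyperplane
`⟨x, β^∨⟩ = -h`. -/
def lexTime (z : D.Position) : LexTime I :=
  toLex ((z.2 : ℚ) / (D.pairing lam z.1.coroot : ℚ), toLex fun i =>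
    (D.pairing (D.fundamentalWeight i) z.1.coroot : ℚ) / (D.pairing lam z.1.coroot : ℚ))

/-- The functional `ξ` on the infinitesimal vector `ε`. -/
def lexShift : (P →ₗ[ℤ] ℤ) →+ LexTime I where
  toFun ξ := toLex (0, toLex fun i => (ξ (D.fundamentalWeight i) : ℚ))
  map_zero' := LexTime.ext rfl fun _ => Int.cast_zero
  map_add' _ _ := LexTime.ext (add_zero (0 : ℚ)).symm fun _ => Int.cast_add _ _

/-- The negative of the functional `ξ` on the path `t ↦ -t lam + ε` at the time of `j`. -/
def pathValue (j : D.Position) : (P →ₗ[ℤ] ℤ) →+ LexTime I where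
  toFun ξ := ξ lam • D.lexTime lam j - D.lexShift ξ
  map_zero' := by simp
  map_add' ξ η := by rw [LinearMap.add_apply, map_add, add_smul]; abel

variable {D lam}

theorem lexChain_lt {x y : D.Position} :
    (D.lexChain lam).lt x y ↔ D.lexTime lam x < D.lexTime lam y := Iff.rfl

theorem mem_lexChain {z : D.Position} :
    z ∈ (D.lexChain lam).carrier ↔ 0 ≤ z.2 ∧ z.2 < D.pairing lam z.1.coroot := Iff.rfl

theorem pathValue_apply (j : D.Position) (ξ : P →ₗ[ℤ] ℤ) :
    D.pathValue lam j ξ = ξ lam • D.lexTime lam j - D.lexShift ξ := rfl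

theorem coord_lexShift (i : I) (ξ : P →ₗ[ℤ] ℤ) :
    coord i (D.lexShift ξ) = ξ (D.fundamentalWeight i) := rfl

theorem main_lexShift (ξ : P →ₗ[ℤ] ℤ) : main (D.lexShift ξ) = 0 := rfl

theorem main_lexTime (z : D.Position) :
    main (D.lexTime lam z) = (z.2 : ℚ) / (D.pairing lam z.1.coroot : ℚ) := rfl

theorem coord_lexTime (i : I) (z : D.Position) : coord i (D.lexTime lam z) =
    (D.pairing (D.fundamentalWeight i) z.1.coroot : ℚ) / (D.pairing lam z.1.coroot : ℚ) := rfl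

theorem pathValue_coroot {z : D.Position} (hz : z ∈ (D.lexChain lam).carrier) :
    D.pathValue lam z (D.pairing.flip z.1.coroot) = ofInt z.2 := by
  have h : (D.pairing lam z.1.coroot : ℚ) ≠ 0 := by
    rw [mem_lexChain] at hz
    exact_mod_cast (hz.1.trans_lt hz.2).ne'
  rw [pathValue_apply]
  refine LexTime.ext ?_ fun i => ?_
  · rw [map_sub, map_zsmul, main_lexTime, main_lexShift, main_ofInt, LinearMap.flip_apply,
      zsmul_eq_mul, mul_div_cancel₀ _ h, sub_zero]
  · rw [map_sub, map_zsmul, coord_lexTime, coord_lexShift, coord_ofInt, LinearMap.flip_apply,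
      LinearMap.flip_apply, zsmul_eq_mul, mul_div_cancel₀ _ h, sub_self]

theorem eq_of_lexTime_eq {y z : D.Position} (hy : 0 < D.pairing lam y.1.coroot)
    (hz : 0 < D.pairing lam z.1.coroot) (h : D.lexTime lam y = D.lexTime lam z) : y = z := by
  have hy0 : (D.pairing lam y.1.coroot : ℚ) ≠ 0 := by exact_mod_cast hy.ne'
  have hz0 : (D.pairing lam z.1.coroot : ℚ) ≠ 0 := by exact_mod_cast hz.ne'
  have h1 : y.1 = z.1 := PosRoot.eq_of_proportional
    (r := (D.pairing lam y.1.coroot : ℚ) / (D.pairing lam z.1.coroot : ℚ)) fun i => by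
      have := congrArg (coord i) h
      rw [coord_lexTime, coord_lexTime, div_eq_div_iff hy0 hz0] at this
      field_simp
      linear_combination this
  refine Prod.ext h1 ?_
  have := congrArg main h
  rw [main_lexTime, main_lexTime, h1, div_left_inj' hz0] at this
  exact_mod_cast this

theorem lexChain_isStrictLinear : (D.lexChain lam).IsStrictLinear where
  asymm _ _ h h' := lt_asymm (lexChain_lt.1 h) (lexChain_lt.1 h')
  trans _ _ _ h h' := lt_trans (lexChain_lt.1 h) (lexChain_lt.1 h')
  trichotomy y hy z hz := by
    rw [lexChain_lt, lexChain_lt]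
    rcases lt_trichotomy (D.lexTime lam y) (D.lexTime lam z) with h | h | h
    · exact Or.inl h
    · exact Or.inr (Or.inl (eq_of_lexTime_eq (hy.1.trans_lt hy.2) (hz.1.trans_lt hz.2) h))
    · exact Or.inr (Or.inr h)

/-- The position `(β, ℓ)` comes after `j` if and only if `ℓ` exceeds the value of the path at
`j`. -/
theorem lexChain_lt_iff {j z : D.Position} (hz : z ∈ (D.lexChain lam).carrier) :
    (D.lexChain lam).lt j z ↔ D.pathValue lam j (D.pairing.flip z.1.coroot) < ofInt z.2 := by
  have h0 := mem_lexChain.1 hz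
  have hL : 0 < D.pairing.flip z.1.coroot lam := h0.1.trans_lt h0.2
  rw [lexChain_lt, ← pathValue_coroot hz, pathValue_apply, pathValue_apply, sub_lt_sub_iff_right,
    zsmul_lt_zsmul_iff_right hL]

/-- The path stays in the range of levels that the chain assigns to a root. -/
theorem isFloor_pathValue_bounds (hlam : ∀ i, 0 ≤ D.pairing lam (D.simpleCoroot i))
    {j : D.Position} (hj : j ∈ (D.lexChain lam).carrier) (β : D.PosRoot) {F : ℤ}
    (hF : IsFloor (D.pathValue lam j (D.pairing.flip β.coroot)) F) :
    -1 ≤ F ∧ F ≤ D.pairing lam β.coroot - 1 := by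
  rw [mem_lexChain] at hj
  have hLj : (0 : ℚ) < D.pairing lam j.1.coroot := by exact_mod_cast hj.1.trans_lt hj.2
  have hj0 : (0 : ℚ) ≤ j.2 := by exact_mod_cast hj.1
  have hj1 : (j.2 : ℚ) < D.pairing lam j.1.coroot := by exact_mod_cast hj.2
  have hL := β.pairing_nonneg hlam
  have hmain : main (D.pathValue lam j (D.pairing.flip β.coroot)) =
      D.pairing lam β.coroot * (j.2 / D.pairing lam j.1.coroot) := by
    rw [pathValue_apply, map_sub, map_zsmul, main_lexTime, main_lexShift, sub_zero, zsmul_eq_mul]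
    rfl
  have hq1 : (j.2 : ℚ) / D.pairing lam j.1.coroot < 1 := (div_lt_one hLj).2 hj1
  constructor
  · rw [← hF (-1), ofInt_le_iff, hmain]
    left
    have : (0 : ℚ) ≤ D.pairing lam β.coroot * (j.2 / D.pairing lam j.1.coroot) := by positivity
    push_cast
    linarith
  · rw [Int.le_sub_one_iff, ← not_le, ← hF, ofInt_le_iff, hmain]
    rcases hL.eq_or_lt with hL | hL
    · rw [← hL]
      simp only [Int.cast_zero, zero_mul, lt_self_iff_false, false_or, true_and]
      have hval : D.pathValue lam j (D.pairing.flip β.coroot) =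
          -D.lexShift (D.pairing.flip β.coroot) := by
        rw [pathValue_apply, LinearMap.flip_apply, ← hL, zero_smul, zero_sub]
      rw [hval]
      intro hle
      have h1 : (0 : Lex (I → ℚ)) ≤ toLex fun i =>
          (D.pairing (D.fundamentalWeight i) β.coroot : ℚ) :=
        Pi.toLex_monotone fun i => by
          change (0 : ℚ) ≤ _
          exact_mod_cast β.fundamentalWeight_nonneg i
      have h2 : (toLex fun i => (D.pairing (D.fundamentalWeight i) β.coroot : ℚ)) ≤
          (0 : Lex (I → ℚ)) := neg_nonneg.1 hle
      obtain ⟨i, hi⟩ := β.exists_fundamentalWeight_pos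
      have h3 : ((D.pairing (D.fundamentalWeight i) β.coroot : ℤ) : ℚ) = 0 :=
        congrFun (congrArg ofLex (le_antisymm h2 h1)) i
      have : D.pairing (D.fundamentalWeight i) β.coroot = 0 := by exact_mod_cast h3
      omega
    · have hLq : (0 : ℚ) < D.pairing lam β.coroot := by exact_mod_cast hL
      have := mul_lt_of_lt_one_right hLq hq1
      rintro (h | ⟨h, -⟩)
      · linarith
      · linarith

/-! ### The weight of an admissible sequence and its signature -/

open Classical in
variable (D) in
/-- `1` on `α_i`, `-1` on `-α_i`, and `0` elsewhere. -/
noncomputable def rootSign (i : I) (y : P) : ℤ :=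
  if y = D.simpleRoot i then 1 else if y = -D.simpleRoot i then -1 else 0

theorem rootSign_simpleRoot (i : I) : D.rootSign i (D.simpleRoot i) = 1 := if_pos rfl

theorem rootSign_neg (i : I) : D.rootSign i (-D.simpleRoot i) = -1 := by
  rw [rootSign, if_neg (RootChain.simpleRoot_ne_neg D i).symm, if_pos rfl]

theorem rootSign_eq_zero {i : I} {y : P}
    (h : ¬ (y = D.simpleRoot i ∨ y = -D.simpleRoot i)) : D.rootSign i y = 0 := by
  rw [not_or] at h
  rw [rootSign, if_neg h.1, if_neg h.2]

theorem PosRoot.eq_of_map_eq {i : I} {u : P ≃ₗ[ℤ] P} {β γ : D.PosRoot}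
    (hβ : u β.root = D.simpleRoot i ∨ u β.root = -D.simpleRoot i)
    (hγ : u γ.root = D.simpleRoot i ∨ u γ.root = -D.simpleRoot i) : β = γ := by
  have h : β.root = γ.root ∨ β.root = -γ.root := by
    rw [← u.injective.eq_iff, ← u.injective.eq_iff (b := -γ.root), map_neg]
    rcases hβ with h | h <;> rcases hγ with h' | h' <;> simp [h, h']
  rcases h with h | h
  · exact PosRoot.ext_root h
  · exact absurd (D.eq_zero_of_mem_of_neg_mem β.positive
      (by rw [h, neg_neg]; exact γ.positive)) β.isRealRoot.ne_zero

theorem finite_setOf_map_eq (i : I) (u : P ≃ₗ[ℤ] P) :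
    {z : D.Position | z ∈ (D.lexChain lam).carrier ∧
      (u z.1.root = D.simpleRoot i ∨ u z.1.root = -D.simpleRoot i)}.Finite := by
  by_cases h : ∃ β : D.PosRoot, u β.root = D.simpleRoot i ∨ u β.root = -D.simpleRoot i
  · obtain ⟨β, hβ⟩ := h
    refine ((Set.finite_Ico 0 (D.pairing lam β.coroot)).image fun l => (β, l)).subset ?_
    rintro ⟨γ, l⟩ ⟨h1, h2⟩
    obtain rfl := PosRoot.eq_of_map_eq hβ h2
    exact ⟨l, h1, rfl⟩
  · refine Set.finite_empty.subset ?_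
    rintro z ⟨-, hz⟩
    exact (h ⟨_, hz⟩).elim

open Classical in
theorem finite_rootSet (i : I) (J : List D.Position) :
    ((D.lexChain lam).rootSet i J).Finite := by
  refine ((J.sublists.toFinset.finite_toSet.biUnion fun L _ =>
    finite_setOf_map_eq (lam := lam) i (D.reflectionProd L))).subset ?_
  rintro z ⟨h1, h2⟩
  refine Set.mem_biUnion (x := J.filter fun j => (D.lexChain lam).lt j z) ?_ ⟨h1, h2⟩
  simp [List.filter_sublist]

open Classical in
theorem letter_eq (i : I) (J : List D.Position) (z : D.Position) :
    (D.lexChain lam).letter i J z = if z ∈ (D.lexChain lam).carrier ∧ z ∉ J then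
      D.rootSign i ((D.lexChain lam).gamma J z) else 0 := by
  unfold RootChain.letter RootChain.IsPlus RootChain.IsMinus rootSign
  split_ifs <;> tauto

open Classical in
/-- The sum of the signs over the positions that satisfy `p`, where `p` selects the levels
above `F`. -/
theorem finsum_rootSign (i : I) (u : P ≃ₗ[ℤ] P) {β : D.PosRoot}
    (hβ : u β.root = D.simpleRoot i ∨ u β.root = -D.simpleRoot i) {p : D.Position → Prop} {F : ℤ}
    (hp : ∀ l, (β, l) ∈ (D.lexChain lam).carrier → (p (β, l) ↔ F < l)) (hF : -1 ≤ F)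
    (hF' : F ≤ D.pairing lam β.coroot - 1) :
    ∑ᶠ z : D.Position, (if z ∈ (D.lexChain lam).carrier ∧ p z then D.rootSign i (u z.1.root)
      else 0) = D.rootSign i (u β.root) * (D.pairing lam β.coroot - 1 - F) := by
  rw [finsum_eq_sum_of_support_subset
    (s := (Finset.Ioc F (D.pairing lam β.coroot - 1)).image fun l => (β, l)) _ ?_,
    Finset.sum_image (fun a _ b _ h => (Prod.ext_iff.1 h).2), Finset.sum_congr rfl
      (g := fun _ => D.rootSign i (u β.root)) fun l hl => ?_, Finset.sum_const, Int.card_Ioc,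
    nsmul_eq_mul, mul_comm, Int.toNat_of_nonneg (by omega)]
  · rw [Finset.mem_Ioc] at hl
    have hc : (β, l) ∈ (D.lexChain lam).carrier := ⟨by dsimp only; omega, by dsimp only; omega⟩
    rw [if_pos ⟨hc, (hp l hc).2 hl.1⟩]
  · rintro ⟨γ, l⟩ hz
    rw [Function.mem_support] at hz
    have h1 : (γ, l) ∈ (D.lexChain lam).carrier ∧ p (γ, l) := by
      by_contra h; exact hz (if_neg h)
    rw [if_pos h1] at hz
    have h2 : u γ.root = D.simpleRoot i ∨ u γ.root = -D.simpleRoot i := by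
      by_contra h; exact hz (rootSign_eq_zero h)
    obtain rfl := PosRoot.eq_of_map_eq hβ h2
    have h3 := (hp l h1.1).1 h1.2
    have h4 := (mem_lexChain.1 h1.1).2
    simp only [Finset.coe_image, Finset.coe_Ioc, Set.mem_image, Set.mem_Ioc]
    exact ⟨l, ⟨h3, by dsimp only at h4; omega⟩, rfl⟩

variable (lam) in
open Classical in
/-- The sign with which `u` sends the root of `z` to `± α_i`, for `z` after `j`. -/
noncomputable def tailSign (i : I) (u : P ≃ₗ[ℤ] P) (j z : D.Position) : ℤ :=
  if z ∈ (D.lexChain lam).carrier ∧ (D.lexChain lam).lt j z then D.rootSign i (u z.1.root) else 0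

theorem hasFiniteSupport_tailSign (i : I) (u : P ≃ₗ[ℤ] P) (j : D.Position) :
    Function.HasFiniteSupport (D.tailSign lam i u j) := by
  refine (finite_setOf_map_eq (lam := lam) i u).subset fun z hz => ?_
  rw [Function.mem_support, tailSign] at hz
  have h1 : z ∈ (D.lexChain lam).carrier ∧ (D.lexChain lam).lt j z := by
    by_contra h; exact hz (if_neg h)
  rw [if_pos h1] at hz
  exact ⟨h1.1, by by_contra h; exact hz (rootSign_eq_zero h)⟩

variable (D) in
/-- The functional `x ↦ ⟨u x, α_i^∨⟩`. -/
def pulledCoroot (i : I) (u : P ≃ₗ[ℤ] P) : P →ₗ[ℤ] ℤ :=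
  (D.pairing.flip (D.simpleCoroot i)).comp (u : P →ₗ[ℤ] P)

theorem pulledCoroot_apply (i : I) (u : P ≃ₗ[ℤ] P) (y : P) :
    D.pulledCoroot i u y = D.pairing (u y) (D.simpleCoroot i) := rfl

theorem pulledCoroot_eq {i : I} {u : P ≃ₗ[ℤ] P} (hu : u ∈ D.weyl) {β : D.PosRoot}
    (hβ : u β.root = D.simpleRoot i) : D.pulledCoroot i u = D.pairing.flip β.coroot :=
  LinearMap.ext fun y =>
    β.isRealRoot.pairing_map hu (βv' := D.simpleCoroot i) (hβ ▸ .simple i) y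

theorem pulledCoroot_eq_neg {i : I} {u : P ≃ₗ[ℤ] P} (hu : u ∈ D.weyl) {β : D.PosRoot}
    (hβ : u β.root = -D.simpleRoot i) : D.pulledCoroot i u = -D.pairing.flip β.coroot :=
  LinearMap.ext fun y => by
    have := β.isRealRoot.pairing_map hu (βv' := -D.simpleCoroot i)
      (hβ ▸ (IsRealRoot.simple i).neg) y
    rw [map_neg] at this
    rw [pulledCoroot_apply, LinearMap.neg_apply, LinearMap.flip_apply, ← this, neg_neg]

theorem pulledCoroot_mul_reflection (i : I) (u : P ≃ₗ[ℤ] P) (γ : D.PosRoot) :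
    D.pulledCoroot i (u * D.reflection γ) =
      D.pulledCoroot i u - D.pulledCoroot i u γ.root • D.pairing.flip γ.coroot :=
  LinearMap.ext fun y => by
    simp only [pulledCoroot_apply, LinearEquiv.mul_apply, reflection_apply, map_sub, map_smul,
      LinearMap.sub_apply, LinearMap.smul_apply, smul_eq_mul, LinearMap.flip_apply]
    ring

theorem finsum_tailSign_of_isAscent (hlam : ∀ i, 0 ≤ D.pairing lam (D.simpleCoroot i)) {i : I}
    {u : P ≃ₗ[ℤ] P} (hu : u ∈ D.weyl) {j : D.Position} (hj : j ∈ (D.lexChain lam).carrier)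
    (ha : D.IsAscent i u) {F : ℤ} (hF : IsFloor (D.pathValue lam j (D.pulledCoroot i u)) F) :
    ∑ᶠ z, D.tailSign lam i u j z = D.pulledCoroot i u lam - 1 - F := by
  obtain ⟨β, hβ⟩ := ha
  rw [pulledCoroot_eq hu hβ] at hF ⊢
  obtain ⟨h1, h2⟩ := isFloor_pathValue_bounds hlam hj β hF
  refine (finsum_rootSign i u (Or.inl hβ) (fun l hl => ?_) h1 h2).trans ?_
  · rw [lexChain_lt_iff hl, ← not_le, hF, not_le]
  · rw [hβ, rootSign_simpleRoot, one_mul]; rfl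

theorem finsum_tailSign_of_isDescent (hlam : ∀ i, 0 ≤ D.pairing lam (D.simpleCoroot i)) {i : I}
    {u : P ≃ₗ[ℤ] P} (hu : u ∈ D.weyl) {j : D.Position} (hj : j ∈ (D.lexChain lam).carrier)
    (hd : D.IsDescent i u) {F : ℤ} (hF : IsFloor (-D.pathValue lam j (D.pulledCoroot i u)) F) :
    ∑ᶠ z, D.tailSign lam i u j z = D.pulledCoroot i u lam + 1 + F := by
  obtain ⟨β, hβ⟩ := hd
  rw [pulledCoroot_eq_neg hu hβ, map_neg, neg_neg] at hF
  obtain ⟨h1, h2⟩ := isFloor_pathValue_bounds hlam hj β hF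
  refine (finsum_rootSign i u (Or.inr hβ) (fun l hl => ?_) h1 h2).trans ?_
  · rw [lexChain_lt_iff hl, ← not_le, hF, not_le]
  · rw [hβ, rootSign_neg, pulledCoroot_eq_neg hu hβ, LinearMap.neg_apply, LinearMap.flip_apply]
    ring

/-- Where the path does not cross a hyperplane, the signs after `j` sum up to the same expression
for ascents and descents. -/
theorem finsum_tailSign_sub (hlam : ∀ i, 0 ≤ D.pairing lam (D.simpleCoroot i)) {i : I}
    {u : P ≃ₗ[ℤ] P} (hu : u ∈ D.weyl) {j : D.Position} (hj : j ∈ (D.lexChain lam).carrier)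
    {F : ℤ} (hF : IsFloor (D.pathValue lam j (D.pulledCoroot i u)) F)
    (hn : ∀ n, D.pathValue lam j (D.pulledCoroot i u) ≠ ofInt n) :
    ∑ᶠ z, D.tailSign lam i u j z - RootChain.descentIndicator D i u =
      D.pulledCoroot i u lam - 1 - F := by
  rcases isAscent_or_isDescent hu i with h | h
  · rw [finsum_tailSign_of_isAscent hlam hu hj h hF, RootChain.descentIndicator,
      if_neg h.not_isDescent, sub_zero]
  · rw [finsum_tailSign_of_isDescent hlam hu hj h (hF.neg hn), RootChain.descentIndicator,
      if_pos h]
    ring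

theorem map_root_eq_of_pathValue {i : I} {u : P ≃ₗ[ℤ] P} (hu : u ∈ D.weyl) {j : D.Position}
    {n : ℤ} (hn : D.pathValue lam j (D.pulledCoroot i u) = ofInt n) :
    u j.1.root = D.simpleRoot i ∨ u j.1.root = -D.simpleRoot i := by
  have key : ∀ (β : D.PosRoot) (n : ℤ), D.pathValue lam j (D.pairing.flip β.coroot) = ofInt n →
      β = j.1 := fun β n h => by
    refine PosRoot.eq_of_proportional
      (r := (D.pairing lam β.coroot : ℚ) / (D.pairing lam j.1.coroot : ℚ)) fun k => ?_
    have := congrArg (coord k) h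
    rw [pathValue_apply, map_sub, map_zsmul, coord_lexTime, coord_lexShift, coord_ofInt,
      zsmul_eq_mul, sub_eq_zero, LinearMap.flip_apply, LinearMap.flip_apply] at this
    rw [← this]
    ring
  rcases isAscent_or_isDescent hu i with ⟨β, hβ⟩ | ⟨β, hβ⟩
  · rw [pulledCoroot_eq hu hβ] at hn
    exact Or.inl (key β n hn ▸ hβ)
  · rw [pulledCoroot_eq_neg hu hβ, map_neg, neg_eq_iff_eq_neg, ← map_neg] at hn
    exact Or.inr (key β _ hn ▸ hβ)

open Classical in
/-- A new last element `j` of the sequence changes the signature at `j` and after `j` only. -/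
theorem letter_append_singleton {i : I} {J : List D.Position} {j : D.Position}
    (hJ : (D.lexChain lam).IsIncreasing (J ++ [j])) (z : D.Position) :
    (D.lexChain lam).letter i (J ++ [j]) z = (D.lexChain lam).letter i J z -
      (Pi.single j (D.rootSign i (D.reflectionProd J j.1.root)) : D.Position → ℤ) z +
      D.tailSign lam i (D.reflectionProd J * D.reflection j.1) j z -
      D.tailSign lam i (D.reflectionProd J) j z := by
  have hC := lexChain_isStrictLinear (D := D) (lam := lam)
  have hjC : j ∈ (D.lexChain lam).carrier := hJ.1 j (by simp)
  have hlt : ∀ k ∈ J, (D.lexChain lam).lt k j := fun k hk => hJ.lt_of_append hk (by simp)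
  have hjJ : j ∉ J := fun h => hC.irrefl j (hlt j h)
  rw [letter_eq, letter_eq, tailSign, tailSign]
  by_cases hz : z ∈ (D.lexChain lam).carrier
  swap
  · have : z ≠ j := by rintro rfl; exact hz hjC
    simp [hz, this]
  rcases hC.trichotomy z hz j hjC with h | rfl | h
  · have h1 : z ≠ j := by rintro rfl; exact hC.irrefl _ h
    have h2 : ¬ (D.lexChain lam).lt j z := hC.asymm _ _ h
    have h3 : (D.lexChain lam).gamma (J ++ [j]) z = (D.lexChain lam).gamma J z :=
      RootChain.gamma_eq_of_mem_iff hC hJ.of_append_left hJ fun y hy => by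
        have : y ≠ j := by rintro rfl; exact h2 hy
        simp [this]
    simp [h1, h2, h3, hz]
  · have h3 : (D.lexChain lam).gamma J z = D.reflectionProd J z.1.root := by
      have := RootChain.gamma_append (C := D.lexChain lam) (L₁ := J) (L₂ := []) hlt (by simp)
      rwa [List.append_nil] at this
    simp [hz, hjJ, h3, hC.irrefl]
  · have h1 : z ≠ j := by rintro rfl; exact hC.irrefl _ h
    have h2 : z ∉ J := fun h' => hC.asymm _ _ h (hlt z h')
    have h5 : ∀ k ∈ J, (D.lexChain lam).lt k z := fun k hk => hC.trans _ _ _ (hlt k hk) h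
    have h3 : (D.lexChain lam).gamma J z = D.reflectionProd J z.1.root := by
      have := RootChain.gamma_append (C := D.lexChain lam) (L₁ := J) (L₂ := []) h5 (by simp)
      rwa [List.append_nil] at this
    have h4 : (D.lexChain lam).gamma (J ++ [j]) z = D.reflectionProd (J ++ [j]) z.1.root := by
      have := RootChain.gamma_append (C := D.lexChain lam) (L₁ := J ++ [j]) (L₂ := [])
        (fun k hk => by
          rcases List.mem_append.1 hk with hk | hk
          · exact h5 k hk
          · rw [List.mem_singleton.1 hk]; exact h) (by simp)
      rwa [List.append_nil] at this
    simp [hz, h1, h2, h3, h4, h]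

theorem hasFiniteSupport_letter (i : I) (J : List D.Position) :
    Function.HasFiniteSupport ((D.lexChain lam).letter i J) :=
  (finite_rootSet (lam := lam) i J).subset fun z hz => by
    by_contra h
    exact hz (RootChain.letter_eq_zero h)

/-- The weight of an admissible sequence pairs with `α_i^∨` to the sum of the `i`-signature,
corrected at a descent of `τ(J)`. By induction on `J`: adding a last element `j` reflects the part
of the path after the time of `j`, and moves its end by the value of the path at `j`. -/
theorem pairing_wt_eq (hlam : ∀ i, 0 ≤ D.pairing lam (D.simpleCoroot i)) (i : I)
    (J : (D.lexChain lam).Al) :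
    D.pairing ((D.lexChain lam).wt lam J) (D.simpleCoroot i) =
      ∑ᶠ z, (D.lexChain lam).letter i J.1 z -
        RootChain.descentIndicator D i (D.reflectionProd J.1) := by
  classical
  obtain ⟨J, hJ⟩ := J
  change D.pairing (-J.foldr D.affineReflection (-lam)) (D.simpleCoroot i) = _
  dsimp only
  induction J using List.reverseRecOn with
  | nil =>
    have h1 := finsum_rootSign (lam := lam) i 1 (β := D.simplePosRoot i) (Or.inl rfl)
      (p := fun _ => True) (F := -1) (fun l hl => by
        have := (mem_lexChain.1 hl).1; dsimp only at this; simp only [true_iff]; omega) le_rfl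
      (by have := hlam i; change -1 ≤ D.pairing lam (D.simpleCoroot i) - 1; omega)
    rw [show (1 : P ≃ₗ[ℤ] P) (D.simplePosRoot i).root = D.simpleRoot i from rfl,
      rootSign_simpleRoot] at h1
    have h2 := (finsum_congr fun z => show (D.lexChain lam).letter i [] z = _ by
      rw [letter_eq]; simp [RootChain.gamma]).trans h1
    rw [h2, reflectionProd_nil, RootChain.descentIndicator, if_neg (isAscent_one i).not_isDescent,
      List.foldr_nil, neg_neg]
    change D.pairing lam (D.simpleCoroot i) = _ * (D.pairing lam (D.simpleCoroot i) - 1 - -1) - 0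
    ring
  | append_singleton J j ih =>
    obtain ⟨hc1, hc2⟩ := isBruhatChain_append.1 hJ.2.2
    have hJ' : (D.lexChain lam).Admissible J :=
      ⟨hJ.isIncreasing.of_append_left.1, hJ.isIncreasing.of_append_left.2, hc1⟩
    have hj : j ∈ (D.lexChain lam).carrier := hJ.1 j (by simp)
    have hcov := hc2.1
    rw [one_mul] at hcov
    set u := D.reflectionProd J with hu_def
    have hu : u ∈ D.weyl := reflectionProd_mem J
    have hu' : u * D.reflection j.1 ∈ D.weyl := mul_mem hu (reflection_mem _)
    have hprod : D.reflectionProd (J ++ [j]) = u * D.reflection j.1 := by simp [hu_def]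
    -- the change of the weight
    have hw : D.pairing (-(J ++ [j]).foldr D.affineReflection (-lam)) (D.simpleCoroot i) =
        D.pairing (-J.foldr D.affineReflection (-lam)) (D.simpleCoroot i) +
          (j.2 - D.pairing lam j.1.coroot) * D.pulledCoroot i u j.1.root := by
      rw [List.foldr_append, List.foldr_cons, List.foldr_nil, affineReflection,
        RootChain.foldr_affineReflection_sub, pulledCoroot_apply]
      simp only [map_neg, map_sub, map_smul, LinearMap.neg_apply, LinearMap.sub_apply,
        LinearMap.smul_apply, smul_eq_mul]
      ring
    -- the change of the signature
    have hs : ∑ᶠ z, (D.lexChain lam).letter i (J ++ [j]) z =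
        ∑ᶠ z, (D.lexChain lam).letter i J z - D.rootSign i (u j.1.root) +
          ∑ᶠ z, D.tailSign lam i (u * D.reflection j.1) j z -
          ∑ᶠ z, D.tailSign lam i u j z := by
      have hsingle : Function.HasFiniteSupport
          (Pi.single j (D.rootSign i (u j.1.root)) : D.Position → ℤ) :=
        (Set.finite_singleton j).subset Pi.support_single_subset
      have hl := hasFiniteSupport_letter (D := D) (lam := lam) i J
      have ht := hasFiniteSupport_tailSign (D := D) (lam := lam) i u j
      have ht' := hasFiniteSupport_tailSign (D := D) (lam := lam) i (u * D.reflection j.1) j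
      have e1 := finsum_sub_distrib ((hl.sub hsingle).add ht') ht
      have e2 := finsum_add_distrib (hl.sub hsingle) ht'
      have e3 := finsum_sub_distrib hl hsingle
      rw [finsum_eq_single (Pi.single j _) j fun z hz => Pi.single_eq_of_ne hz _,
        Pi.single_eq_same] at e3
      refine (finsum_congr (letter_append_singleton hJ.isIncreasing)).trans (e1.trans ?_)
      exact congrArg (· - _) (e2.trans (congrArg (· + _) e3))
    have hval := pathValue_coroot hj
    have hpv : D.pathValue lam j (D.pulledCoroot i (u * D.reflection j.1)) =
        D.pathValue lam j (D.pulledCoroot i u) - ofInt (D.pulledCoroot i u j.1.root * j.2) := by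
      rw [pulledCoroot_mul_reflection, map_sub, map_zsmul, hval, ← map_zsmul, smul_eq_mul]
    have hlam' : D.pulledCoroot i (u * D.reflection j.1) lam = D.pulledCoroot i u lam -
        D.pulledCoroot i u j.1.root * D.pairing lam j.1.coroot := by
      rw [pulledCoroot_mul_reflection]; rfl
    rw [hw, ih hJ', hs, hprod]
    by_cases hfold : u j.1.root = D.simpleRoot i
    · -- `j` is a fold at a hyperplane orthogonal to `α_i`
      have ha : D.IsAscent i u := ⟨_, hfold⟩
      have hd : D.IsDescent i (u * D.reflection j.1) := by
        rw [simpleReflection_mul_eq hu (Or.inl hfold), isDescent_simpleReflection_mul]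
        exact ha
      have hξ := pulledCoroot_eq hu hfold
      have h2 : D.pulledCoroot i u j.1.root = 2 := by
        rw [hξ]; exact j.1.isRealRoot.pairing_eq_two
      have h3 : D.pulledCoroot i u lam = D.pairing lam j.1.coroot := by rw [hξ]; rfl
      rw [← hξ] at hval
      rw [hval, h2, ← map_sub] at hpv
      rw [finsum_tailSign_of_isAscent hlam hu hj ha (F := j.2) (by
          rw [hval]; exact isFloor_ofInt _),
        finsum_tailSign_of_isDescent hlam hu' hj hd (F := j.2) (by
          rw [hpv, ← map_neg]
          convert isFloor_ofInt (I := I) j.2 using 2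
          ring),
        hlam', h2, h3, hfold, rootSign_simpleRoot, RootChain.descentIndicator,
        RootChain.descentIndicator, if_pos hd, if_neg ha.not_isDescent]
      ring
    · -- otherwise the path does not cross such a hyperplane at the time of `j`
      have hno : ¬ (u j.1.root = D.simpleRoot i ∨ u j.1.root = -D.simpleRoot i) := by
        rintro (h | h)
        · exact hfold h
        · have := hcov.map_root_mem hu
          rw [h] at this
          exact (IsRealRoot.simple (D := D) i).ne_zero
            (D.eq_zero_of_mem_of_neg_mem (D.simpleRoot_mem i) this)
      have hn : ∀ n, D.pathValue lam j (D.pulledCoroot i u) ≠ ofInt n := fun n h =>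
        hno (map_root_eq_of_pathValue hu h)
      have hn' : ∀ n, D.pathValue lam j (D.pulledCoroot i (u * D.reflection j.1)) ≠ ofInt n := by
        intro n h
        rw [hpv, sub_eq_iff_eq_add, ← map_add] at h
        exact hn _ h
      obtain ⟨F, hF⟩ := exists_isFloor (D.pathValue lam j (D.pulledCoroot i u))
      have hF' := hF.sub_ofInt (D.pulledCoroot i u j.1.root * j.2)
      rw [← hpv] at hF'
      have e1 := finsum_tailSign_sub hlam hu hj hF hn
      have e2 := finsum_tailSign_sub hlam hu' hj hF' hn'
      rw [hlam'] at e2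
      rw [rootSign_eq_zero hno]
      linear_combination e1 - e2

theorem isCrystal_al (hlam : ∀ i, 0 ≤ D.pairing lam (D.simpleCoroot i)) :
    (D.al lam).IsCrystal D :=
  RootChain.isCrystal lexChain_isStrictLinear (fun i J => finite_rootSet i J.1)
    ⟨⟨[], by simp, List.Pairwise.nil, trivial⟩⟩ (pairing_wt_eq hlam)

end LexChain

end KacMoodyDatum

namespace KacMoodyDatum

namespace RootChain

section UpperEmbedding

variable {I P Pv : Type*} [Fintype I] [DecidableEq I] [AddCommGroup P] [AddCommGroup Pv]
variable {D : KacMoodyDatum I P Pv} {C C' : D.RootChain} {τ : D.Position → D.Position}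
variable {i : I} {J : List D.Position} {y z w : D.Position}

/-! ### Chains that are upper sets of larger chains -/

/-- The map `τ` identifies the chain `C` with an upper set of the chain `C'`. -/
structure IsUpperEmbedding (C C' : D.RootChain) (τ : D.Position → D.Position) : Prop where
  isStrictLinear' : C'.IsStrictLinear
  fst_eq : ∀ z, (τ z).1 = z.1
  injective : Function.Injective τ
  map_mem : ∀ z ∈ C.carrier, τ z ∈ C'.carrier
  lt_iff : ∀ y ∈ C.carrier, ∀ z ∈ C.carrier, C'.lt (τ y) (τ z) ↔ C.lt y z
  lt_of_forall_ne : ∀ z ∈ C.carrier, ∀ y ∈ C'.carrier, (∀ x ∈ C.carrier, τ x ≠ y) → C'.lt y (τ z)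

namespace IsUpperEmbedding

theorem exists_eq_of_lt (h : IsUpperEmbedding C C' τ) (hz : z ∈ C.carrier) (hy : y ∈ C'.carrier)
    (hlt : C'.lt (τ z) y) : ∃ x ∈ C.carrier, τ x = y := by
  by_contra! hne
  exact h.isStrictLinear'.asymm _ _ hlt (h.lt_of_forall_ne z hz y hy hne)

theorem reflectionProd_map (h : IsUpperEmbedding C C' τ) (J : List D.Position) :
    D.reflectionProd (J.map τ) = D.reflectionProd J := by
  simp only [reflectionProd, List.map_map, Function.comp_def, h.fst_eq]

theorem isBruhatChain_map (h : IsUpperEmbedding C C' τ) (u : P ≃ₗ[ℤ] P) (J : List D.Position) :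
    D.IsBruhatChain u (J.map τ) ↔ D.IsBruhatChain u J := by
  induction J generalizing u with
  | nil => exact Iff.rfl
  | cons j J ih => simp only [List.map_cons, IsBruhatChain, h.fst_eq, ih]

theorem admissible_map (h : IsUpperEmbedding C C' τ) (hJ : ∀ j ∈ J, j ∈ C.carrier) :
    C'.Admissible (J.map τ) ↔ C.Admissible J := by
  rw [Admissible, Admissible, h.isBruhatChain_map, List.pairwise_map]
  refine and_congr ?_ (and_congr_left' (List.Pairwise.iff_of_mem fun hy hz =>
    h.lt_iff _ (hJ _ hy) _ (hJ _ hz)))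
  refine iff_of_true (fun j hj => ?_) hJ
  obtain ⟨k, hk, rfl⟩ := List.mem_map.1 hj
  exact h.map_mem k (hJ k hk)

theorem gamma_map (h : IsUpperEmbedding C C' τ) (hJ : ∀ j ∈ J, j ∈ C.carrier)
    (hz : z ∈ C.carrier) : C'.gamma (J.map τ) (τ z) = C.gamma J z := by
  rw [gamma, gamma, List.filter_map, h.reflectionProd_map, h.fst_eq]
  congr 2
  refine List.filter_congr fun j hj => ?_
  exact decide_eq_decide.2 (h.lt_iff j (hJ j hj) z hz)

theorem gamma_of_forall_ne (h : IsUpperEmbedding C C' τ) (hJ : ∀ j ∈ J, j ∈ C.carrier)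
    (hy : y ∈ C'.carrier) (hne : ∀ x ∈ C.carrier, τ x ≠ y) :
    C'.gamma (J.map τ) y = y.1.root := by
  rw [gamma, List.filter_eq_nil_iff.2 fun j hj => ?_]
  · rfl
  · obtain ⟨k, hk, rfl⟩ := List.mem_map.1 hj
    simpa using h.isStrictLinear'.asymm _ _ (h.lt_of_forall_ne k (hJ k hk) y hy hne)

theorem mem_rootSet_map (h : IsUpperEmbedding C C' τ) (hJ : ∀ j ∈ J, j ∈ C.carrier)
    (hz : z ∈ C.carrier) : τ z ∈ C'.rootSet i (J.map τ) ↔ z ∈ C.rootSet i J := by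
  simp only [rootSet, Set.mem_ofPred_eq, h.gamma_map hJ hz, hz, h.map_mem z hz]

theorem isPlus_map (h : IsUpperEmbedding C C' τ) (hJ : ∀ j ∈ J, j ∈ C.carrier)
    (hz : z ∈ C.carrier) : C'.IsPlus i (J.map τ) (τ z) ↔ C.IsPlus i J z := by
  simp only [IsPlus, h.gamma_map hJ hz, hz, h.map_mem z hz, List.mem_map_of_injective h.injective]

theorem isMinus_map (h : IsUpperEmbedding C C' τ) (hJ : ∀ j ∈ J, j ∈ C.carrier)
    (hz : z ∈ C.carrier) : C'.IsMinus i (J.map τ) (τ z) ↔ C.IsMinus i J z := by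
  simp only [IsMinus, h.gamma_map hJ hz, hz, h.map_mem z hz, List.mem_map_of_injective h.injective]

/-- Before the first fold all roots are positive, so that no `-` lies outside the image. -/
theorem exists_eq_of_isMinus (h : IsUpperEmbedding C C' τ) (hJ : ∀ j ∈ J, j ∈ C.carrier)
    (hy : C'.IsMinus i (J.map τ) y) : ∃ x ∈ C.carrier, τ x = y := by
  by_contra! hne
  have h1 := hy.2.2
  rw [h.gamma_of_forall_ne hJ hy.1 hne] at h1
  have h2 := y.1.positive
  rw [h1] at h2
  exact (IsRealRoot.simple (D := D) i).ne_zero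
    (D.eq_zero_of_mem_of_neg_mem (D.simpleRoot_mem i) h2)

/-- Cancellation in the larger chain between letters of the image happens in the smaller chain: the
letters between them all lie in the image, which is an upper set. -/
theorem cancels_of_map (h : IsUpperEmbedding C C' τ) (hJ : ∀ j ∈ J, j ∈ C.carrier)
    {y' z' : D.Position} (hc : C'.Cancels i (J.map τ) y' z') (hy : y ∈ C.carrier)
    (hz : z ∈ C.carrier) (hy' : τ y = y') (hz' : τ z = z') : C.Cancels i J y z := by
  induction hc generalizing y z with
  | @intro a b m ha hb hab hr hrc hl hlc ihr ihl =>
    subst hy' hz'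
    have : Nonempty D.Position := ⟨y⟩
    have hσ := Function.leftInverse_invFun h.injective
    have hminus : ∀ w, C.IsMinus i J w → C.lt y w → C.lt w z →
        ∃ x ∈ C.carrier, τ x = m (τ w) := fun w hw h1 h2 => by
      have hc := hrc (τ w) ((h.isMinus_map hJ hw.1).2 hw) ((h.lt_iff y hy w hw.1).2 h1)
        ((h.lt_iff w hw.1 z hz).2 h2)
      refine h.exists_eq_of_lt hw.1 hc.isPlus.1 ?_
      cases hc; assumption
    have hplus : ∀ w, C.IsPlus i J w → C.lt y w → C.lt w z →
        ∃ x ∈ C.carrier, τ x = m (τ w) := fun w hw h1 h2 =>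
      h.exists_eq_of_isMinus hJ (hlc (τ w) ((h.isPlus_map hJ hw.1).2 hw)
        ((h.lt_iff y hy w hw.1).2 h1) ((h.lt_iff w hw.1 z hz).2 h2)).isMinus
    refine .intro (fun w => Function.invFun τ (m (τ w))) ((h.isMinus_map hJ hy).1 ha)
      ((h.isPlus_map hJ hz).1 hb) ((h.lt_iff y hy z hz).1 hab) (fun w hw h1 h2 => ?_)
      (fun w hw h1 h2 => ?_) (fun w hw h1 h2 => ?_) fun w hw h1 h2 => ?_
    · obtain ⟨x, hx, hxm⟩ := hminus w hw h1 h2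
      rw [← hxm, hσ x, ← h.lt_iff x hx z hz, hxm]
      exact hr (τ w) ((h.isMinus_map hJ hw.1).2 hw) ((h.lt_iff y hy w hw.1).2 h1)
        ((h.lt_iff w hw.1 z hz).2 h2)
    · obtain ⟨x, hx, hxm⟩ := hminus w hw h1 h2
      rw [← hxm, hσ x]
      exact ihr (τ w) ((h.isMinus_map hJ hw.1).2 hw) ((h.lt_iff y hy w hw.1).2 h1)
        ((h.lt_iff w hw.1 z hz).2 h2) hw.1 hx rfl hxm
    · obtain ⟨x, hx, hxm⟩ := hplus w hw h1 h2
      rw [← hxm, hσ x, ← h.lt_iff y hy x hx, hxm]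
      exact hl (τ w) ((h.isPlus_map hJ hw.1).2 hw) ((h.lt_iff y hy w hw.1).2 h1)
        ((h.lt_iff w hw.1 z hz).2 h2)
    · obtain ⟨x, hx, hxm⟩ := hplus w hw h1 h2
      rw [← hxm, hσ x]
      exact ihl (τ w) ((h.isPlus_map hJ hw.1).2 hw) ((h.lt_iff y hy w hw.1).2 h1)
        ((h.lt_iff w hw.1 z hz).2 h2) hx hw.1 hxm rfl

theorem map_cancels (h : IsUpperEmbedding C C' τ) (hJ : ∀ j ∈ J, j ∈ C.carrier)
    (hc : C.Cancels i J y z) : C'.Cancels i (J.map τ) (τ y) (τ z) := by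
  induction hc with
  | @intro y z m hy hz hyz hr hrc hl hlc ihr ihl =>
    have : Nonempty D.Position := ⟨y⟩
    have hσ := Function.leftInverse_invFun h.injective
    -- every letter between `τ y` and `τ z` lies in the image
    have key : ∀ w, w ∈ C'.carrier → C'.lt (τ y) w → C'.lt w (τ z) →
        ∃ x ∈ C.carrier, τ x = w ∧ C.lt y x ∧ C.lt x z := fun w hw h1 h2 => by
      obtain ⟨x, hx, rfl⟩ := h.exists_eq_of_lt hy.1 hw h1
      exact ⟨x, hx, rfl, (h.lt_iff y hy.1 x hx).1 h1, (h.lt_iff x hx z hz.1).1 h2⟩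
    refine .intro (fun w => τ (m (Function.invFun τ w))) ((h.isMinus_map hJ hy.1).2 hy)
      ((h.isPlus_map hJ hz.1).2 hz) ((h.lt_iff y hy.1 z hz.1).2 hyz) (fun w hw h1 h2 => ?_)
      (fun w hw h1 h2 => ?_) (fun w hw h1 h2 => ?_) fun w hw h1 h2 => ?_
    all_goals
      obtain ⟨x, hx, rfl, h3, h4⟩ := key w hw.1 h1 h2
      rw [hσ x]
    · have hw' := (h.isMinus_map hJ hx).1 hw
      exact (h.lt_iff _ (hrc x hw' h3 h4).isPlus.1 z hz.1).2 (hr x hw' h3 h4)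
    · exact ihr x ((h.isMinus_map hJ hx).1 hw) h3 h4
    · have hw' := (h.isPlus_map hJ hx).1 hw
      exact (h.lt_iff y hy.1 _ (hlc x hw' h3 h4).isMinus.1).2 (hl x hw' h3 h4)
    · exact ihl x ((h.isPlus_map hJ hx).1 hw) h3 h4

theorem isReducedPlus_map (h : IsUpperEmbedding C C' τ) (hJ : ∀ j ∈ J, j ∈ C.carrier)
    (hz : z ∈ C.carrier) : C'.IsReducedPlus i (J.map τ) (τ z) ↔ C.IsReducedPlus i J z := by
  rw [IsReducedPlus, IsReducedPlus, h.isPlus_map hJ hz]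
  refine and_congr_right fun _ => ⟨fun hn y hc => hn _ (h.map_cancels hJ hc), fun hn y hc => ?_⟩
  obtain ⟨x, hx, rfl⟩ := h.exists_eq_of_isMinus hJ hc.isMinus
  exact hn x (h.cancels_of_map hJ hc hx hz rfl rfl)

theorem isReducedMinus_map (h : IsUpperEmbedding C C' τ) (hJ : ∀ j ∈ J, j ∈ C.carrier)
    (hz : z ∈ C.carrier) : C'.IsReducedMinus i (J.map τ) (τ z) ↔ C.IsReducedMinus i J z := by
  rw [IsReducedMinus, IsReducedMinus, h.isMinus_map hJ hz]
  refine and_congr_right fun _ => ⟨fun hn y hc => hn _ (h.map_cancels hJ hc), fun hn y hc => ?_⟩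
  obtain ⟨x, hx, rfl⟩ := h.exists_eq_of_lt hz hc.isPlus.1 (by cases hc; assumption)
  exact hn x (h.cancels_of_map hJ hc hz hx rfl rfl)

theorem isRightmostPlus_map (h : IsUpperEmbedding C C' τ) (hJ : ∀ j ∈ J, j ∈ C.carrier)
    (hz : C.IsRightmostPlus i J z) : C'.IsRightmostPlus i (J.map τ) (τ z) := by
  have hzC := hz.1.1.1
  refine ⟨(h.isReducedPlus_map hJ hzC).2 hz.1, fun y hy => ?_⟩
  by_cases hex : ∃ x ∈ C.carrier, τ x = y
  · obtain ⟨x, hx, rfl⟩ := hex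
    exact (hz.2 x ((h.isReducedPlus_map hJ hx).1 hy)).imp (congrArg τ) (h.lt_iff x hx z hzC).2
  · push Not at hex
    exact Or.inr (h.lt_of_forall_ne z hzC y hy.1.1 hex)

theorem isLeftmostMinus_map (h : IsUpperEmbedding C C' τ) (hJ : ∀ j ∈ J, j ∈ C.carrier)
    (hz : z ∈ C.carrier) : C'.IsLeftmostMinus i (J.map τ) (τ z) ↔ C.IsLeftmostMinus i J z := by
  rw [IsLeftmostMinus, IsLeftmostMinus, h.isReducedMinus_map hJ hz]
  refine and_congr_right fun _ => ⟨fun hall x hx => ?_, fun hall y hy => ?_⟩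
  · exact (hall (τ x) ((h.isReducedMinus_map hJ hx.1.1).2 hx)).imp (fun e => h.injective e)
      (h.lt_iff z hz x hx.1.1).1
  · obtain ⟨x, hx, rfl⟩ := h.exists_eq_of_isMinus hJ hy.1
    exact (hall x ((h.isReducedMinus_map hJ hx).1 hy)).imp (congrArg τ) (h.lt_iff z hz x hx).2

open Classical in
theorem orderedInsert_map (h : IsUpperEmbedding C C' τ) (hJ : ∀ j ∈ J, j ∈ C.carrier)
    (hz : z ∈ C.carrier) :
    (J.map τ).orderedInsert C'.lt (τ z) = (J.orderedInsert C.lt z).map τ :=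
  (List.map_orderedInsert C.lt C'.lt τ J z (fun y hy => (h.lt_iff y (hJ y hy) z hz).symm)
    fun y hy => (h.lt_iff z hz y (hJ y hy)).symm).symm

theorem mem_carrier_of_fList (hJ : ∀ j ∈ J, j ∈ C.carrier) {K : List D.Position}
    (hK : C.fList i J = some K) : ∀ j ∈ K, j ∈ C.carrier := by
  classical
  unfold fList at hK
  split_ifs at hK with ha
  have hmem := ha.choose_spec.1.1.1
  split at hK
  all_goals
    obtain rfl := Option.some.inj hK
    intro j hj
    rcases (List.mem_orderedInsert _).1 hj with rfl | hj
    · exact hmem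
  · exact hJ j hj
  · exact hJ j (List.mem_of_mem_erase hj)

theorem mem_carrier_of_eList (hJ : ∀ j ∈ J, j ∈ C.carrier) {K : List D.Position}
    (hK : C.eList i J = some K) : ∀ j ∈ K, j ∈ C.carrier := by
  classical
  unfold eList at hK
  split_ifs at hK with ha
  · have hmem := ha.choose_spec.1.1.1
    split at hK
    all_goals
      obtain rfl := Option.some.inj hK
      intro j hj
      rcases (List.mem_orderedInsert _).1 hj with rfl | hj
      · exact hmem
    · exact hJ j hj
    · exact hJ j (List.mem_of_mem_erase hj)
  · split at hK
    · cases hK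
    · obtain rfl := Option.some.inj hK
      exact fun j hj => hJ j (List.mem_of_mem_erase hj)

theorem fList_map (h : IsUpperEmbedding C C' τ) (hJ : ∀ j ∈ J, j ∈ C.carrier)
    {K : List D.Position} (hK : C.fList i J = some K) :
    C'.fList i (J.map τ) = some (K.map τ) := by
  classical
  unfold fList at hK
  split_ifs at hK with ha
  have hτ := h.isRightmostPlus_map hJ ha.choose_spec
  have hex : ∃ a, C'.IsRightmostPlus i (J.map τ) a := ⟨_, hτ⟩
  have hmem := ha.choose_spec.1.1.1
  unfold fList
  rw [dif_pos hex, hex.choose_spec.unique h.isStrictLinear'.asymm hτ]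
  have hfilter : (J.map τ).filter (fun j => j ∈ C'.rootSet i (J.map τ) ∧ C'.lt (τ ha.choose) j) =
      (J.filter fun j => j ∈ C.rootSet i J ∧ C.lt ha.choose j).map τ := by
    rw [List.filter_map]
    congr 1
    refine List.filter_congr fun j hj => decide_eq_decide.2 (and_congr ?_ ?_)
    · exact h.mem_rootSet_map hJ (hJ j hj)
    · exact h.lt_iff _ hmem j (hJ j hj)
  rw [hfilter, List.head?_map]
  split at hK
  · next hm =>
    rw [hm]
    obtain rfl := Option.some.inj hK
    exact congrArg some (h.orderedInsert_map hJ hmem)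
  · next m hm =>
    rw [hm]
    obtain rfl := Option.some.inj hK
    have := h.orderedInsert_map (J := J.erase m) (fun j hj => hJ j (List.mem_of_mem_erase hj)) hmem
    rw [List.map_erase h.injective] at this
    exact congrArg some this

theorem eList_map (h : IsUpperEmbedding C C' τ) (hJ : ∀ j ∈ J, j ∈ C.carrier) :
    C'.eList i (J.map τ) = (C.eList i J).map (List.map τ) := by
  classical
  unfold eList
  by_cases ha : ∃ a, C.IsLeftmostMinus i J a
  · have hmem := ha.choose_spec.1.1.1
    have hτ := (h.isLeftmostMinus_map hJ hmem).2 ha.choose_spec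
    have hex : ∃ a, C'.IsLeftmostMinus i (J.map τ) a := ⟨_, hτ⟩
    rw [dif_pos hex, dif_pos ha, hex.choose_spec.unique h.isStrictLinear'.asymm hτ]
    have hfilter : (J.map τ).filter
        (fun j => j ∈ C'.rootSet i (J.map τ) ∧ C'.lt j (τ ha.choose)) =
        (J.filter fun j => j ∈ C.rootSet i J ∧ C.lt j ha.choose).map τ := by
      rw [List.filter_map]
      congr 1
      refine List.filter_congr fun j hj => decide_eq_decide.2 (and_congr ?_ ?_)
      · exact h.mem_rootSet_map hJ (hJ j hj)
      · exact h.lt_iff j (hJ j hj) _ hmem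
    rw [hfilter, List.getLast?_map]
    cases (J.filter fun j => j ∈ C.rootSet i J ∧ C.lt j ha.choose).getLast? with
    | none => exact congrArg some (h.orderedInsert_map hJ hmem)
    | some m =>
      have := h.orderedInsert_map (J := J.erase m) (fun j hj => hJ j (List.mem_of_mem_erase hj))
        hmem
      rw [List.map_erase h.injective] at this
      exact congrArg some this
  · have hex : ¬ ∃ a, C'.IsLeftmostMinus i (J.map τ) a := by
      rintro ⟨a, ha'⟩
      obtain ⟨x, hx, rfl⟩ := h.exists_eq_of_isMinus hJ ha'.1.1
      exact ha ⟨x, (h.isLeftmostMinus_map hJ hx).1 ha'⟩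
    rw [dif_neg hex, dif_neg ha, h.reflectionProd_map]
    split_ifs
    · have hfilter : (J.map τ).filter (fun j => j ∈ C'.rootSet i (J.map τ)) =
          (J.filter fun j => j ∈ C.rootSet i J).map τ := by
        rw [List.filter_map]
        congr 1
        exact List.filter_congr fun j hj => decide_eq_decide.2 (h.mem_rootSet_map hJ (hJ j hj))
      rw [hfilter, List.getLast?_map]
      cases (J.filter fun j => j ∈ C.rootSet i J).getLast? with
      | none => rfl
      | some m => exact congrArg some (List.map_erase h.injective _).symm
    · rfl

/-- The inclusion of the admissible sequences of an upper set of a chain. -/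
def mapAl (h : IsUpperEmbedding C C' τ) (J : C.Al) : C'.Al :=
  ⟨J.1.map τ, (h.admissible_map J.2.1).2 J.2⟩

theorem mapAl_injective (h : IsUpperEmbedding C C' τ) : Function.Injective h.mapAl :=
  fun _ _ e => Subtype.ext (List.map_injective_iff.2 h.injective (congrArg Subtype.val e))

theorem toAl_map (h : IsUpperEmbedding C C' τ) (hJ : ∀ j ∈ J, j ∈ C.carrier) :
    C'.toAl (J.map τ) = (C.toAl J).map h.mapAl := by
  unfold toAl
  by_cases hA : C.Admissible J
  · rw [dif_pos hA, dif_pos ((h.admissible_map hJ).2 hA)]; rfl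
  · rw [dif_neg hA, dif_neg (mt (h.admissible_map hJ).1 hA)]; rfl

theorem e_mapAl (h : IsUpperEmbedding C C' τ) (i : I) (J : C.Al) :
    C'.e i (h.mapAl J) = (C.e i J).map h.mapAl := by
  have h1 := h.eList_map (i := i) J.2.1
  have h2 : ∀ K, C.eList i J.1 = some K → ∀ j ∈ K, j ∈ C.carrier :=
    fun K => mem_carrier_of_eList J.2.1
  unfold e
  rw [show (h.mapAl J).1 = J.1.map τ from rfl, h1]
  cases hK : C.eList i J.1 with
  | none => rfl
  | some K => exact h.toAl_map (h2 K hK)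

/-- The operator `f_i` commutes with the inclusion only where it is nonzero on the smaller chain:
the larger chain has further letters `+` to the left. -/
theorem f_mapAl (h : IsUpperEmbedding C C' τ) {i : I} {J K : C.Al} (hf : C.f i J = some K) :
    C'.f i (h.mapAl J) = some (h.mapAl K) := by
  unfold f at *
  obtain ⟨L, hL, hK⟩ := Option.bind_eq_some_iff.1 hf
  rw [show (h.mapAl J).1 = J.1.map τ from rfl, h.fList_map J.2.1 hL, Option.bind_some,
    h.toAl_map (mem_carrier_of_fList J.2.1 hL), hK]
  rfl

theorem stringLength_e_mapAl (h : IsUpperEmbedding C C' τ) (i : I) (J : C.Al) :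
    CrystalData.stringLength (C'.e i) (h.mapAl J) = CrystalData.stringLength (C.e i) J := by
  have key : ∀ n (b : Option C.Al), (fun c : Option C'.Al => c.bind (C'.e i))^[n] (b.map h.mapAl) =
      ((fun c : Option C.Al => c.bind (C.e i))^[n] b).map h.mapAl := fun n => by
    induction n with
    | zero => exact fun b => rfl
    | succ n ih =>
      intro b
      rw [Function.iterate_succ_apply, Function.iterate_succ_apply, ← ih]
      congr 1
      cases b with
      | none => rfl
      | some J => exact h.e_mapAl i J
  unfold CrystalData.stringLength
  congr 1
  ext n
  have := key n (some J)
  rw [Option.map_some] at this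
  simp only [Set.mem_ofPred_eq, this, ne_eq, Option.map_eq_none_iff]

end IsUpperEmbedding

end UpperEmbedding

end RootChain

end KacMoodyDatum

namespace KacMoodyDatum

open LexTime

section InfinityChain

variable {I P Pv : Type*} [Fintype I] [LinearOrder I] [AddCommGroup P] [AddCommGroup Pv]
variable {D : KacMoodyDatum I P Pv}

/-! ### The chains of multiples of `ρ` inside the infinity chain -/

theorem mem_infinityChain {Γ : D.RootChain} {z : D.Position} :
    z ∈ (D.infinityChain Γ).carrier ↔ z.2 < 0 := Iff.rfl

theorem main_lexTime_emod (z : D.Position) :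
    0 ≤ main (D.lexTime D.rho (z.1, z.2 % D.height z.1)) ∧
      main (D.lexTime D.rho (z.1, z.2 % D.height z.1)) < 1 := by
  have h := z.1.height_pos
  have h1 := Int.emod_nonneg z.2 h.ne'
  have h2 := Int.emod_lt_of_pos z.2 h
  rw [main_lexTime]
  have hq : (0 : ℚ) < D.pairing D.rho z.1.coroot := by exact_mod_cast h
  refine ⟨div_nonneg (by exact_mod_cast h1) hq.le, (div_lt_one hq).2 (by exact_mod_cast h2)⟩

theorem lexTime_rho_eq (z : D.Position) : D.lexTime D.rho z =
    ofInt (z.2 / D.height z.1) + D.lexTime D.rho (z.1, z.2 % D.height z.1) := by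
  have h : (D.pairing D.rho z.1.coroot : ℚ) ≠ 0 := by exact_mod_cast z.1.height_pos.ne'
  refine LexTime.ext ?_ fun i => ?_
  · rw [map_add, main_ofInt, main_lexTime, main_lexTime]
    field_simp
    have := Int.emod_add_mul_ediv z.2 (D.height z.1)
    rw [← Int.cast_mul, ← Int.cast_add, Int.cast_inj]
    change z.2 = D.height z.1 * (z.2 / D.height z.1) + z.2 % D.height z.1
    linarith
  · rw [map_add, coord_ofInt, zero_add, coord_lexTime, coord_lexTime]

/-- The infinity chain is the set of all negative levels, in the order of the lex `ρ`-chain. -/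
theorem infinityChain_lt {y z : D.Position} :
    (D.infinityChain (D.lexChain D.rho)).lt y z ↔ D.lexTime D.rho y < D.lexTime D.rho z := by
  rw [lexTime_rho_eq y, lexTime_rho_eq z, LexTime.ofInt_add_lt_iff (main_lexTime_emod y).1
    (main_lexTime_emod y).2 (main_lexTime_emod z).1 (main_lexTime_emod z).2]
  rfl

theorem infinityChain_isStrictLinear :
    (D.infinityChain (D.lexChain D.rho)).IsStrictLinear where
  asymm _ _ h h' := lt_asymm (infinityChain_lt.1 h) (infinityChain_lt.1 h')
  trans _ _ _ h h' := infinityChain_lt.2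
    (lt_trans (infinityChain_lt.1 h) (infinityChain_lt.1 h'))
  trichotomy y _ z _ := by
    rw [infinityChain_lt, infinityChain_lt]
    rcases lt_trichotomy (D.lexTime D.rho y) (D.lexTime D.rho z) with h | h | h
    · exact Or.inl h
    · exact Or.inr (Or.inl (eq_of_lexTime_eq y.1.height_pos z.1.height_pos h))
    · exact Or.inr (Or.inr h)

variable (D) in
/-- The map `(β, ℓ) ↦ (β, ℓ + n ⟨ρ, β^∨⟩)`. -/
def levelShift (n : ℤ) (z : D.Position) : D.Position := (z.1, z.2 + n * D.height z.1)

theorem shiftLevels_eq (n : ℤ) (J : List D.Position) :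
    D.shiftLevels n J = J.map (D.levelShift n) := rfl

theorem levelShift_levelShift (m n : ℤ) (z : D.Position) :
    D.levelShift m (D.levelShift n z) = D.levelShift (m + n) z :=
  Prod.ext rfl (by simp only [levelShift]; ring)

theorem levelShift_zero (z : D.Position) : D.levelShift 0 z = z :=
  Prod.ext rfl (by simp [levelShift])

theorem shiftLevels_neg_shiftLevels (n : ℤ) (J : List D.Position) :
    D.shiftLevels (-n) (D.shiftLevels n J) = J := by
  simp [shiftLevels_eq, Function.comp_def, levelShift_levelShift, levelShift_zero]

theorem pairing_nsmul_rho (k : ℕ) (β : D.PosRoot) :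
    D.pairing (k • D.rho) β.coroot = k * D.height β := by
  rw [map_nsmul, LinearMap.smul_apply, nsmul_eq_mul]; rfl

theorem nsmul_lexTime {k : ℕ} (hk : k ≠ 0) (z : D.Position) :
    k • D.lexTime (k • D.rho) z = D.lexTime D.rho z := by
  have h : (D.pairing D.rho z.1.coroot : ℚ) ≠ 0 := by exact_mod_cast z.1.height_pos.ne'
  have hk' : (k : ℚ) ≠ 0 := Nat.cast_ne_zero.2 hk
  have e : (D.pairing (k • D.rho) z.1.coroot : ℚ) = k * D.pairing D.rho z.1.coroot := by
    rw [pairing_nsmul_rho]; push_cast; rfl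
  refine LexTime.ext ?_ fun i => ?_
  · rw [map_nsmul, main_lexTime, main_lexTime, e, nsmul_eq_mul]
    field_simp
  · rw [map_nsmul, coord_lexTime, coord_lexTime, e, nsmul_eq_mul]
    field_simp

theorem lexTime_levelShift (n : ℤ) (z : D.Position) :
    D.lexTime D.rho (D.levelShift n z) = D.lexTime D.rho z + ofInt n := by
  have h : (D.pairing D.rho z.1.coroot : ℚ) ≠ 0 := by exact_mod_cast z.1.height_pos.ne'
  refine LexTime.ext ?_ fun i => ?_
  · rw [map_add, main_ofInt, main_lexTime, main_lexTime, levelShift, height]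
    push_cast
    field_simp
  · rw [map_add, coord_ofInt, add_zero, coord_lexTime, coord_lexTime, levelShift]

theorem mem_lexChain_nsmul_rho {k : ℕ} {z : D.Position} :
    z ∈ (D.lexChain (k • D.rho)).carrier ↔ 0 ≤ z.2 ∧ z.2 < k * D.height z.1 := by
  rw [mem_lexChain, pairing_nsmul_rho]

/-- The lex `kρ`-chain, shifted down by `kρ`, consists of the last `k` blocks of the infinity
chain. -/
theorem isUpperEmbedding_levelShift (k : ℕ) :
    RootChain.IsUpperEmbedding (D.lexChain (k • D.rho)) (D.infinityChain (D.lexChain D.rho))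
      (D.levelShift (-k)) where
  isStrictLinear' := infinityChain_isStrictLinear
  fst_eq _ := rfl
  injective := Function.LeftInverse.injective (g := D.levelShift k) fun z => by
    rw [levelShift_levelShift, add_neg_cancel, levelShift_zero]
  map_mem z hz := by
    rw [mem_lexChain_nsmul_rho] at hz
    rw [mem_infinityChain, levelShift]
    dsimp only
    linarith
  lt_iff y _ z hz := by
    rw [mem_lexChain_nsmul_rho] at hz
    have hk : k ≠ 0 := by
      rintro rfl
      simp only [CharP.cast_eq_zero, zero_mul] at hz
      omega
    rw [infinityChain_lt, lexTime_levelShift, lexTime_levelShift, add_lt_add_iff_right,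
      lexChain_lt, ← nsmul_lexTime hk, ← nsmul_lexTime hk, ← natCast_zsmul (D.lexTime _ y),
      ← natCast_zsmul (D.lexTime _ z), zsmul_lt_zsmul_iff_right (by omega)]
  lt_of_forall_ne z hz y hy hne := by
    rw [mem_lexChain_nsmul_rho] at hz
    rw [mem_infinityChain] at hy
    have hz' := z.1.height_pos
    have hy' := y.1.height_pos
    have h1 : y.2 + k * D.height y.1 < 0 := by
      by_contra! h
      refine hne (D.levelShift k y) (mem_lexChain_nsmul_rho.2 ⟨h, ?_⟩) ?_
      · change y.2 + k * D.height y.1 < k * D.height y.1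
        linarith
      · rw [levelShift_levelShift, neg_add_cancel, levelShift_zero]
    refine Or.inl ((?_ : _ < -(k : ℤ)).trans_le ?_)
    · rw [Int.ediv_lt_iff_lt_mul hy']; linarith
    · rw [Int.le_ediv_iff_mul_le (by exact hz')]
      change -(k : ℤ) * D.height z.1 ≤ z.2 + -k * D.height z.1
      linarith

variable (D) in
/-- The inclusion of `Al(kρ)` into `Al(∞)`. -/
noncomputable def inclusion (k : ℕ) : D.AlSet (k • D.rho) → D.AlInfSet :=
  (isUpperEmbedding_levelShift k).mapAl

theorem foldr_affineReflection_shiftLevels (k : ℕ) (J : List D.Position) (y : P) :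
    (D.shiftLevels (-k) J).foldr D.affineReflection (y + k • D.rho) =
      J.foldr D.affineReflection y + k • D.rho := by
  induction J with
  | nil => rfl
  | cons j J ih =>
    rw [shiftLevels_eq, List.map_cons, List.foldr_cons, ← shiftLevels_eq, ih, List.foldr_cons,
      affineReflection, affineReflection, map_add, LinearMap.add_apply]
    dsimp only [levelShift]
    rw [pairing_nsmul_rho]
    module

theorem wt_inclusion (k : ℕ) (J : D.AlSet (k • D.rho)) :
    (D.infinityChain (D.lexChain D.rho)).wt 0 (D.inclusion k J) =
      -(k • D.rho) + (D.lexChain (k • D.rho)).wt (k • D.rho) J := by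
  change -(D.shiftLevels (-k) J.1).foldr D.affineReflection (-0) =
    -(k • D.rho) + -J.1.foldr D.affineReflection (-(k • D.rho))
  have := foldr_affineReflection_shiftLevels k J.1 (-(k • D.rho))
  rw [neg_add_cancel] at this
  rw [neg_zero, this]
  abel

/-- `Al(∞)` is the union of the crystals `Al(kρ)`. -/
theorem exists_forall_inclusion_eq (J : D.AlInfSet) :
    ∃ K : ℕ, ∀ k ≥ K, ∃ J₀, D.inclusion k J₀ = J := by
  obtain ⟨J, hJ⟩ := J
  have hbound : ∃ K : ℕ, ∀ j ∈ J, -(K : ℤ) ≤ j.2 := by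
    clear hJ
    induction J with
    | nil => exact ⟨0, by simp⟩
    | cons j J ih =>
      obtain ⟨K, hK⟩ := ih
      refine ⟨K + j.2.natAbs, fun l hl => ?_⟩
      rcases List.mem_cons.1 hl with rfl | hl
      · omega
      · have := hK l hl; omega
  obtain ⟨K, hK⟩ := hbound
  refine ⟨K, fun k hk => ?_⟩
  have hmem : ∀ j ∈ D.shiftLevels k J, j ∈ (D.lexChain (k • D.rho)).carrier := fun j hj => by
    obtain ⟨l, hl, rfl⟩ := List.mem_map.1 hj
    have h1 := mem_infinityChain.1 (hJ.1 l hl)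
    have h2 := hK l hl
    have h3 := l.1.height_pos
    rw [mem_lexChain_nsmul_rho]
    dsimp only
    constructor
    · nlinarith
    · linarith
  refine ⟨⟨D.shiftLevels k J, ((isUpperEmbedding_levelShift k).admissible_map hmem).1 ?_⟩,
    Subtype.ext ?_⟩
  · rwa [← shiftLevels_eq, shiftLevels_neg_shiftLevels]
  · exact shiftLevels_neg_shiftLevels k J

theorem pairing_rho_simpleCoroot (i : I) : D.pairing D.rho (D.simpleCoroot i) = 1 := by
  rw [rho, map_sum, LinearMap.sum_apply]
  simp [D.pairing_fundamentalWeight]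

theorem pairing_nsmul_rho_simpleCoroot (k : ℕ) (i : I) :
    D.pairing (k • D.rho) (D.simpleCoroot i) = k := by
  rw [map_nsmul, LinearMap.smul_apply, pairing_rho_simpleCoroot, nsmul_eq_mul, mul_one]

variable (D) in
theorem isCrystal_al_nsmul_rho (k : ℕ) : (D.al (k • D.rho)).IsCrystal D :=
  isCrystal_al fun i => by rw [pairing_nsmul_rho_simpleCoroot]; positivity

end InfinityChain

end KacMoodyDatum

namespace KacMoodyDatum

section Morphisms

variable {I P Pv : Type*} [Fintype I] [LinearOrder I] [AddCommGroup P] [AddCommGroup Pv]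
variable {D : KacMoodyDatum I P Pv}

/-! ### The crystal structure of `Al(∞)` -/

theorem inclusion_injective (k : ℕ) : Function.Injective (D.inclusion k) :=
  (isUpperEmbedding_levelShift k).mapAl_injective

theorem alInf_e_inclusion (k : ℕ) (i : I) (J : D.AlSet (k • D.rho)) :
    D.alInf.e i (D.inclusion k J) = ((D.al (k • D.rho)).e i J).map (D.inclusion k) :=
  (isUpperEmbedding_levelShift k).e_mapAl i J

theorem alInf_f_inclusion {k : ℕ} {i : I} {J J' : D.AlSet (k • D.rho)}
    (h : (D.al (k • D.rho)).f i J = some J') :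
    D.alInf.f i (D.inclusion k J) = some (D.inclusion k J') :=
  (isUpperEmbedding_levelShift k).f_mapAl h

theorem alInf_wt_inclusion (k : ℕ) (J : D.AlSet (k • D.rho)) :
    D.alInf.wt (D.inclusion k J) = -(k • D.rho) + (D.al (k • D.rho)).wt J :=
  wt_inclusion k J

theorem alInf_eps_inclusion (k : ℕ) (i : I) (J : D.AlSet (k • D.rho)) :
    D.alInf.eps i (D.inclusion k J) = (D.al (k • D.rho)).eps i J := by
  change ((CrystalData.stringLength _ _ : ℤ) : WithBot ℤ) = ((CrystalData.stringLength _ _ : ℤ) : _)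
  rw [← (isUpperEmbedding_levelShift k).stringLength_e_mapAl i J]
  rfl

theorem alInf_phi_eq (i : I) (J : D.AlInfSet) : D.alInf.phi i J =
    D.alInf.eps i J + (D.pairing (D.alInf.wt J) (D.simpleCoroot i) : WithBot ℤ) := rfl

/-- For large `k` the string of `f_i` at `J` in `Al(kρ)` does not stop at `J`, since its length
grows with `k`. -/
theorem exists_inclusion_f_eq (i : I) (J : D.AlInfSet) :
    ∃ (k : ℕ) (J₀ J₁ : D.AlSet (k • D.rho)), D.inclusion k J₀ = J ∧
      (D.al (k • D.rho)).f i J₀ = some J₁ := by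
  obtain ⟨K, hK⟩ := exists_forall_inclusion_eq J
  obtain ⟨k, hk, hk'⟩ : ∃ k : ℕ, K ≤ k ∧ 0 < D.pairing (D.alInf.wt J) (D.simpleCoroot i) + k :=
    ⟨K + (D.pairing (D.alInf.wt J) (D.simpleCoroot i)).natAbs + 1, by omega, by omega⟩
  obtain ⟨J₀, rfl⟩ := hK k hk
  cases hf : (D.al (k • D.rho)).f i J₀ with
  | some J₁ => exact ⟨k, J₀, J₁, rfl, hf⟩
  | none =>
    exfalso
    have h1 := (D.isCrystal_al_nsmul_rho k).phi_eq i J₀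
    change ((CrystalData.stringLength ((D.al (k • D.rho)).f i) J₀ : ℤ) : WithBot ℤ) =
      ((CrystalData.stringLength ((D.al (k • D.rho)).e i) J₀ : ℤ) : WithBot ℤ) + _ at h1
    rw [(CrystalData.HasString.of_none hf).stringLength_eq, ← WithBot.coe_add,
      WithBot.coe_inj] at h1
    rw [alInf_wt_inclusion, map_add, LinearMap.add_apply, map_neg, LinearMap.neg_apply,
      pairing_nsmul_rho_simpleCoroot] at hk'
    push_cast at h1
    omega

theorem exists_inclusion_of_f_eq {i : I} {J J' : D.AlInfSet} (h : D.alInf.f i J = some J') :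
    ∃ (k : ℕ) (J₀ J₁ : D.AlSet (k • D.rho)), D.inclusion k J₀ = J ∧ D.inclusion k J₁ = J' ∧
      (D.al (k • D.rho)).f i J₀ = some J₁ := by
  obtain ⟨k, J₀, J₁, rfl, h1⟩ := exists_inclusion_f_eq i J
  exact ⟨k, J₀, J₁, rfl, Option.some.inj ((alInf_f_inclusion h1).symm.trans h), h1⟩

theorem exists_inclusion_of_e_eq {i : I} {J J' : D.AlInfSet} (h : D.alInf.e i J = some J') :
    ∃ (k : ℕ) (J₀ J₁ : D.AlSet (k • D.rho)), D.inclusion k J₀ = J ∧ D.inclusion k J₁ = J' ∧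
      (D.al (k • D.rho)).e i J₀ = some J₁ := by
  obtain ⟨K, hK⟩ := exists_forall_inclusion_eq J
  obtain ⟨J₀, rfl⟩ := hK K le_rfl
  rw [alInf_e_inclusion] at h
  obtain ⟨J₁, h1, h2⟩ := Option.map_eq_some_iff.1 h
  exact ⟨K, J₀, J₁, rfl, h2, h1⟩

variable (D) in
theorem isCrystal_alInf : D.alInf.IsCrystal D := by
  have heps_e : ∀ i b b', D.alInf.e i b = some b' →
      D.alInf.eps i b' = D.alInf.eps i b + ((-1 : ℤ) : WithBot ℤ) := fun i b b' h => by
    obtain ⟨k, J₀, J₁, rfl, rfl, h0⟩ := exists_inclusion_of_e_eq h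
    rw [alInf_eps_inclusion, alInf_eps_inclusion]
    exact (D.isCrystal_al_nsmul_rho k).eps_e i _ _ h0
  have hwt_e : ∀ i b b', D.alInf.e i b = some b' →
      D.alInf.wt b' = D.alInf.wt b + D.simpleRoot i := fun i b b' h => by
    obtain ⟨k, J₀, J₁, rfl, rfl, h0⟩ := exists_inclusion_of_e_eq h
    rw [alInf_wt_inclusion, alInf_wt_inclusion, (D.isCrystal_al_nsmul_rho k).wt_e i _ _ h0,
      add_assoc]
  have hfe : ∀ i b b', D.alInf.f i b = some b' ↔ D.alInf.e i b' = some b := fun i b b' => by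
    constructor
    · intro h
      obtain ⟨k, J₀, J₁, rfl, rfl, h0⟩ := exists_inclusion_of_f_eq h
      rw [alInf_e_inclusion, ((D.isCrystal_al_nsmul_rho k).f_iff_e i _ _).1 h0, Option.map_some]
    · intro h
      obtain ⟨k, J₀, J₁, rfl, rfl, h0⟩ := exists_inclusion_of_e_eq h
      exact alInf_f_inclusion (((D.isCrystal_al_nsmul_rho k).f_iff_e i _ _).2 h0)
  have hphi_e : ∀ i b b', D.alInf.e i b = some b' →
      D.alInf.phi i b' = D.alInf.phi i b + ((1 : ℤ) : WithBot ℤ) := fun i b b' h => by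
    rw [alInf_phi_eq, alInf_phi_eq, heps_e i b b' h, hwt_e i b b' h, map_add, LinearMap.add_apply,
      D.pairing_simple, D.cartan_diag, add_assoc, add_assoc, ← WithBot.coe_add, ← WithBot.coe_add]
    congr 2
    ring
  refine ⟨⟨⟨[], by simp, List.Pairwise.nil, trivial⟩⟩, alInf_phi_eq, heps_e, hphi_e, hwt_e,
    fun i b b' h => ?_, fun i b b' h => ?_, fun i b b' h => ?_, hfe,
    fun i b h => absurd h WithBot.coe_ne_bot⟩
  · rw [heps_e i b' b ((hfe i b b').1 h), add_assoc, ← WithBot.coe_add]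
    exact (add_zero _).symm
  · rw [hphi_e i b' b ((hfe i b b').1 h), add_assoc, ← WithBot.coe_add]
    exact (add_zero _).symm
  · rw [hwt_e i b' b ((hfe i b b').1 h), add_sub_cancel_right]

/-! ### The crystal `T_{-kρ} ⊗ Al(kρ)` -/

theorem shiftedAl_e (k : ℕ) (i : I) (b : Unit × D.AlSet (k • D.rho)) :
    (D.shiftedAl k).e i b = ((D.al (k • D.rho)).e i b.2).map fun c => ((), c) := by
  dsimp only [shiftedAl, CrystalData.tensor]
  rw [if_neg (show ¬ _ < (CrystalData.T I _).eps i b.1 from not_lt_bot (α := WithBot ℤ))]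

theorem shiftedAl_f (k : ℕ) (i : I) (b : Unit × D.AlSet (k • D.rho)) :
    (D.shiftedAl k).f i b = ((D.al (k • D.rho)).f i b.2).map fun c => ((), c) := by
  dsimp only [shiftedAl, CrystalData.tensor]
  rw [if_neg (show ¬ (D.al (k • D.rho)).phi i b.2 ≤ (CrystalData.T I _).eps i b.1 from
    fun h => WithBot.coe_ne_bot (le_bot_iff.1 h))]

theorem shiftedAl_eps (k : ℕ) (i : I) (b : Unit × D.AlSet (k • D.rho)) :
    (D.shiftedAl k).eps i b = (D.al (k • D.rho)).eps i b.2 := by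
  change max _ ((⊥ : WithBot ℤ) + _) = _
  rw [WithBot.bot_add, max_bot_right]

theorem shiftedAl_wt (k : ℕ) (b : Unit × D.AlSet (k • D.rho)) :
    (D.shiftedAl k).wt b = -(k • D.rho) + (D.al (k • D.rho)).wt b.2 := rfl

theorem shiftedAl_phi (k : ℕ) (i : I) (b : Unit × D.AlSet (k • D.rho)) :
    (D.shiftedAl k).phi i b = (D.al (k • D.rho)).phi i b.2 + ((-k : ℤ) : WithBot ℤ) := by
  change max (⊥ : WithBot ℤ) (_ + ((D.pairing (-(k • D.rho)) (D.simpleCoroot i) : ℤ) : _)) = _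
  rw [max_bot_left, map_neg, LinearMap.neg_apply, pairing_nsmul_rho_simpleCoroot]

variable (D) in
theorem isCrystal_shiftedAl (k : ℕ) : (D.shiftedAl k).IsCrystal D := by
  have h := D.isCrystal_al_nsmul_rho k
  have he : ∀ i b b', (D.shiftedAl k).e i b = some b' ↔
      (D.al (k • D.rho)).e i b.2 = some b'.2 := fun i b b' => by
    rw [shiftedAl_e, Option.map_eq_some_iff]
    exact ⟨by rintro ⟨c, h1, rfl⟩; exact h1, fun h1 => ⟨_, h1, rfl⟩⟩
  have hf : ∀ i b b', (D.shiftedAl k).f i b = some b' ↔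
      (D.al (k • D.rho)).f i b.2 = some b'.2 := fun i b b' => by
    rw [shiftedAl_f, Option.map_eq_some_iff]
    exact ⟨by rintro ⟨c, h1, rfl⟩; exact h1, fun h1 => ⟨_, h1, rfl⟩⟩
  refine ⟨h.nonempty.map fun c => ((), c), fun i b => ?_, fun i b b' hb => ?_, fun i b b' hb => ?_,
    fun i b b' hb => ?_, fun i b b' hb => ?_, fun i b b' hb => ?_, fun i b b' hb => ?_,
    fun i b b' => ?_, fun i b hb => absurd hb ?_⟩
  · rw [shiftedAl_phi, shiftedAl_eps, shiftedAl_wt, h.phi_eq, map_add, LinearMap.add_apply, map_neg,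
      LinearMap.neg_apply, pairing_nsmul_rho_simpleCoroot, add_assoc, ← WithBot.coe_add, add_comm
      (-(k : ℤ))]
  · rw [shiftedAl_eps, shiftedAl_eps, h.eps_e i _ _ ((he i b b').1 hb)]
  · rw [shiftedAl_phi, shiftedAl_phi, h.phi_e i _ _ ((he i b b').1 hb), add_right_comm]
  · rw [shiftedAl_wt, shiftedAl_wt, h.wt_e i _ _ ((he i b b').1 hb), add_assoc]
  · rw [shiftedAl_eps, shiftedAl_eps, h.eps_f i _ _ ((hf i b b').1 hb)]
  · rw [shiftedAl_phi, shiftedAl_phi, h.phi_f i _ _ ((hf i b b').1 hb), add_right_comm]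
  · rw [shiftedAl_wt, shiftedAl_wt, h.wt_f i _ _ ((hf i b b').1 hb), add_sub_assoc]
  · rw [hf, he, h.f_iff_e]
  · rw [shiftedAl_phi]
    exact WithBot.coe_ne_bot

/-! ### The projection and the inclusion -/

theorem shiftInclusion_some (k : ℕ) (b : Unit × D.AlSet (k • D.rho)) :
    D.shiftInclusion k (some b) = some (D.inclusion k b.2) :=
  RootChain.toAl_eq (D.inclusion k b.2).2

theorem shiftInclusion_eq_map (k : ℕ) (b : Option (Unit × D.AlSet (k • D.rho))) :
    D.shiftInclusion k b = b.map fun c => D.inclusion k c.2 := by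
  cases b with
  | none => rfl
  | some b => exact shiftInclusion_some k b

/-- The projection is the partial inverse of the inclusion. -/
theorem shiftProjection_eq_some_iff (k : ℕ) (J : D.AlInfSet) (b : Unit × D.AlSet (k • D.rho)) :
    D.shiftProjection k (some J) = some b ↔ D.inclusion k b.2 = J := by
  change ((D.lexChain (k • D.rho)).toAl (D.shiftLevels k J.1)).map _ = _ ↔ _
  constructor
  · intro h
    obtain ⟨c, h1, rfl⟩ := Option.map_eq_some_iff.1 h
    rw [RootChain.toAl] at h1
    split_ifs at h1
    obtain rfl := Option.some.inj h1
    exact Subtype.ext (shiftLevels_neg_shiftLevels k J.1)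
  · rintro rfl
    have : D.shiftLevels k (D.inclusion k b.2).1 = b.2.1 := by
      have := shiftLevels_neg_shiftLevels (-k) b.2.1
      rwa [neg_neg] at this
    rw [this, RootChain.toAl_eq b.2.2]
    rfl

theorem alInf_phi_inclusion (k : ℕ) (i : I) (b : Unit × D.AlSet (k • D.rho)) :
    D.alInf.phi i (D.inclusion k b.2) = (D.shiftedAl k).phi i b := by
  rw [(D.isCrystal_alInf).phi_eq, (D.isCrystal_shiftedAl k).phi_eq, alInf_eps_inclusion,
    alInf_wt_inclusion, shiftedAl_eps, shiftedAl_wt]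

variable (D) in
theorem isEmbedding_shiftInclusion (k : ℕ) :
    CrystalData.IsEmbedding D (D.shiftedAl k) D.alInf (D.shiftInclusion k) := by
  refine ⟨⟨D.isCrystal_shiftedAl k, D.isCrystal_alInf, rfl, fun b b' h => ?_, fun i b b' h => ?_,
    fun i b b' h => ?_, fun i b _ _ => ?_, fun i b h _ => ?_⟩, ?_⟩
  · rw [shiftInclusion_some] at h
    obtain rfl := Option.some.inj h
    exact alInf_wt_inclusion k b.2
  · rw [shiftInclusion_some] at h
    obtain rfl := Option.some.inj h
    rw [alInf_eps_inclusion, shiftedAl_eps]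
  · rw [shiftInclusion_some] at h
    obtain rfl := Option.some.inj h
    exact alInf_phi_inclusion k i b
  · rw [shiftInclusion_some, Option.bind_some, alInf_e_inclusion, shiftedAl_e,
      shiftInclusion_eq_map, Option.map_map]
    rfl
  · cases hf : (D.al (k • D.rho)).f i b.2 with
    | none => exact absurd (by rw [shiftedAl_f, hf]; rfl) h
    | some c =>
      rw [shiftInclusion_some, Option.bind_some, alInf_f_inclusion hf, shiftedAl_f, hf]
      exact shiftInclusion_some k ((), c)
  · rw [show D.shiftInclusion k = Option.map fun c => D.inclusion k c.2 from
      funext (shiftInclusion_eq_map k)]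
    exact Option.map_injective fun b b' h => Prod.ext rfl (inclusion_injective k h)

variable (D) in
theorem isSurjection_shiftProjection (k : ℕ) :
    CrystalData.IsSurjection D D.alInf (D.shiftedAl k) (D.shiftProjection k) := by
  refine ⟨⟨D.isCrystal_alInf, D.isCrystal_shiftedAl k, rfl, fun J b h => ?_, fun i J b h => ?_,
    fun i J b h => ?_, fun i J _ h => ?_, fun i J _ h => ?_⟩, ?_⟩
  · obtain rfl := (shiftProjection_eq_some_iff k J b).1 h
    exact (alInf_wt_inclusion k b.2).symm
  · obtain rfl := (shiftProjection_eq_some_iff k J b).1 h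
    rw [alInf_eps_inclusion, shiftedAl_eps]
  · obtain rfl := (shiftProjection_eq_some_iff k J b).1 h
    exact (alInf_phi_inclusion k i b).symm
  · obtain ⟨b', h'⟩ := Option.ne_none_iff_exists'.1 h
    obtain ⟨b, hb, hb'⟩ := Option.bind_eq_some_iff.1 h'
    obtain rfl := (shiftProjection_eq_some_iff k J b).1 hb
    rw [shiftedAl_e] at hb'
    obtain ⟨c, hc, rfl⟩ := Option.map_eq_some_iff.1 hb'
    rw [h', alInf_e_inclusion, hc]
    exact (shiftProjection_eq_some_iff k _ _).2 rfl
  · obtain ⟨b', h'⟩ := Option.ne_none_iff_exists'.1 h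
    obtain ⟨b, hb, hb'⟩ := Option.bind_eq_some_iff.1 h'
    obtain rfl := (shiftProjection_eq_some_iff k J b).1 hb
    rw [shiftedAl_f] at hb'
    obtain ⟨c, hc, rfl⟩ := Option.map_eq_some_iff.1 hb'
    rw [h', alInf_f_inclusion hc]
    exact (shiftProjection_eq_some_iff k _ _).2 rfl
  · rintro (_ | b)
    · exact ⟨none, rfl⟩
    · exact ⟨some (D.inclusion k b.2), (shiftProjection_eq_some_iff k _ _).2 rfl⟩

end Morphisms

end KacMoodyDatum

theorem mainTheorem6 {I P Pv : Type*} [Fintype I] [LinearOrder I]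
    [AddCommGroup P] [Module.Free ℤ P] [Module.Finite ℤ P]
    [AddCommGroup Pv] [Module.Free ℤ Pv] [Module.Finite ℤ Pv]
    (D : KacMoodyDatum I P Pv) (k : ℕ) :
    CrystalData.IsSurjection D D.alInf (D.shiftedAl k) (D.shiftProjection k) ∧
      CrystalData.IsEmbedding D (D.shiftedAl k) D.alInf (D.shiftInclusion k) := by
  exact ⟨D.isSurjection_shiftProjection k, D.isEmbedding_shiftInclusion k⟩
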